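/- **Setting.** Let $p,d,n\ge 1$, let $\Sigma\in\mathbb R^{p\times p}$ be symmetric positive definite with $\Sigma_{ii}=1$ for all $i$, put $\Theta=\Sigma^{-1}$, and let $\sigma\ge 0$. Let $\tilde A\in\mathbb R^{d\times p}$ have i.i.d. $N(0,1/d)$ entries, let $X^{(1)},\dots,X^{(n)}$ be i.i.d. $N(0,\Sigma)$, let $W^{(1)},\dots,W^{(n)}$ be i.i.d. $N(0,\sigma^2 I_d)$, with $\tilde A$, $(X^{(s)})_s$, $(W^{(s)})_s$ independent. One observes $\tilde A$ and $Y^{(s)}=\tilde A X^{(s)}+W^{(s)}$. Put $$\hat\Sigma=I+\frac{d}{d+1}\Big[\tilde A^{\top}\Big(\frac1n\sum_{s=1}^nY^{(s)}Y^{(s)\top}\Big)\tilde A\Big]_{\rm off},$$ where $[\cdot]_{\rm off}$ replaces the diagonal by zero, and for $\lambda>0$ let $\hat\Theta$ be a minimizer, over symmetric positive definite matrices $T$, of $$-\log\det T+\operatorname{tr}(T\hat\Sigma)+\lambda\sum_{i\ne j}|T_{ij}|.$$ **Parameters.** $S=\{(i,j):\Theta_{ij}\neq0\}$ (it contains the diagonal),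 $S^c$ is its complement; $\deg=\max_j\#\{i:\Theta_{ij}\ne0\}$; $\kappa_\Sigma=\max_i\sum_j|\Sigma_{ij}|$; $\Gamma=\Sigma\otimes\Sigma$; $\kappa_\Gamma$ is the maximal absolute row sum of $(\Gamma_{SS})^{-1}$; $\|M\|_\infty=\max_{i,j}|M_{ij}|$. For $C>0$ put $$\begin{aligned}\tau_\infty=C\Big[&\sqrt{\tfrac{\log p}{d}}\max_j\|\Sigma_j\|_2+\tfrac{\log p}{d}\big(1+\tfrac pd\big)\Big(\sum_{i\neq j}\Sigma_{ij}^2\Big)^{1/2}+\tfrac{\sqrt p\,\log p}{\sqrt{nd}}+\tfrac{p(\log p)^{3/2}}{\sqrt n\,d}\big(1+\tfrac pd\big)\\&+\tfrac{\sqrt{p\log p}}{d}+\tfrac{p\sqrt{\log p}}{d^{3/2}}+\sqrt{\tfrac{\log p}{n}}+\sigma^2\Big(1+\sqrt{\tfrac{\log p}{d}}\Big)\sqrt{\tfrac{\log p}{d}}\Big(1+\max\big\{\sqrt{\tfrac dn},\tfrac dn\big\}\Big)\Big],\end{aligned}$$ where $\Sigma_j$ is the $j$-th column of $\Sigma$.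 **Theorem.** There are absolute constants $C,a_0,a_1,a_2,a_3,a_4>0$ such that the following two statements hold. (1) Let $0<\theta\le1$, assume the irrepresentability condition $\max_{e\in S^c}\|\Gamma_{eS}(\Gamma_{SS})^{-1}\|_1\le1-\theta$, put $r=2\kappa_\Gamma(1+8/\theta)\tau_\infty$, and assume $$r\le\frac{1}{3\kappa_\Sigma\deg}\min\Big\{1,\frac1{\kappa_\Sigma^2\kappa_\Gamma}\Big\},\qquad \tfrac32\deg\,\kappa_\Sigma^3\,r^2\le\tau_\infty .$$ Then, with $\lambda=8\tau_\infty/\theta$, with probability at least $1-a_0p^{-1}-a_1p^2e^{-a_2d}-a_3p^2e^{-a_4p}$ the minimizer $\hat\Theta$ exists and is unique, $\hat\Theta_{ij}=0$ for all $(i,j)\in S^c$, $\|\hat\Theta-\Theta\|_\infty\le 2\kappa_\Gamma(1+8/\theta)\tau_\infty$, and, if $|\Theta_{ij}|\ge2\kappa_\Gamma(1+8/\theta)\tau_\infty$ for all $(i,j)\in S$ with $i\neq j$, then $\operatorname{sign}(\hat\Theta)=\operatorname{sign}(\Theta)$ entrywise. (2) For all $\theta\in(0,1]$, $b>0$ and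 bounds $\kappa_1,\kappa_2,\sigma_0,D$ there is $K>0$ such that, whenever $\Sigma$ satisfies the irrepresentability condition with $\theta$, $\kappa_\Sigma\le\kappa_1$, $\kappa_\Gamma\le\kappa_2$, $\deg\le D$, $\sigma\le\sigma_0$, $|\Theta_{ij}|\ge b$ for all $(i,j)\in S$ with $i\ne j$, and $$d\ge Kp^{0.8},\qquad n\ge Kp^{0.8}\log^3p,\qquad d\le\max\{p,n\},$$ then, with $\lambda=8\tau_\infty/\theta$, with probability at least $1-a_0p^{-1}-a_1p^2e^{-a_2d}-a_3p^2e^{-a_4p}$ the minimizer $\hat\Theta$ exists and is unique and $\operatorname{sign}(\hat\Theta)=\operatorname{sign}(\Theta)$ entrywise. -/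

import Mathlib

open MeasureTheory ProbabilityTheory Matrix
open scoped NNReal ENNReal Kronecker

universe u

noncomputable section

namespace IndirectGGM

/-! ### Matrix quantities -/

/-- `max_{i,j} |M i j|`. -/
def entryMax {p : ℕ} (M : Matrix (Fin p) (Fin p) ℝ) : ℝ :=
  ⨆ q : Fin p × Fin p, |M q.1 q.2|

/-- `max_i ∑_j |M i j|`, the operator norm from `ℓ_∞` to `ℓ_∞`. -/
def maxRowSum {ι : Type*} [Fintype ι] (M : Matrix ι ι ℝ) : ℝ :=
  ⨆ i, ∑ j, |M i j|

/-- The largest Euclidean norm of a column. -/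
def maxColNorm {p : ℕ} (M : Matrix (Fin p) (Fin p) ℝ) : ℝ :=
  ⨆ j, Real.sqrt (∑ i, M i j ^ 2)

/-- The matrix with the diagonal entries replaced by zero. -/
def offPart {p : ℕ} (M : Matrix (Fin p) (Fin p) ℝ) : Matrix (Fin p) (Fin p) ℝ :=
  Matrix.of fun i j => if i = j then 0 else M i j

/-- `∑_{i ≠ j} |M i j|`. -/
def offL1 {p : ℕ} (M : Matrix (Fin p) (Fin p) ℝ) : ℝ :=
  ∑ i, ∑ j, |offPart M i j|

/-- `(∑_{i ≠ j} (M i j)^2)^{1/2}`. -/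
def offFrobenius {p : ℕ} (M : Matrix (Fin p) (Fin p) ℝ) : ℝ :=
  Real.sqrt (∑ i, ∑ j, offPart M i j ^ 2)

/-! ### Parameters of the Gaussian graphical model with covariance `Sig` -/

/-- The support of the precision matrix. It contains the diagonal (a positive definite matrix has
nonzero diagonal), so its complement consists of the off-diagonal zeros. -/
def precSupport {p : ℕ} (Sig : Matrix (Fin p) (Fin p) ℝ) : Set (Fin p × Fin p) :=
  {q | Sig⁻¹ q.1 q.2 ≠ 0}

instance {p : ℕ} (Sig : Matrix (Fin p) (Fin p) ℝ) : Fintype (precSupport Sig) :=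
  Fintype.ofFinite _

/-- The largest number of nonzero entries in a column of the precision matrix. -/
def maxDeg {p : ℕ} (Sig : Matrix (Fin p) (Fin p) ℝ) : ℕ :=
  ⨆ j : Fin p, Set.ncard {i : Fin p | Sig⁻¹ i j ≠ 0}

/-- `κ_Σ`. -/
def kappaSigma {p : ℕ} (Sig : Matrix (Fin p) (Fin p) ℝ) : ℝ := maxRowSum Sig

/-- `Γ = Σ ⊗ Σ`. -/
def fisher {p : ℕ} (Sig : Matrix (Fin p) (Fin p) ℝ) :
    Matrix (Fin p × Fin p) (Fin p × Fin p) ℝ :=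
  Sig ⊗ₖ Sig

/-- `Γ_{SS}`. -/
def fisherSS {p : ℕ} (Sig : Matrix (Fin p) (Fin p) ℝ) :
    Matrix (precSupport Sig) (precSupport Sig) ℝ :=
  (fisher Sig).submatrix Subtype.val Subtype.val

open Classical in
/-- `(Γ_{SS})⁻¹`. -/
def fisherSSInv {p : ℕ} (Sig : Matrix (Fin p) (Fin p) ℝ) :
    Matrix (precSupport Sig) (precSupport Sig) ℝ :=
  (fisherSS Sig)⁻¹

/-- `κ_Γ`, the `ℓ_∞` operator norm of `(Γ_{SS})⁻¹`. -/
def kappaGamma {p : ℕ} (Sig : Matrix (Fin p) (Fin p) ℝ) : ℝ := maxRowSum (fisherSSInv Sig)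

/-- The irrepresentability condition
`max_{e ∉ S} ‖Γ_{eS} (Γ_{SS})⁻¹‖_1 ≤ 1 - θ`. -/
def Irrepresentable {p : ℕ} (Sig : Matrix (Fin p) (Fin p) ℝ) (θ : ℝ) : Prop :=
  ∀ e : Fin p × Fin p, e ∉ precSupport Sig →
    ∑ t : precSupport Sig,
      |((fun s : precSupport Sig => fisher Sig e s) ᵥ* fisherSSInv Sig) t| ≤ 1 - θ

/-! ### Observations, covariance estimator, graphical lasso -/

/-- The random inputs: a sensing matrix `A` with i.i.d. `N(0, 1/d)` entries, i.i.d. signals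
`X s ∼ N(0, Sig)`, i.i.d. noise entries `W s k ∼ N(0, σ²)`, and `A`, `X`, `W` independent. -/
structure IsSensingModel {p d n : ℕ} {Ω : Type*} [MeasurableSpace Ω] (P : Measure Ω)
    (Sig : Matrix (Fin p) (Fin p) ℝ) (σ : ℝ≥0)
    (A : Ω → Matrix (Fin d) (Fin p) ℝ) (X : Fin n → Ω → EuclideanSpace ℝ (Fin p))
    (W : Fin n → Ω → Fin d → ℝ) : Prop where
  law_A : ∀ k j, HasLaw (fun ω => A ω k j) (gaussianReal 0 (d : ℝ≥0)⁻¹) P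
  law_X : ∀ s, HasLaw (X s) (multivariateGaussian 0 Sig) P
  law_W : ∀ s k, HasLaw (fun ω => W s ω k) (gaussianReal 0 (σ ^ 2)) P
  indep_A : iIndepFun (fun (q : Fin d × Fin p) ω => A ω q.1 q.2) P
  indep_X : iIndepFun X P
  indep_W : iIndepFun (fun (q : Fin n × Fin d) ω => W q.1 ω q.2) P
  indep_A_XW : IndepFun (fun ω (q : Fin d × Fin p) => A ω q.1 q.2)
    (fun ω => ((fun s => X s ω), (fun (q : Fin n × Fin d) => W q.1 ω q.2))) P
  indep_X_W : IndepFun (fun ω s => X s ω) (fun ω (q : Fin n × Fin d) => W q.1 ω q.2) P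

/-- One observation `y = A x + w`. -/
def observe {p d : ℕ} (A : Matrix (Fin d) (Fin p) ℝ) (x : EuclideanSpace ℝ (Fin p))
    (w : Fin d → ℝ) : Fin d → ℝ :=
  (A *ᵥ fun j => x j) + w

/-- The covariance estimator `I + d/(d+1) [Aᵀ (n⁻¹ ∑ y yᵀ) A]_off`. -/
def covEstimator {p d n : ℕ} (A : Matrix (Fin d) (Fin p) ℝ) (y : Fin n → Fin d → ℝ) :
    Matrix (Fin p) (Fin p) ℝ :=
  1 + ((d : ℝ) / ((d : ℝ) + 1)) •
    offPart (Aᵀ * ((n : ℝ)⁻¹ • ∑ s, vecMulVec (y s) (y s)) * A)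

/-- `-log det T + tr(T R) + lam ∑_{i ≠ j} |T i j|`. -/
def glassoObjective {p : ℕ} (R : Matrix (Fin p) (Fin p) ℝ) (lam : ℝ)
    (T : Matrix (Fin p) (Fin p) ℝ) : ℝ :=
  -Real.log T.det + (T * R).trace + lam * offL1 T

/-- `T` minimizes the graphical lasso objective over the positive definite matrices. -/
def IsGraphicalLasso {p : ℕ} (R : Matrix (Fin p) (Fin p) ℝ) (lam : ℝ)
    (T : Matrix (Fin p) (Fin p) ℝ) : Prop :=
  T.PosDef ∧ IsMinOn (glassoObjective R lam) {T' | T'.PosDef} T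

/-! ### Error level and failure probability -/

/-- The error level `τ_∞`, with one constant `C` in front of all its terms. -/
def tauInf (C : ℝ) {p : ℕ} (d n : ℕ) (Sig : Matrix (Fin p) (Fin p) ℝ) (σ : ℝ) : ℝ :=
  C * (Real.sqrt (Real.log p / d) * maxColNorm Sig
    + Real.log p / d * (1 + (p : ℝ) / d) * offFrobenius Sig
    + Real.sqrt p * Real.log p / Real.sqrt ((n : ℝ) * d)
    + (p : ℝ) * Real.sqrt (Real.log p) ^ 3 / (Real.sqrt n * d) * (1 + (p : ℝ) / d)
    + Real.sqrt ((p : ℝ) * Real.log p) / d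
    + (p : ℝ) * Real.sqrt (Real.log p) / Real.sqrt d ^ 3
    + Real.sqrt (Real.log p / n)
    + σ ^ 2 * (1 + Real.sqrt (Real.log p / d)) * Real.sqrt (Real.log p / d)
        * (1 + max (Real.sqrt ((d : ℝ) / n)) ((d : ℝ) / n)))

/-- `a₀ p⁻¹ + a₁ p² e^{-a₂ d} + a₃ p² e^{-a₄ p}`. -/
def failureBound (a₀ a₁ a₂ a₃ a₄ : ℝ) (p d : ℕ) : ℝ :=
  a₀ / p + a₁ * (p : ℝ) ^ 2 * Real.exp (-a₂ * d) + a₃ * (p : ℝ) ^ 2 * Real.exp (-a₄ * p)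

/-- `2 κ_Γ (1 + 8/θ) τ`, the error bound of the estimate of the precision matrix. -/
def precError {p : ℕ} (Sig : Matrix (Fin p) (Fin p) ℝ) (θ τ : ℝ) : ℝ :=
  2 * kappaGamma Sig * (1 + 8 / θ) * τ

end IndirectGGM

end

/-!
Once every entry of `Σ̂ - Σ` is at most `τ / 2`, recovery is deterministic, by a primal-dual
witness. Let `T` minimize the graphical lasso objective over the matrices supported in `S`;
stationarity on `S` bounds `T⁻¹ - Σ` there. Expanding the inverse, the perturbations `Δ` supported
in `S` for which `(Θ + Δ)⁻¹` agrees with `T⁻¹` on `S` are the fixed points of a Newton map built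
from `(Γ_SS)⁻¹`. The remainder being quadratic, this map contracts a box of radius `r`, and the
strict concavity of `log det` identifies `T` with `Θ + Δ` for its fixed point `Δ`, so the
entries of `T - Θ` are smaller than `r`. Irrepresentability then gives the stationarity of `T`
outside `S`, so that `T` solves the full problem.

For the entrywise bound let `G = ÃᵀÃ`. Given `Ã`, the entries of `Ãᵀ (n⁻¹ ∑ Y Yᵀ) Ã` are empirical
mixed moments of Gaussian variables; by polarization and Chernoff bounds for sums of squares they
concentrate around the entries of `G Σ G + σ² G`. It remains to compare `G Σ G` with `Σ`. The
delicate part is the off-diagonal part of the bilinear form `∑ G_ik Σ_kl G_lj`: replacing column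
`j` of `Ã` by its component orthogonal to column `i` makes the two factors conditionally
independent.

For the orders of `d` and `n`, each term of `τ_∞` is compared with `L⁻¹`, where `L² = K`, as a
monomial in `p ^ (1 / 10)` and `log p`.
-/

namespace IndirectGGM

/-! ### Row sums -/

section RowSums

variable {ι κ η : Type*}

theorem sum_abs_le_maxRowSum [Fintype ι] (M : Matrix ι ι ℝ) (i : ι) :
    ∑ j, |M i j| ≤ maxRowSum M :=
  le_ciSup (f := fun i => ∑ j, |M i j|) (Set.finite_range _).bddAbove i

theorem abs_dotProduct_le [Fintype κ] {u x : κ → ℝ} {a h : ℝ} (hh : 0 ≤ h)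
    (hu : ∑ k, |u k| ≤ a) (hx : ∀ k, |x k| ≤ h) : |u ⬝ᵥ x| ≤ a * h :=
  calc |∑ k, u k * x k| ≤ ∑ k, |u k * x k| := Finset.abs_sum_le_sum_abs _ _
    _ = ∑ k, |u k| * |x k| := by simp only [abs_mul]
    _ ≤ ∑ k, |u k| * h := by gcongr with k; exact hx k
    _ ≤ a * h := by rw [← Finset.sum_mul]; gcongr

theorem abs_mulVec_le [Fintype κ] {M : Matrix ι κ ℝ} {a h : ℝ} (hh : 0 ≤ h)
    (hM : ∀ i, ∑ j, |M i j| ≤ a) {x : κ → ℝ} (hx : ∀ j, |x j| ≤ h) (i : ι) :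
    |(M *ᵥ x) i| ≤ a * h :=
  abs_dotProduct_le hh (hM i) hx

theorem sum_abs_mul_le [Fintype κ] [Fintype η] {A : Matrix ι κ ℝ} {B : Matrix κ η ℝ} {a b : ℝ}
    (hb : 0 ≤ b) (hA : ∀ i, ∑ j, |A i j| ≤ a) (hB : ∀ i, ∑ j, |B i j| ≤ b) (i : ι) :
    ∑ j, |(A * B) i j| ≤ a * b :=
  calc ∑ j, |∑ k, A i k * B k j| ≤ ∑ j, ∑ k, |A i k| * |B k j| := by
        simp only [← abs_mul]
        gcongr
        exact Finset.abs_sum_le_sum_abs _ _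
    _ = ∑ k, |A i k| * ∑ j, |B k j| := by
        rw [Finset.sum_comm]; simp_rw [Finset.mul_sum]
    _ ≤ ∑ k, |A i k| * b := by gcongr with k; exact hB k
    _ ≤ a * b := by rw [← Finset.sum_mul]; gcongr; exact hA i

theorem abs_mul_mul_apply_le [Fintype κ] [Fintype η] {A : Matrix ι κ ℝ} {H : Matrix κ η ℝ}
    {B : Matrix η ι ℝ} {a b h : ℝ} (hh : 0 ≤ h) (ha : 0 ≤ a) (hA : ∀ i, ∑ j, |A i j| ≤ a)
    (hH : ∀ i j, |H i j| ≤ h) (hB : ∀ j, ∑ i, |B i j| ≤ b) (i j : ι) :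
    |(A * H * B) i j| ≤ a * h * b := by
  have hAH : ∀ l, |(A * H) i l| ≤ a * h := fun l => abs_dotProduct_le hh (hA i) fun k => hH k l
  have := abs_dotProduct_le (by positivity) (hB j) hAH
  rwa [dotProduct_comm, mul_comm b] at this

theorem sum_abs_le_of_eq_sub_mul [Fintype ι] {M E N : Matrix ι ι ℝ} {a c : ℝ} (hc : c < 1)
    (hN : N = M - E * N) (hM : ∀ i, ∑ j, |M i j| ≤ a) (hE : ∀ i, ∑ j, |E i j| ≤ c)
    (i : ι) : ∑ j, |N i j| ≤ (1 - c)⁻¹ * a := by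
  set b := maxRowSum N
  have hrow := sum_abs_le_maxRowSum N
  have hb : 0 ≤ b := (Finset.sum_nonneg fun j _ => abs_nonneg _).trans (hrow i)
  have : Nonempty ι := ⟨i⟩
  have hle : b ≤ a + c * b := ciSup_le fun k =>
    calc ∑ j, |N k j| = ∑ j, |M k j - (E * N) k j| := by
          conv_lhs => rw [hN]
          rfl
      _ ≤ ∑ j, (|M k j| + |(E * N) k j|) := by gcongr; exact abs_sub _ _
      _ ≤ a + c * b := by
          rw [Finset.sum_add_distrib]
          exact add_le_add (hM k) (sum_abs_mul_le hb hE hrow k)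
  refine (hrow i).trans ?_
  rw [inv_mul_eq_div, le_div_iff₀ (by linarith)]
  linarith

theorem abs_lt_one_of_mulVec_eq_smul [Fintype ι] {M : Matrix ι ι ℝ}
    (hM : ∀ i, ∑ j, |M i j| < 1) {x : ι → ℝ} (hx : x ≠ 0) {μ : ℝ} (h : M *ᵥ x = μ • x) :
    |μ| < 1 := by
  obtain ⟨k, hk⟩ := Function.ne_iff.mp hx
  have : Nonempty ι := ⟨k⟩
  obtain ⟨l, hl⟩ := Finite.exists_max (fun k => |x k|)
  have hpos : 0 < |x l| := (abs_pos.mpr hk).trans_le (hl k)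
  have hle : |(M *ᵥ x) l| ≤ (∑ j, |M l j|) * |x l| := abs_dotProduct_le hpos.le le_rfl hl
  rw [h, Pi.smul_apply, smul_eq_mul, abs_mul] at hle
  exact (le_of_mul_le_mul_right hle hpos).trans_lt (hM l)

end RowSums

/-! ### Positive definite matrices -/

section PosDef

variable {ι : Type*} {M H : Matrix ι ι ℝ}

theorem transpose_eq_of_posDef (h : M.PosDef) : Mᵀ = M := by
  simpa only [IsHermitian, conjTranspose_eq_transpose_of_trivial] using h.isHermitian

theorem apply_comm_of_posDef (h : M.PosDef) (i j : ι) : M i j = M j i :=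
  congrFun (congrFun (transpose_eq_of_posDef h) j) i

theorem isClosed_posSemidef [Finite ι] : IsClosed {N : Matrix ι ι ℝ | N.PosSemidef} := by
  have := Fintype.ofFinite ι
  have : {N : Matrix ι ι ℝ | N.PosSemidef} =
      {N | Nᵀ = N} ∩ ⋂ x : ι → ℝ, {N | 0 ≤ x ⬝ᵥ (N *ᵥ x)} := by
    ext N
    simp only [Set.mem_ofPred_eq, Set.mem_inter_iff, Set.mem_iInter,
      posSemidef_iff_dotProduct_mulVec, IsHermitian, conjTranspose_eq_transpose_of_trivial,
      star_trivial]
  rw [this]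
  refine IsClosed.inter (isClosed_eq (by fun_prop) (by fun_prop)) (isClosed_iInter fun x => ?_)
  exact isClosed_le (by fun_prop) (by fun_prop)

variable [Fintype ι]

theorem exists_transpose_mul_self (hM : M.PosSemidef) : ∃ B : Matrix ι ι ℝ, M = Bᵀ * B := by
  classical
  open scoped MatrixOrder Matrix.Norms.L2Operator in
  obtain ⟨B, hB⟩ := CStarAlgebra.nonneg_iff_eq_star_mul_self.mp hM.nonneg
  exact ⟨B, by simpa [star_eq_conjTranspose, conjTranspose_eq_transpose_of_trivial] using hB⟩

theorem posSemidef_mul_mul_transpose {η : Type*} [Finite η] (hM : M.PosSemidef)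
    (B : Matrix η ι ℝ) : (B * M * Bᵀ).PosSemidef := by
  simpa only [conjTranspose_eq_transpose_of_trivial] using hM.mul_mul_conjTranspose_same B

theorem abs_apply_le_mean_diag {η : Type*} [Finite η] {N : Matrix η η ℝ} (hN : N.PosSemidef)
    (i j : η) : |N i j| ≤ (N i i + N j j) / 2 := by
  have := Fintype.ofFinite η
  obtain ⟨B, rfl⟩ := exists_transpose_mul_self hN
  simp only [mul_apply, transpose_apply]
  rw [← Finset.sum_add_distrib, Finset.sum_div]
  refine (Finset.abs_sum_le_sum_abs _ _).trans (Finset.sum_le_sum fun k _ => ?_)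
  rw [abs_le]
  constructor <;> nlinarith [sq_nonneg (B k i - B k j), sq_nonneg (B k i + B k j)]

theorem abs_apply_le_trace (hM : M.PosSemidef) (i j : ι) : |M i j| ≤ M.trace := by
  have hdiag : ∀ k, M k k ≤ M.trace := fun k =>
    Finset.single_le_sum (f := fun k => M k k) (fun l _ => hM.diag_nonneg) (Finset.mem_univ k)
  linarith [hdiag i, hdiag j, abs_apply_le_mean_diag hM i j]

theorem isCompact_posSemidef_trace_le (b : ℝ) :
    IsCompact {N : Matrix ι ι ℝ | N.PosSemidef ∧ N.trace ≤ b} := by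
  have hbox : IsCompact (Set.univ.pi fun _ : ι => Set.univ.pi fun _ : ι => Set.Icc (-b) b) :=
    isCompact_univ_pi fun _ => isCompact_univ_pi fun _ => isCompact_Icc
  refine IsCompact.of_isClosed_subset hbox ?_ ?_
  · exact isClosed_posSemidef.inter (isClosed_le (f := fun N : Matrix ι ι ℝ => N.trace)
      (by fun_prop) continuous_const)
  · rintro N ⟨hN, hb⟩ i - j -
    exact abs_le.mp ((abs_apply_le_trace hN i j).trans hb)

section Invertible

variable [DecidableEq ι]

theorem isUnit_det_of_posDef (h : M.PosDef) : IsUnit M.det :=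
  (isUnit_iff_isUnit_det M).mp h.isUnit

theorem exists_isUnit_transpose_mul_self (hM : M.PosDef) :
    ∃ B : Matrix ι ι ℝ, IsUnit B.det ∧ M = Bᵀ * B := by
  obtain ⟨B, hB⟩ := exists_transpose_mul_self hM.posSemidef
  refine ⟨B, isUnit_of_mul_isUnit_right (x := Bᵀ.det) ?_, hB⟩
  rw [← det_mul, ← hB]
  exact isUnit_det_of_posDef hM

theorem posDef_mul_mul_transpose (hM : M.PosDef) {B : Matrix ι ι ℝ} (hB : IsUnit B.det) :
    (B * M * Bᵀ).PosDef := by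
  have := hM.mul_mul_conjTranspose_same (B := B)
    (vecMul_injective_of_isUnit ((isUnit_iff_isUnit_det B).mpr hB))
  rwa [conjTranspose_eq_transpose_of_trivial] at this

theorem inv_mul_mul_mul_transpose_mul_inv {B : Matrix ι ι ℝ} (hB : IsUnit B.det)
    (N : Matrix ι ι ℝ) : B⁻¹ * (B * N * Bᵀ) * (B⁻¹)ᵀ = N := by
  rw [transpose_nonsing_inv]
  calc B⁻¹ * (B * N * Bᵀ) * (Bᵀ)⁻¹ = (B⁻¹ * B) * N * (Bᵀ * (Bᵀ)⁻¹) := by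
        simp only [Matrix.mul_assoc]
    _ = N := by
        rw [nonsing_inv_mul _ hB, mul_nonsing_inv _ (by rwa [det_transpose]), Matrix.one_mul,
          Matrix.mul_one]

/-- An eigenvector `v` of `B D Bᵀ` yields the eigenvector `Bᵀ v` of `BᵀB D`, with the same
eigenvalue. -/
theorem posDef_one_add_mul_mul_transpose {B D : Matrix ι ι ℝ} (hB : IsUnit B.det) (hD : Dᵀ = D)
    (hrow : ∀ i, ∑ j, |(Bᵀ * B * D) i j| < 1) : (1 + B * D * Bᵀ).PosDef := by
  have hherm : (1 + B * D * Bᵀ).IsHermitian := by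
    simp [IsHermitian, conjTranspose_eq_transpose_of_trivial, transpose_mul, hD, Matrix.mul_assoc]
  rw [hherm.posDef_iff_eigenvalues_pos]
  intro i
  set v : ι → ℝ := ⇑(hherm.eigenvectorBasis i)
  set μ := hherm.eigenvalues i
  have hv : (1 + B * D * Bᵀ) *ᵥ v = μ • v := hherm.mulVec_eigenvectorBasis i
  have hv0 : v ≠ 0 := fun h => hherm.eigenvectorBasis.toBasis.ne_zero i (by
    ext k; simpa using congrFun h k)
  have hBv0 : Bᵀ *ᵥ v ≠ 0 := fun h => hv0 <| mulVec_injective_of_isUnit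
    ((isUnit_iff_isUnit_det Bᵀ).mpr (by rwa [det_transpose])) (by rw [h, mulVec_zero])
  have heig : (Bᵀ * B * D) *ᵥ (Bᵀ *ᵥ v) = (μ - 1) • (Bᵀ *ᵥ v) := by
    rw [sub_smul, one_smul, ← mulVec_smul, ← hv, add_mulVec, one_mulVec, mulVec_add,
      add_sub_cancel_left]
    simp only [mulVec_mulVec, Matrix.mul_assoc]
  linarith [(abs_lt.mp (abs_lt_one_of_mulVec_eq_smul hrow hBv0 heig)).1]

theorem posDef_inv_add (hM : M.PosDef) (hH : Hᵀ = H) (hrow : ∀ i, ∑ j, |(M * H) i j| < 1) :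
    (M⁻¹ + H).PosDef := by
  obtain ⟨B, hB, rfl⟩ := exists_isUnit_transpose_mul_self hM
  have hBinv : IsUnit (B⁻¹).det := isUnit_nonsing_inv_det B hB
  have hfac : (Bᵀ * B)⁻¹ + H = B⁻¹ * (1 + B * H * Bᵀ) * (B⁻¹)ᵀ := by
    rw [Matrix.mul_add, Matrix.add_mul, inv_mul_mul_mul_transpose_mul_inv hB, Matrix.mul_inv_rev,
      Matrix.mul_one, transpose_nonsing_inv]
  rw [hfac]
  exact posDef_mul_mul_transpose (posDef_one_add_mul_mul_transpose hB hH hrow) hBinv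

end Invertible

theorem isCompact_posSemidef_trace_mul_le (hM : M.PosDef) (b : ℝ) :
    IsCompact {N : Matrix ι ι ℝ | N.PosSemidef ∧ (N * M).trace ≤ b} := by
  classical
  obtain ⟨B, hB, rfl⟩ := exists_isUnit_transpose_mul_self hM
  have htrace : ∀ N : Matrix ι ι ℝ, (B * N * Bᵀ).trace = (N * (Bᵀ * B)).trace := fun N => by
    rw [Matrix.mul_assoc, trace_mul_comm, Matrix.mul_assoc]
  refine ((isCompact_posSemidef_trace_le b).image
    (f := fun N => B⁻¹ * N * (B⁻¹)ᵀ) (by fun_prop)).of_isClosed_subset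
    (isClosed_posSemidef.inter (isClosed_le
      (f := fun N : Matrix ι ι ℝ => (N * (Bᵀ * B)).trace) (by fun_prop) continuous_const)) ?_
  rintro N ⟨hN, hb⟩
  exact ⟨B * N * Bᵀ, ⟨posSemidef_mul_mul_transpose hN B, (htrace N).trans_le hb⟩,
    inv_mul_mul_mul_transpose_mul_inv hB N⟩

theorem eventually_posDef_add_smul {ι : Type*} [Finite ι] {M H : Matrix ι ι ℝ} (hM : M.PosDef)
    (hH : Hᵀ = H) : ∀ᶠ t : ℝ in nhds 0, (M + t • H).PosDef := by
  classical
  have := Fintype.ofFinite ι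
  have hsmall : ∀ᶠ t : ℝ in nhds 0, ∀ i, ∑ j, |(M⁻¹ * (t • H)) i j| < 1 := by
    rw [Filter.eventually_all]
    intro i
    have : ContinuousAt (fun t : ℝ => ∑ j, |(M⁻¹ * (t • H)) i j|) 0 := by
      simp only [mul_smul_comm, Matrix.smul_apply, smul_eq_mul]
      fun_prop
    exact this.eventually_lt continuousAt_const (by simp)
  filter_upwards [hsmall] with t ht
  rw [← nonsing_inv_nonsing_inv M (isUnit_det_of_posDef hM)]
  exact posDef_inv_add hM.inv (by rw [transpose_smul, hH]) ht

end PosDef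

/-! ### The logarithm of the determinant -/

section LogDet

variable {ι : Type*} [Fintype ι] [DecidableEq ι] {M A B : Matrix ι ι ℝ}

theorem log_det_eq_sum_log_eigenvalues (hM : M.PosDef) :
    Real.log M.det = ∑ i, Real.log (hM.isHermitian.eigenvalues i) := by
  rw [hM.isHermitian.det_eq_prod_eigenvalues]
  simp only [RCLike.ofReal_real_eq_id, id_eq]
  exact Real.log_prod fun i _ => (hM.eigenvalues_pos i).ne'

theorem trace_sub_card_eq_sum_eigenvalues_sub_one (hM : M.IsHermitian) :
    M.trace - Fintype.card ι = ∑ i, (hM.eigenvalues i - 1) := by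
  simp [hM.trace_eq_sum_eigenvalues]

theorem log_det_le_trace_sub_card (hM : M.PosDef) :
    Real.log M.det ≤ M.trace - Fintype.card ι := by
  rw [log_det_eq_sum_log_eigenvalues hM, trace_sub_card_eq_sum_eigenvalues_sub_one hM.isHermitian]
  exact Finset.sum_le_sum fun i _ => Real.log_le_sub_one_of_pos (hM.eigenvalues_pos i)

theorem eq_one_of_trace_sub_card_le_log_det (hM : M.PosDef)
    (h : M.trace - Fintype.card ι ≤ Real.log M.det) : M = 1 := by
  have heig : ∀ i, hM.isHermitian.eigenvalues i = 1 := by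
    by_contra! hne
    obtain ⟨i, hi⟩ := hne
    rw [log_det_eq_sum_log_eigenvalues hM,
      trace_sub_card_eq_sum_eigenvalues_sub_one hM.isHermitian] at h
    exact h.not_gt <| Finset.sum_lt_sum
      (fun i _ => Real.log_le_sub_one_of_pos (hM.eigenvalues_pos i))
      ⟨i, Finset.mem_univ i, Real.log_lt_sub_one_of_pos (hM.eigenvalues_pos i) hi⟩
  have hdiag : diagonal (RCLike.ofReal ∘ hM.isHermitian.eigenvalues : ι → ℝ) = 1 := by
    rw [← diagonal_one]; congr 1; ext i; simp [heig i]
  have hspec := hM.isHermitian.spectral_theorem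
  rwa [hdiag, map_one] at hspec

/-- Reduction of the tangent inequality of `log det` at `A` to the one at the identity. -/
theorem exists_whitening (hA : A.PosDef) (hB : B.PosDef) :
    ∃ C : Matrix ι ι ℝ, A⁻¹ = Cᵀ * C ∧ (C * B * Cᵀ).PosDef ∧
      (C * B * Cᵀ).trace = (A⁻¹ * B).trace ∧
      Real.log (C * B * Cᵀ).det = Real.log B.det - Real.log A.det := by
  obtain ⟨C, hCu, hC⟩ := exists_isUnit_transpose_mul_self hA.inv
  refine ⟨C, hC, posDef_mul_mul_transpose hB hCu, ?_, ?_⟩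
  · rw [hC, trace_mul_comm, ← Matrix.mul_assoc]
  · have hdet : (A.det)⁻¹ = C.det * C.det := by
      simpa [det_nonsing_inv, Ring.inverse_eq_inv'] using congrArg det hC
    rw [← Real.log_div hB.det_pos.ne' hA.det_pos.ne', div_eq_mul_inv, hdet, det_mul, det_mul,
      det_transpose]
    congr 1
    ring

theorem log_det_sub_log_det_le (hA : A.PosDef) (hB : B.PosDef) :
    Real.log B.det - Real.log A.det ≤ (A⁻¹ * B).trace - Fintype.card ι := by
  obtain ⟨C, -, hpos, htrace, hlog⟩ := exists_whitening hA hB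
  rw [← hlog, ← htrace]
  exact log_det_le_trace_sub_card hpos

theorem eq_of_trace_sub_card_le_log_det_sub (hA : A.PosDef) (hB : B.PosDef)
    (h : (A⁻¹ * B).trace - Fintype.card ι ≤ Real.log B.det - Real.log A.det) : B = A := by
  obtain ⟨C, hC, hpos, htrace, hlog⟩ := exists_whitening hA hB
  rw [← hlog, ← htrace] at h
  have hCB : C * (B * Cᵀ) = 1 := by
    rw [← Matrix.mul_assoc]; exact eq_one_of_trace_sub_card_le_log_det hpos h
  have hBA : B * A⁻¹ = 1 := by rw [hC, ← Matrix.mul_assoc, mul_eq_one_comm, hCB]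
  calc B = B * (A⁻¹ * A) := by
        rw [nonsing_inv_mul _ (isUnit_det_of_posDef hA), Matrix.mul_one]
    _ = A := by rw [← Matrix.mul_assoc, hBA, Matrix.one_mul]

theorem eq_of_trace_inv_sub_inv_mul_eq_zero (hA : A.PosDef) (hB : B.PosDef)
    (h : ((A⁻¹ - B⁻¹) * (A - B)).trace = 0) : A = B := by
  have htangent := log_det_sub_log_det_le hA hB
  rw [Matrix.sub_mul, Matrix.mul_sub, Matrix.mul_sub, nonsing_inv_mul _ (isUnit_det_of_posDef hA),
    nonsing_inv_mul _ (isUnit_det_of_posDef hB)] at h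
  simp only [trace_sub, trace_one] at h
  exact eq_of_trace_sub_card_le_log_det_sub hB hA (by linarith)

end LogDet

/-! ### Minimizers of penalized log-determinant objectives -/

section Existence

variable {ι : Type*} [Fintype ι] {M : Matrix ι ι ℝ}

theorem trace_mul_nonneg {T : Matrix ι ι ℝ} (hT : T.PosSemidef) (hM : M.PosSemidef) :
    0 ≤ (T * M).trace := by
  obtain ⟨B, rfl⟩ := exists_transpose_mul_self hM
  rw [← Matrix.mul_assoc, trace_mul_comm, ← Matrix.mul_assoc]
  exact (posSemidef_mul_mul_transpose hT B).trace_nonneg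

variable [DecidableEq ι]

theorem exists_log_det_le_add_trace_mul_half (hM : M.PosDef) :
    ∃ c, ∀ T : Matrix ι ι ℝ, T.PosDef → Real.log T.det ≤ c + (T * M).trace / 2 := by
  have hA : ((2⁻¹ : ℝ) • M).PosDef := hM.smul (by norm_num)
  refine ⟨Real.log (((2⁻¹ : ℝ) • M)⁻¹).det, fun T hT => ?_⟩
  have htangent := log_det_sub_log_det_le hA.inv hT
  rw [nonsing_inv_nonsing_inv _ (isUnit_det_of_posDef hA), trace_mul_comm, mul_smul_comm,
    trace_smul, smul_eq_mul] at htangent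
  linarith [(Fintype.card ι).cast_nonneg (α := ℝ)]

/-- The sublevel sets of `-log det T + tr(T M)` are bounded and stay away from the singular
matrices. -/
theorem exists_isMinOn_neg_log_det_add (hM : M.PosDef) {g : Matrix ι ι ℝ → ℝ}
    (hg : Continuous g) (hMg : ∀ T : Matrix ι ι ℝ, T.PosDef → (T * M).trace ≤ g T)
    {K : Set (Matrix ι ι ℝ)} (hK : IsClosed K) (hne : ∃ T ∈ K, T.PosDef) :
    ∃ T ∈ K, T.PosDef ∧
      IsMinOn (fun T => -Real.log T.det + g T) {T | T ∈ K ∧ T.PosDef} T := by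
  set f : Matrix ι ι ℝ → ℝ := fun T => -Real.log T.det + g T with hf
  obtain ⟨T₀, hT₀K, hT₀⟩ := hne
  obtain ⟨c, hc⟩ := exists_log_det_le_add_trace_mul_half hM
  let sub : Set (Matrix ι ι ℝ) :=
    {T | T.PosSemidef ∧ (T * M).trace ≤ 2 * (f T₀ + c)} ∩ (K ∩ {T | Real.exp (-f T₀) ≤ T.det})
  have hsub : IsCompact sub := (isCompact_posSemidef_trace_mul_le hM _).inter_right
    (hK.inter (isClosed_le continuous_const (by fun_prop)))
  have hmem : ∀ T ∈ K, T.PosDef → f T ≤ f T₀ → T ∈ sub := fun T hTK hT hle => by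
    have := hMg T hT
    have := trace_mul_nonneg hT.posSemidef hM.posSemidef
    have := hc T hT
    simp only [hf] at hle
    exact ⟨⟨hT.posSemidef, by linarith⟩, hTK,
      (Real.le_log_iff_exp_le hT.det_pos).mp (by linarith)⟩
  have hdet : ∀ T ∈ sub, 0 < T.det := fun T hT => (Real.exp_pos _).trans_le hT.2.2
  have hcont : ContinuousOn f sub :=
    (ContinuousOn.log (by fun_prop) fun T hT => (hdet T hT).ne').neg.add hg.continuousOn
  have hT₀sub := hmem T₀ hT₀K hT₀ le_rfl
  obtain ⟨T, hT, hTmin⟩ := hsub.exists_isMinOn ⟨T₀, hT₀sub⟩ hcont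
  refine ⟨T, hT.2.1, hT.1.1.posDef_iff_isUnit.mpr
    ((isUnit_iff_isUnit_det T).mpr (hdet T hT).ne'.isUnit), ?_⟩
  rintro T' ⟨hT'K, hT'⟩
  rcases le_total (f T') (f T₀) with h | h
  · exact hTmin (hmem T' hT'K hT' h)
  · exact (hTmin hT₀sub).trans h

end Existence

/-! ### Optimality conditions of the graphical lasso -/

section ScalarOptimality

variable {G : ℝ → ℝ} {w a : ℝ}

/-- The difference quotient in the direction `s`, where the penalty has slope at most `c`. -/
theorem nonneg_of_eventually_nonneg (hG : ContinuousAt G 0) (hw : 0 ≤ w)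
    (h : ∀ᶠ t in nhds 0, 0 ≤ t * G t + w * (|a + t| - |a|)) {s c : ℝ}
    (hc : ∀ t ∈ Set.Ioo (0 : ℝ) 1, |a + t * s| - |a| ≤ t * c) : 0 ≤ s * G 0 + w * c := by
  have hts : Filter.Tendsto (fun t : ℝ => t * s) (nhdsWithin 0 (Set.Ioi 0)) (nhds 0) := by
    have : Filter.Tendsto (fun t : ℝ => t * s) (nhds 0) (nhds (0 * s)) :=
      (continuous_id.mul continuous_const).tendsto 0
    rw [zero_mul] at this
    exact this.mono_left nhdsWithin_le_nhds
  refine ge_of_tendsto (((hG.tendsto.comp hts).const_mul s).add_const (w * c)) ?_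
  filter_upwards [hts.eventually h, Ioo_mem_nhdsGT zero_lt_one] with t hnonneg ht
  have hslope := mul_le_mul_of_nonneg_left (hc t ht) hw
  refine nonneg_of_mul_nonneg_right (a := t) ?_ ht.1
  rw [Function.comp_apply]
  linarith

theorem abs_le_and_mul_le_of_eventually_nonneg (hG : ContinuousAt G 0) (hw : 0 ≤ w)
    (h : ∀ᶠ t in nhds 0, 0 ≤ t * G t + w * (|a + t| - |a|)) :
    |G 0| ≤ w ∧ a * G 0 ≤ -(w * |a|) := by
  have hunit : ∀ s : ℝ, |s| = 1 → 0 ≤ s * G 0 + w * 1 := fun s hs =>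
    nonneg_of_eventually_nonneg hG hw h fun t ht => by
      have := abs_add_le a (t * s)
      rw [abs_mul, hs, abs_of_pos ht.1] at this
      linarith
  have hshrink : 0 ≤ -a * G 0 + w * -|a| := nonneg_of_eventually_nonneg hG hw h fun t ht => by
    rw [show a + t * -a = (1 - t) * a by ring, abs_mul, abs_of_pos (sub_pos.mpr ht.2)]
    linarith
  have hpos := hunit 1 (by simp)
  have hneg := hunit (-1) (by simp)
  exact ⟨abs_le.mpr ⟨by linarith, by linarith⟩, by linarith⟩

end ScalarOptimality

section Stationarity

variable {p : ℕ} {R T : Matrix (Fin p) (Fin p) ℝ} {lam : ℝ}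

/-- The weight of the entry `(i, j)` in the penalty of the graphical lasso: the diagonal is not
penalized. -/
noncomputable def penaltyWeight (lam : ℝ) (i j : Fin p) : ℝ := if i = j then 0 else lam

theorem penaltyWeight_nonneg (h : 0 ≤ lam) (i j : Fin p) : 0 ≤ penaltyWeight lam i j := by
  unfold penaltyWeight; split_ifs <;> simp [h]

theorem mul_offL1_eq_sum (lam : ℝ) (T : Matrix (Fin p) (Fin p) ℝ) :
    lam * offL1 T = ∑ i, ∑ j, penaltyWeight lam i j * |T i j| := by
  simp only [offL1, Finset.mul_sum]
  refine Finset.sum_congr rfl fun i _ => Finset.sum_congr rfl fun j _ => ?_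
  by_cases h : i = j <;> simp [offPart, penaltyWeight, h]

theorem exists_isMinOn_glassoObjective {Sig : Matrix (Fin p) (Fin p) ℝ} (hSig : Sig.PosDef)
    (hR : ∀ T : Matrix (Fin p) (Fin p) ℝ, T.PosDef →
      (T * Sig).trace ≤ (T * R).trace + lam * offL1 T)
    {K : Set (Matrix (Fin p) (Fin p) ℝ)} (hK : IsClosed K) (hne : ∃ T ∈ K, T.PosDef) :
    ∃ T ∈ K, T.PosDef ∧ IsMinOn (glassoObjective R lam) {T | T ∈ K ∧ T.PosDef} T := by
  simp_rw [funext fun T => show glassoObjective R lam T =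
    -Real.log T.det + ((T * R).trace + lam * offL1 T) from add_assoc _ _ _]
  refine exists_isMinOn_neg_log_det_add hSig ?_ hR hK hne
  simp_rw [mul_offL1_eq_sum]
  fun_prop

/-- The subgradient condition of the graphical lasso objective at the entry `(i, j)` of `T`: the
derivative `R - T⁻¹` of the smooth part equals `-w` times a subgradient of `|·|` at `T i j`,
where `w` is the weight of the entry. -/
def IsStationaryAt (R : Matrix (Fin p) (Fin p) ℝ) (lam : ℝ) (T : Matrix (Fin p) (Fin p) ℝ)
    (i j : Fin p) : Prop :=
  |R i j - T⁻¹ i j| ≤ penaltyWeight lam i j ∧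
    T i j * (R i j - T⁻¹ i j) ≤ -(penaltyWeight lam i j * |T i j|)

/-- The symmetric matrix `E_{ij} + E_{ji}`, along which a minimizer is perturbed. -/
def symmUnit (i j : Fin p) : Matrix (Fin p) (Fin p) ℝ := single i j 1 + single j i 1

theorem transpose_symmUnit (i j : Fin p) : (symmUnit i j)ᵀ = symmUnit i j := by
  simp [symmUnit, add_comm]

theorem symmUnit_apply_eq_zero {i j k l : Fin p} (h : (k, l) ≠ (i, j)) (h' : (k, l) ≠ (j, i)) :
    symmUnit i j k l = 0 := by
  simp only [symmUnit, Matrix.add_apply, single_apply]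
  grind

theorem trace_mul_symmUnit {N : Matrix (Fin p) (Fin p) ℝ} (hN : Nᵀ = N) (i j : Fin p) :
    (N * symmUnit i j).trace = 2 * N i j := by
  have : N j i = N i j := congrFun (congrFun hN i) j
  simp [symmUnit, Matrix.mul_add, trace_mul_single, this, two_mul]

theorem penaltyWeight_mul_abs_add_smul_symmUnit_sub (hT : Tᵀ = T) (i j : Fin p) (t : ℝ)
    (k l : Fin p) :
    penaltyWeight lam k l * (|(T + t • symmUnit i j) k l| - |T k l|) =
      penaltyWeight lam i j * (|T i j + t| - |T i j|) * symmUnit i j k l := by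
  have hsymm : T j i = T i j := congrFun (congrFun hT i) j
  simp only [symmUnit, Matrix.add_apply, Matrix.smul_apply, single_apply, penaltyWeight,
    smul_eq_mul]
  grind

theorem mul_offL1_add_smul_symmUnit (hT : Tᵀ = T) (i j : Fin p) (t : ℝ) :
    lam * offL1 (T + t • symmUnit i j) =
      lam * offL1 T + 2 * (penaltyWeight lam i j * (|T i j + t| - |T i j|)) := by
  have hsum : ∑ k, ∑ l, symmUnit i j k l = 2 := by
    simp [symmUnit, Finset.sum_add_distrib, single_apply, ite_and, one_add_one_eq_two]
  rw [mul_offL1_eq_sum, mul_offL1_eq_sum, ← sub_eq_iff_eq_add', ← Finset.sum_sub_distrib]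
  simp_rw [← Finset.sum_sub_distrib, ← mul_sub,
    penaltyWeight_mul_abs_add_smul_symmUnit_sub hT, ← Finset.mul_sum, hsum]
  ring

theorem continuousAt_inv_add_smul_apply {ι : Type*} [Fintype ι] [DecidableEq ι]
    {M : Matrix ι ι ℝ} (hM : IsUnit M.det) (H : Matrix ι ι ℝ) (i j : ι) :
    ContinuousAt (fun t : ℝ => (M + t • H)⁻¹ i j) 0 := by
  have hinv : ContinuousAt (fun N : Matrix ι ι ℝ => N⁻¹) (M + (0 : ℝ) • H) := by
    refine continuousAt_matrix_inv _ ?_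
    simpa using NormedRing.inverse_continuousAt hM.unit
  have hline : ContinuousAt (fun t : ℝ => M + t • H) 0 := by fun_prop
  have hentry : Continuous (fun N : Matrix ι ι ℝ => N i j) := by fun_prop
  exact hentry.continuousAt.comp (hinv.comp (f := fun t : ℝ => M + t • H) hline)

/-- The concavity of `log det` is used at the perturbed matrix, so that no derivative of the
determinant is needed. -/
theorem nonneg_of_glassoObjective_le_add_smul_symmUnit (hR : Rᵀ = R) (hT : T.PosDef) {i j : Fin p}
    {t : ℝ} (ht : (T + t • symmUnit i j).PosDef)
    (hle : glassoObjective R lam T ≤ glassoObjective R lam (T + t • symmUnit i j)) :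
    0 ≤ t * (R i j - (T + t • symmUnit i j)⁻¹ i j)
      + penaltyWeight lam i j * (|T i j + t| - |T i j|) := by
  set H := symmUnit i j
  have htangent := log_det_sub_log_det_le ht hT
  have hinv : (T + t • H)⁻¹ * T = 1 - t • ((T + t • H)⁻¹ * H) := by
    rw [eq_sub_iff_add_eq, ← mul_smul_comm, ← Matrix.mul_add,
      nonsing_inv_mul _ (isUnit_det_of_posDef ht)]
  rw [hinv, trace_sub, trace_one, trace_smul,
    trace_mul_symmUnit (transpose_eq_of_posDef ht.inv), smul_eq_mul] at htangent
  have htraceR : ((T + t • H) * R).trace = (T * R).trace + t * (2 * R i j) := by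
    rw [Matrix.add_mul, trace_add, smul_mul_assoc, trace_smul, trace_mul_comm H R,
      trace_mul_symmUnit hR, smul_eq_mul]
  rw [glassoObjective, glassoObjective, htraceR,
    mul_offL1_add_smul_symmUnit (transpose_eq_of_posDef hT)] at hle
  linarith

theorem isStationaryAt_of_isMinOn_support (hlam : 0 ≤ lam) (hR : Rᵀ = R)
    {S : Set (Fin p × Fin p)} (hS : ∀ i j, (i, j) ∈ S → (j, i) ∈ S) (hT : T.PosDef)
    (hTS : ∀ i j, (i, j) ∉ S → T i j = 0)
    (hmin : IsMinOn (glassoObjective R lam)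
      {T' | (∀ i j, (i, j) ∉ S → T' i j = 0) ∧ T'.PosDef} T)
    {i j : Fin p} (hij : (i, j) ∈ S) : IsStationaryAt R lam T i j := by
  have hsupp : ∀ (t : ℝ) k l, (k, l) ∉ S → (T + t • symmUnit i j) k l = 0 := fun t k l hkl => by
    have hunit : symmUnit i j k l = 0 := symmUnit_apply_eq_zero
      (fun h => hkl (h ▸ hij)) (fun h => hkl (h ▸ hS i j hij))
    rw [Matrix.add_apply, Matrix.smul_apply, hTS k l hkl, hunit, smul_zero, add_zero]
  have hcont : ContinuousAt (fun t : ℝ => R i j - (T + t • symmUnit i j)⁻¹ i j) 0 :=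
    continuousAt_const.sub (continuousAt_inv_add_smul_apply (isUnit_det_of_posDef hT) _ i j)
  have := abs_le_and_mul_le_of_eventually_nonneg hcont (penaltyWeight_nonneg hlam i j)
    (a := T i j) <| by
      filter_upwards [eventually_posDef_add_smul hT (transpose_symmUnit i j)] with t ht
      exact nonneg_of_glassoObjective_le_add_smul_symmUnit hR hT ht (hmin ⟨hsupp t, ht⟩)
  simpa only [IsStationaryAt, zero_smul, add_zero] using this

theorem trace_mul_eq_sum {ι : Type*} [Fintype ι] {M N : Matrix ι ι ℝ} (hN : Nᵀ = N) :
    (M * N).trace = ∑ i, ∑ j, M i j * N i j := by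
  conv_lhs => rw [← hN]
  simp [trace, mul_apply]

theorem trace_sub_trace_le_of_isStationaryAt (hR : Rᵀ = R) (hT : T.PosDef)
    (h : ∀ i j, IsStationaryAt R lam T i j) (T' : Matrix (Fin p) (Fin p) ℝ) :
    (T⁻¹ * T').trace - p ≤
      (T' * R).trace + lam * offL1 T' - ((T * R).trace + lam * offL1 T) := by
  have hsymm : (R - T⁻¹)ᵀ = R - T⁻¹ := by
    rw [transpose_sub, hR, transpose_eq_of_posDef hT.inv]
  have htrace : (T' * R).trace - (T * R).trace - ((T⁻¹ * T').trace - p)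
      = ∑ i, ∑ j, (T' - T) i j * (R - T⁻¹) i j := by
    rw [← trace_mul_eq_sum hsymm, Matrix.sub_mul, Matrix.mul_sub, Matrix.mul_sub,
      mul_nonsing_inv _ (isUnit_det_of_posDef hT), trace_mul_comm T⁻¹ T']
    simp only [trace_sub, trace_one, Fintype.card_fin]
    ring
  have hentry : ∀ i j, penaltyWeight lam i j * |T i j| - penaltyWeight lam i j * |T' i j|
      ≤ (T' - T) i j * (R - T⁻¹) i j := fun i j => by
    obtain ⟨hle, hmul⟩ := h i j
    have habs : |T' i j * (R i j - T⁻¹ i j)| ≤ penaltyWeight lam i j * |T' i j| := by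
      rw [abs_mul, mul_comm]
      gcongr
    rw [Matrix.sub_apply, Matrix.sub_apply]
    linarith [(abs_le.mp habs).1]
  have hsum := Finset.sum_le_sum fun i (_ : i ∈ Finset.univ) =>
    Finset.sum_le_sum fun j (_ : j ∈ Finset.univ) => hentry i j
  simp only [Finset.sum_sub_distrib, ← mul_offL1_eq_sum] at hsum
  linarith

theorem isGraphicalLasso_iff_eq_of_isStationaryAt (hR : Rᵀ = R) (hT : T.PosDef)
    (h : ∀ i j, IsStationaryAt R lam T i j) (T' : Matrix (Fin p) (Fin p) ℝ) :
    IsGraphicalLasso R lam T' ↔ T' = T := by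
  have hgap := trace_sub_trace_le_of_isStationaryAt hR hT h
  constructor
  · rintro ⟨hT', hmin⟩
    refine eq_of_trace_sub_card_le_log_det_sub hT hT' ?_
    have hle : glassoObjective R lam T' ≤ glassoObjective R lam T := hmin hT
    simp only [glassoObjective, Fintype.card_fin] at hle ⊢
    linarith [hgap T']
  · rintro rfl
    refine ⟨hT, fun U hU => ?_⟩
    have htangent := log_det_sub_log_det_le hT hU
    simp only [glassoObjective, Set.mem_ofPred_eq, Fintype.card_fin] at htangent ⊢
    linarith [hgap U]

end Stationarity

/-! ### The Taylor remainder of the matrix inverse -/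

/-- The remainder of the first order expansion of `D ↦ (Sig⁻¹ + D)⁻¹` at zero. -/
noncomputable def invRemainder {ι : Type*} [Fintype ι] [DecidableEq ι] (Sig D : Matrix ι ι ℝ) :
    Matrix ι ι ℝ :=
  (Sig⁻¹ + D)⁻¹ - Sig + Sig * D * Sig

/-- Symmetric perturbations whose row sums are at most `m`, with `m` small compared with the row
sums of `Sig`. -/
structure IsSmallPerturbation {ι : Type*} [Fintype ι] (Sig : Matrix ι ι ℝ) (k m : ℝ)
    (D : Matrix ι ι ℝ) : Prop where
  symm : Dᵀ = D
  row : ∀ i, ∑ j, |D i j| ≤ m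
  rowSig : ∀ i, ∑ j, |Sig i j| ≤ k
  k_nonneg : 0 ≤ k
  m_nonneg : 0 ≤ m
  small : k * m ≤ 1 / 3

namespace IsSmallPerturbation

variable {ι : Type*} [Fintype ι] {Sig D D' : Matrix ι ι ℝ} {k m r : ℝ}

theorem row_mul (h : IsSmallPerturbation Sig k m D) (i : ι) : ∑ j, |(Sig * D) i j| ≤ k * m :=
  sum_abs_mul_le h.m_nonneg h.rowSig h.row i

theorem col_sig (h : IsSmallPerturbation Sig k m D) (hSig : Sig.PosDef) (j : ι) :
    ∑ i, |Sig i j| ≤ k := by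
  simp_rw [apply_comm_of_posDef hSig _ j]
  exact h.rowSig j

variable [DecidableEq ι]

theorem posDef (h : IsSmallPerturbation Sig k m D) (hSig : Sig.PosDef) : (Sig⁻¹ + D).PosDef :=
  posDef_inv_add hSig h.symm fun i => by linarith [h.row_mul i, h.small]

theorem inv_eq (h : IsSmallPerturbation Sig k m D) (hSig : Sig.PosDef) :
    (Sig⁻¹ + D)⁻¹ = Sig - Sig * D * (Sig⁻¹ + D)⁻¹ := by
  have hmul : Sig * ((Sig⁻¹ + D) * (Sig⁻¹ + D)⁻¹) = Sig := by
    rw [mul_nonsing_inv _ (isUnit_det_of_posDef (h.posDef hSig)), Matrix.mul_one]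
  rw [Matrix.add_mul, Matrix.mul_add, ← Matrix.mul_assoc,
    mul_nonsing_inv _ (isUnit_det_of_posDef hSig), Matrix.one_mul, ← Matrix.mul_assoc] at hmul
  exact eq_sub_of_add_eq hmul

theorem row_inv (h : IsSmallPerturbation Sig k m D) (hSig : Sig.PosDef) (i : ι) :
    ∑ j, |(Sig⁻¹ + D)⁻¹ i j| ≤ 3 / 2 * k := by
  have := sum_abs_le_of_eq_sub_mul (c := 1 / 3) (by norm_num) (h.inv_eq hSig) h.rowSig
    (fun i => (h.row_mul i).trans h.small) i
  linarith

theorem row_sub_inv (h : IsSmallPerturbation Sig k m D) (hSig : Sig.PosDef) (i : ι) :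
    ∑ j, |(Sig - (Sig⁻¹ + D)⁻¹) i j| ≤ k * m * (3 / 2 * k) := by
  rw [show Sig - (Sig⁻¹ + D)⁻¹ = Sig * D * (Sig⁻¹ + D)⁻¹ from
    sub_eq_iff_eq_add'.mpr (sub_eq_iff_eq_add.mp (h.inv_eq hSig).symm)]
  exact sum_abs_mul_le (by linarith [h.k_nonneg]) h.row_mul (h.row_inv hSig) i

theorem col_sub_inv (h : IsSmallPerturbation Sig k m D) (hSig : Sig.PosDef) (j : ι) :
    ∑ i, |(Sig - (Sig⁻¹ + D)⁻¹) i j| ≤ k * m * (3 / 2 * k) := by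
  simp_rw [Matrix.sub_apply, apply_comm_of_posDef hSig _ j,
    apply_comm_of_posDef (h.posDef hSig).inv _ j]
  exact h.row_sub_inv hSig j

theorem invRemainder_eq (h : IsSmallPerturbation Sig k m D) (hSig : Sig.PosDef) :
    invRemainder Sig D = Sig * D * (Sig - (Sig⁻¹ + D)⁻¹) := by
  rw [invRemainder, Matrix.mul_sub]
  conv_lhs => rw [h.inv_eq hSig]
  abel

theorem transpose_invRemainder (h : IsSmallPerturbation Sig k m D) (hSig : Sig.PosDef) :
    (invRemainder Sig D)ᵀ = invRemainder Sig D := by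
  rw [invRemainder, transpose_add, transpose_sub, transpose_mul, transpose_mul,
    transpose_eq_of_posDef (h.posDef hSig).inv, transpose_eq_of_posDef hSig, h.symm,
    Matrix.mul_assoc]

theorem abs_invRemainder_le (h : IsSmallPerturbation Sig k m D) (hSig : Sig.PosDef)
    (hr : 0 ≤ r) (hD : ∀ i j, |D i j| ≤ r) (i j : ι) :
    |invRemainder Sig D i j| ≤ 3 / 2 * k ^ 3 * m * r := by
  rw [h.invRemainder_eq hSig]
  calc _ ≤ k * r * (k * m * (3 / 2 * k)) :=
        abs_mul_mul_apply_le hr h.k_nonneg h.rowSig hD (h.col_sub_inv hSig) i j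
    _ = _ := by ring

theorem invRemainder_sub_eq (h : IsSmallPerturbation Sig k m D)
    (h' : IsSmallPerturbation Sig k m D') (hSig : Sig.PosDef) :
    invRemainder Sig D - invRemainder Sig D' =
      (Sig - (Sig⁻¹ + D)⁻¹) * (D - D') * Sig
        + (Sig⁻¹ + D)⁻¹ * (D - D') * (Sig - (Sig⁻¹ + D')⁻¹) := by
  have hinv := nonsing_inv_mul _ (isUnit_det_of_posDef (h.posDef hSig))
  have hinv' := mul_nonsing_inv _ (isUnit_det_of_posDef (h'.posDef hSig))
  rw [invRemainder, invRemainder]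
  set N := (Sig⁻¹ + D)⁻¹
  set N' := (Sig⁻¹ + D')⁻¹
  have hresolvent : N * (D - D') * N' = N' - N := by
    calc N * (D - D') * N' = N * (Sig⁻¹ + D) * N' - N * ((Sig⁻¹ + D') * N') := by noncomm_ring
      _ = N' - N := by rw [hinv, hinv', Matrix.one_mul, Matrix.mul_one]
  rw [Matrix.mul_sub (N * (D - D')), hresolvent]
  noncomm_ring

theorem abs_invRemainder_sub_le (h : IsSmallPerturbation Sig k m D)
    (h' : IsSmallPerturbation Sig k m D') (hSig : Sig.PosDef) (hr : 0 ≤ r)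
    (hD : ∀ i j, |D i j - D' i j| ≤ r) (i j : ι) :
    |invRemainder Sig D i j - invRemainder Sig D' i j| ≤ 15 / 4 * k ^ 3 * m * r := by
  have hk := h.k_nonneg
  have hm := h.m_nonneg
  rw [← Matrix.sub_apply, h.invRemainder_sub_eq h' hSig, Matrix.add_apply]
  calc _ ≤ _ := abs_add_le _ _
    _ ≤ k * m * (3 / 2 * k) * r * k + 3 / 2 * k * r * (k * m * (3 / 2 * k)) := add_le_add
        (abs_mul_mul_apply_le (H := D - D') hr (by positivity) (h.row_sub_inv hSig) hD
          (h.col_sig hSig) i j)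
        (abs_mul_mul_apply_le (H := D - D') hr (by positivity) (h.row_inv hSig) hD
          (h'.col_sub_inv hSig) i j)
    _ = _ := by ring

end IsSmallPerturbation

/-! ### Parameters of the model -/

section Parameters

theorem maxRowSum_nonneg {ι : Type*} [Fintype ι] (M : Matrix ι ι ℝ) : 0 ≤ maxRowSum M :=
  Real.iSup_nonneg fun _ => Finset.sum_nonneg fun _ _ => abs_nonneg _

/-- The quadratic form of `M` is nonnegative at `M⁻¹ eₛ - (M s s)⁻¹ eₛ`. -/
theorem inv_apply_self_le_inv_apply_self {ι : Type*} [Fintype ι] [DecidableEq ι]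
    {M : Matrix ι ι ℝ} (hM : M.PosDef) (s : ι) : (M s s)⁻¹ ≤ M⁻¹ s s := by
  set e : ι → ℝ := Pi.single s 1 with he
  set x := M⁻¹ *ᵥ e with hx
  set c := (M s s)⁻¹
  have hMx : M *ᵥ x = e := by
    rw [hx, mulVec_mulVec, mul_nonsing_inv _ (isUnit_det_of_posDef hM), one_mulVec]
  have hsymm : x ⬝ᵥ (M *ᵥ e) = e ⬝ᵥ (M *ᵥ x) := by
    rw [dotProduct_mulVec, ← mulVec_transpose, transpose_eq_of_posDef hM, dotProduct_comm]
  have hform := hM.posSemidef.dotProduct_mulVec_nonneg (x - c • e)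
  simp only [star_trivial, mulVec_sub, sub_dotProduct, dotProduct_sub, mulVec_smul,
    dotProduct_smul, smul_dotProduct, hsymm, hMx] at hform
  have hxs : x s = M⁻¹ s s := by simp [hx, he]
  have hcM : c * M s s = 1 := inv_mul_cancel₀ hM.diag_pos.ne'
  simp [he, hxs, hcM] at hform
  linarith

variable {p : ℕ} {Sig : Matrix (Fin p) (Fin p) ℝ}

theorem mem_precSupport_swap (hSig : Sig.PosDef) {i j : Fin p} (h : (i, j) ∈ precSupport Sig) :
    (j, i) ∈ precSupport Sig :=
  fun h0 => h ((apply_comm_of_posDef hSig.inv i j).trans h0)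

theorem diag_mem_precSupport (hSig : Sig.PosDef) (i : Fin p) : (i, i) ∈ precSupport Sig :=
  hSig.inv.diag_pos.ne'

theorem ncard_row_le_maxDeg (hSig : Sig.PosDef) (i : Fin p) :
    Set.ncard {j : Fin p | (i, j) ∈ precSupport Sig} ≤ maxDeg Sig := by
  have h : {j : Fin p | (i, j) ∈ precSupport Sig} = {j : Fin p | Sig⁻¹ j i ≠ 0} := by
    ext j
    exact ⟨mem_precSupport_swap hSig, mem_precSupport_swap hSig⟩
  rw [h]
  exact le_ciSup (f := fun j : Fin p => Set.ncard {i : Fin p | Sig⁻¹ i j ≠ 0})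
    (Set.finite_range _).bddAbove i

theorem one_le_maxDeg (hSig : Sig.PosDef) (i : Fin p) : 1 ≤ maxDeg Sig :=
  ((Set.ncard_pos (Set.toFinite _)).mpr ⟨i, diag_mem_precSupport hSig i⟩).trans_le
    (ncard_row_le_maxDeg hSig i)

theorem one_le_kappaSigma (hdiag : ∀ i, Sig i i = 1) (i : Fin p) : 1 ≤ kappaSigma Sig :=
  calc 1 = |Sig i i| := by rw [hdiag, abs_one]
    _ ≤ ∑ j, |Sig i j| := Finset.single_le_sum (f := fun j => |Sig i j|)
        (fun j _ => abs_nonneg _) (Finset.mem_univ i)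
    _ ≤ kappaSigma Sig := sum_abs_le_maxRowSum Sig i

theorem fisherSS_posDef (hSig : Sig.PosDef) : (fisherSS Sig).PosDef :=
  (hSig.kronecker hSig).submatrix Subtype.val_injective

theorem fisherSSInv_mul_fisherSS (hSig : Sig.PosDef) : fisherSSInv Sig * fisherSS Sig = 1 := by
  classical
  unfold fisherSSInv
  convert! nonsing_inv_mul (fisherSS Sig) (isUnit_det_of_posDef (fisherSS_posDef hSig))

theorem fisherSS_mul_fisherSSInv (hSig : Sig.PosDef) : fisherSS Sig * fisherSSInv Sig = 1 :=
  mul_eq_one_comm.mp (fisherSSInv_mul_fisherSS hSig)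

theorem one_le_kappaGamma (hSig : Sig.PosDef) (hdiag : ∀ i, Sig i i = 1) (i : Fin p) :
    1 ≤ kappaGamma Sig := by
  classical
  set s : precSupport Sig := ⟨(i, i), diag_mem_precSupport hSig i⟩ with hs
  have hss : fisherSS Sig s s = 1 := by
    simp [fisherSS, fisher, hs, kroneckerMap_apply, hdiag]
  have hinv : (fisherSS Sig)⁻¹ = fisherSSInv Sig :=
    inv_eq_right_inv (fisherSS_mul_fisherSSInv hSig)
  calc 1 = (fisherSS Sig s s)⁻¹ := by rw [hss, inv_one]
    _ ≤ fisherSSInv Sig s s := hinv ▸ inv_apply_self_le_inv_apply_self (fisherSS_posDef hSig) s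
    _ ≤ |fisherSSInv Sig s s| := le_abs_self _
    _ ≤ ∑ t, |fisherSSInv Sig s t| := Finset.single_le_sum
        (f := fun t => |fisherSSInv Sig s t|) (fun t _ => abs_nonneg _) (Finset.mem_univ s)
    _ ≤ kappaGamma Sig := sum_abs_le_maxRowSum (fisherSSInv Sig) s

end Parameters

/-! ### Matrices supported in the support of the precision matrix -/

section Support

variable {p : ℕ} {Sig : Matrix (Fin p) (Fin p) ℝ}

open Classical in
/-- The matrix with the entries of `x` on the support of the precision matrix and zero
elsewhere. -/
noncomputable def extendSupport (x : precSupport Sig → ℝ) : Matrix (Fin p) (Fin p) ℝ :=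
  Matrix.of fun i j => if h : (i, j) ∈ precSupport Sig then x ⟨(i, j), h⟩ else 0

/-- The vector of the entries of `M` on the support of the precision matrix. -/
def restrictSupport (Sig M : Matrix (Fin p) (Fin p) ℝ) : precSupport Sig → ℝ :=
  fun s => M s.1.1 s.1.2

theorem extendSupport_mem (x : precSupport Sig → ℝ) {i j : Fin p} (h : (i, j) ∈ precSupport Sig) :
    extendSupport x i j = x ⟨(i, j), h⟩ := by simp [extendSupport, h]

theorem extendSupport_notMem (x : precSupport Sig → ℝ) {i j : Fin p}
    (h : (i, j) ∉ precSupport Sig) : extendSupport x i j = 0 := by simp [extendSupport, h]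

theorem extendSupport_sub (x y : precSupport Sig → ℝ) :
    extendSupport (x - y) = extendSupport x - extendSupport y := by
  ext i j
  by_cases h : (i, j) ∈ precSupport Sig <;> simp [extendSupport, h]

theorem extendSupport_restrictSupport {M : Matrix (Fin p) (Fin p) ℝ}
    (hM : ∀ i j, (i, j) ∉ precSupport Sig → M i j = 0) :
    extendSupport (restrictSupport Sig M) = M := by
  ext i j
  by_cases h : (i, j) ∈ precSupport Sig
  · rw [extendSupport_mem _ h, restrictSupport]
  · rw [extendSupport_notMem _ h, hM i j h]

theorem continuous_extendSupport :
    Continuous (extendSupport : (precSupport Sig → ℝ) → Matrix (Fin p) (Fin p) ℝ) := by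
  refine continuous_matrix fun i j => ?_
  by_cases h : (i, j) ∈ precSupport Sig <;> simp only [extendSupport, of_apply, h, dif_pos,
    dif_neg, not_false_eq_true] <;> fun_prop

theorem abs_extendSupport_le {x : precSupport Sig → ℝ} {r : ℝ} (hr : 0 ≤ r)
    (h : ∀ s, |x s| ≤ r) (i j : Fin p) : |extendSupport x i j| ≤ r := by
  by_cases hij : (i, j) ∈ precSupport Sig
  · rw [extendSupport_mem x hij]; exact h _
  · rwa [extendSupport_notMem x hij, abs_zero]

theorem sum_abs_extendSupport_le (hSig : Sig.PosDef) {x : precSupport Sig → ℝ} {r : ℝ}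
    (hr : 0 ≤ r) (h : ∀ s, |x s| ≤ r) (i : Fin p) :
    ∑ j, |extendSupport x i j| ≤ maxDeg Sig * r := by
  classical
  calc ∑ j, |extendSupport x i j|
      ≤ ∑ j, if (i, j) ∈ precSupport Sig then r else 0 := by
        gcongr with j
        split_ifs with hij
        · exact abs_extendSupport_le hr h i j
        · rw [extendSupport_notMem x hij, abs_zero]
    _ = (Set.ncard {j : Fin p | (i, j) ∈ precSupport Sig} : ℝ) * r := by
        rw [← Finset.sum_filter, Finset.sum_const, nsmul_eq_mul, ← Set.ncard_coe_finset,
          Finset.coe_filter_univ]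
    _ ≤ _ := by gcongr; exact ncard_row_le_maxDeg hSig i

theorem sum_fisher_mul (hSig : Sig.PosDef) (x : precSupport Sig → ℝ) (e : Fin p × Fin p) :
    ∑ s : precSupport Sig, fisher Sig e s * x s = (Sig * extendSupport x * Sig) e.1 e.2 := by
  classical
  have hfull : ∑ s : precSupport Sig, fisher Sig e s * x s
      = ∑ q : Fin p × Fin p, fisher Sig e q * extendSupport x q.1 q.2 := by
    refine Finset.sum_of_injOn Subtype.val Subtype.val_injective.injOn (fun _ _ => by simp) ?_ ?_
    · intro q _ hq
      have : (q.1, q.2) ∉ precSupport Sig := fun h => hq ⟨⟨q, h⟩, by simp, rfl⟩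
      rw [extendSupport_notMem x this, mul_zero]
    · intro s _
      rw [extendSupport_mem x (i := s.1.1) (j := s.1.2) s.2]
  rw [hfull, Fintype.sum_prod_type, mul_apply]
  simp only [mul_apply, Finset.sum_mul]
  rw [Finset.sum_comm]
  refine Finset.sum_congr rfl fun l _ => Finset.sum_congr rfl fun k _ => ?_
  rw [fisher, kroneckerMap_apply, apply_comm_of_posDef hSig e.2 l]
  ring

theorem fisherSS_mulVec (hSig : Sig.PosDef) (x : precSupport Sig → ℝ) :
    fisherSS Sig *ᵥ x = restrictSupport Sig (Sig * extendSupport x * Sig) :=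
  funext fun s => sum_fisher_mul hSig x s.1

theorem restrictSupport_transpose_congr (hSig : Sig.PosDef) {M N : Matrix (Fin p) (Fin p) ℝ}
    (h : restrictSupport Sig M = restrictSupport Sig N) :
    restrictSupport Sig Mᵀ = restrictSupport Sig Nᵀ :=
  funext fun s => congrFun h ⟨(s.1.2, s.1.1), mem_precSupport_swap hSig s.2⟩

/-- Transposition commutes with `Γ_{SS}`, and the solution of the linear system is unique. -/
theorem transpose_extendSupport_fisherSSInv (hSig : Sig.PosDef) {M : Matrix (Fin p) (Fin p) ℝ}
    (hM : Mᵀ = M) :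
    (extendSupport (fisherSSInv Sig *ᵥ restrictSupport Sig M))ᵀ =
      extendSupport (fisherSSInv Sig *ᵥ restrictSupport Sig M) := by
  set x := fisherSSInv Sig *ᵥ restrictSupport Sig M with hx
  set x' := restrictSupport Sig (extendSupport x)ᵀ
  have hext : extendSupport x' = (extendSupport x)ᵀ := extendSupport_restrictSupport
    fun i j hij => extendSupport_notMem x fun h => hij (mem_precSupport_swap hSig h)
  have hsolve : restrictSupport Sig (Sig * extendSupport x * Sig) = restrictSupport Sig M := by
    rw [← fisherSS_mulVec hSig, hx, mulVec_mulVec, fisherSS_mul_fisherSSInv hSig, one_mulVec]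
  have hsolve' : fisherSS Sig *ᵥ x' = restrictSupport Sig M := by
    have := restrictSupport_transpose_congr hSig hsolve
    rw [transpose_mul, transpose_mul, transpose_eq_of_posDef hSig, ← Matrix.mul_assoc, hM] at this
    rw [fisherSS_mulVec hSig, hext, this]
  have : x' = x := by
    rw [hx, ← hsolve', mulVec_mulVec, fisherSSInv_mul_fisherSS hSig, one_mulVec]
  rw [← hext, this]

/-- Vectors of size at most `r` on the support that extend to symmetric matrices. -/
def symmBox (Sig : Matrix (Fin p) (Fin p) ℝ) (r : ℝ) : Set (precSupport Sig → ℝ) :=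
  {x | (∀ s, |x s| ≤ r) ∧ (extendSupport x)ᵀ = extendSupport x}

/-- The map whose fixed points `x` are the perturbations with `(Sig⁻¹ + extendSupport x)⁻¹ =
Sig + V` on the support of the precision matrix. -/
noncomputable def newtonMap (Sig V : Matrix (Fin p) (Fin p) ℝ) (x : precSupport Sig → ℝ) :
    precSupport Sig → ℝ :=
  fisherSSInv Sig *ᵥ restrictSupport Sig (invRemainder Sig (extendSupport x) - V)

variable {V : Matrix (Fin p) (Fin p) ℝ} {r v : ℝ}

theorem isClosed_symmBox : IsClosed (symmBox Sig r) := by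
  simp only [symmBox, Set.ofPred_and, Set.ofPred_forall]
  exact IsClosed.inter (isClosed_iInter fun s => isClosed_le (by fun_prop) continuous_const)
    (isClosed_eq continuous_extendSupport.matrix_transpose continuous_extendSupport)

theorem isSmallPerturbation_of_mem_symmBox (hSig : Sig.PosDef) (hr : 0 ≤ r)
    (hsmall : kappaSigma Sig * (maxDeg Sig * r) ≤ 1 / 3) {x : precSupport Sig → ℝ}
    (hx : x ∈ symmBox Sig r) :
    IsSmallPerturbation Sig (kappaSigma Sig) (maxDeg Sig * r) (extendSupport x) where
  symm := hx.2
  row := sum_abs_extendSupport_le hSig hr hx.1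
  rowSig := sum_abs_le_maxRowSum Sig
  k_nonneg := maxRowSum_nonneg Sig
  m_nonneg := by positivity
  small := hsmall

theorem abs_invRemainder_extendSupport_le (hSig : Sig.PosDef) (hr : 0 ≤ r)
    (hsmall : kappaSigma Sig * (maxDeg Sig * r) ≤ 1 / 3) {x : precSupport Sig → ℝ}
    (hx : x ∈ symmBox Sig r) (i j : Fin p) :
    |invRemainder Sig (extendSupport x) i j| ≤
      3 / 2 * kappaSigma Sig ^ 3 * (maxDeg Sig * r) * r :=
  (isSmallPerturbation_of_mem_symmBox hSig hr hsmall hx).abs_invRemainder_le hSig hr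
    (abs_extendSupport_le hr hx.1) i j

theorem abs_fisherSSInv_mulVec_le {y : precSupport Sig → ℝ} {b : ℝ} (hb : 0 ≤ b)
    (hy : ∀ s, |y s| ≤ b) (s : precSupport Sig) :
    |(fisherSSInv Sig *ᵥ y) s| ≤ kappaGamma Sig * b :=
  abs_mulVec_le hb (sum_abs_le_maxRowSum (fisherSSInv Sig)) hy s

theorem mapsTo_newtonMap_symmBox (hSig : Sig.PosDef) (hr : 0 ≤ r)
    (hsmall : kappaSigma Sig * (maxDeg Sig * r) ≤ 1 / 3)
    (hmaps : kappaGamma Sig * (3 / 2 * kappaSigma Sig ^ 3 * (maxDeg Sig * r) * r + v) ≤ r)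
    (hV : Vᵀ = V) (hv : 0 ≤ v) (hVv : ∀ s, |restrictSupport Sig V s| ≤ v) :
    Set.MapsTo (newtonMap Sig V) (symmBox Sig r) (symmBox Sig r) := by
  intro x hx
  have hk : 0 ≤ kappaSigma Sig := maxRowSum_nonneg Sig
  refine ⟨fun s => (abs_fisherSSInv_mulVec_le (by positivity) (fun t => ?_) s).trans hmaps, ?_⟩
  · exact (abs_sub _ _).trans (add_le_add
      (abs_invRemainder_extendSupport_le hSig hr hsmall hx _ _) (hVv t))
  · refine transpose_extendSupport_fisherSSInv hSig ?_
    rw [transpose_sub, hV,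
      (isSmallPerturbation_of_mem_symmBox hSig hr hsmall hx).transpose_invRemainder hSig]

theorem dist_newtonMap_le (hSig : Sig.PosDef) (hr : 0 ≤ r)
    (hsmall : kappaSigma Sig * (maxDeg Sig * r) ≤ 1 / 3)
    (hcontr : kappaGamma Sig * (15 / 4 * kappaSigma Sig ^ 3 * (maxDeg Sig * r)) ≤ 1 / 2)
    {x y : precSupport Sig → ℝ} (hx : x ∈ symmBox Sig r) (hy : y ∈ symmBox Sig r) :
    dist (newtonMap Sig V x) (newtonMap Sig V y) ≤ 1 / 2 * dist x y := by
  have hk : 0 ≤ kappaSigma Sig := maxRowSum_nonneg Sig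
  have hdist : ∀ t, |(x - y) t| ≤ dist x y := fun t => dist_le_pi_dist x y t
  have hsub : newtonMap Sig V x - newtonMap Sig V y = fisherSSInv Sig *ᵥ restrictSupport Sig
      (invRemainder Sig (extendSupport x) - invRemainder Sig (extendSupport y)) := by
    rw [newtonMap, newtonMap, ← mulVec_sub]
    refine congrArg _ (funext fun s => ?_)
    simp [restrictSupport]
  have hrem := (isSmallPerturbation_of_mem_symmBox hSig hr hsmall hx).abs_invRemainder_sub_le
    (isSmallPerturbation_of_mem_symmBox hSig hr hsmall hy) hSig dist_nonneg fun i j => by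
      rw [← Matrix.sub_apply, ← extendSupport_sub]
      exact abs_extendSupport_le dist_nonneg hdist i j
  rw [dist_pi_le_iff (by positivity)]
  intro s
  calc dist (newtonMap Sig V x s) (newtonMap Sig V y s)
      = |(newtonMap Sig V x - newtonMap Sig V y) s| := rfl
    _ ≤ kappaGamma Sig * (15 / 4 * kappaSigma Sig ^ 3 * (maxDeg Sig * r) * dist x y) := by
        rw [hsub]
        exact abs_fisherSSInv_mulVec_le (by positivity) (fun t => hrem _ _) s
    _ = kappaGamma Sig * (15 / 4 * kappaSigma Sig ^ 3 * (maxDeg Sig * r)) * dist x y := by ring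
    _ ≤ 1 / 2 * dist x y := by gcongr

theorem exists_newtonMap_eq (hSig : Sig.PosDef) (hr : 0 ≤ r)
    (hsmall : kappaSigma Sig * (maxDeg Sig * r) ≤ 1 / 3)
    (hmaps : kappaGamma Sig * (3 / 2 * kappaSigma Sig ^ 3 * (maxDeg Sig * r) * r + v) ≤ r)
    (hcontr : kappaGamma Sig * (15 / 4 * kappaSigma Sig ^ 3 * (maxDeg Sig * r)) ≤ 1 / 2)
    (hV : Vᵀ = V) (hv : 0 ≤ v) (hVv : ∀ s, |restrictSupport Sig V s| ≤ v) :
    ∃ x ∈ symmBox Sig r, newtonMap Sig V x = x := by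
  have hmapsTo := mapsTo_newtonMap_symmBox hSig hr hsmall hmaps hV hv hVv
  have hcontract : ContractingWith (1 / 2) (hmapsTo.restrict _ _ _) :=
    ⟨by norm_num, LipschitzWith.of_dist_le_mul fun x y =>
      (dist_newtonMap_le hSig hr hsmall hcontr x.2 y.2).trans_eq (by simp [Subtype.dist_eq])⟩
  have hzero : (0 : precSupport Sig → ℝ) ∈ symmBox Sig r := by
    refine ⟨fun _ => by simpa using hr, ?_⟩
    ext i j
    simp [extendSupport]
  obtain ⟨x, hx, hfix, -⟩ := hcontract.exists_fixedPoint' isClosed_symmBox.isComplete hmapsTo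
    hzero (edist_ne_top _ _)
  exact ⟨x, hx, hfix⟩

end Support

/-! ### The primal-dual witness -/

section Witness

variable {p : ℕ} {Sig R T : Matrix (Fin p) (Fin p) ℝ} {θ τ lam r v : ℝ}

theorem trace_mul_le_of_abs_sub_le (hdiag : ∀ i, R i i = Sig i i)
    (hRS : ∀ i j, |R i j - Sig i j| ≤ lam) (T : Matrix (Fin p) (Fin p) ℝ) :
    (T * Sig).trace ≤ (T * R).trace + lam * offL1 T := by
  rw [mul_offL1_eq_sum]
  simp only [trace, diag_apply, mul_apply]
  rw [← Finset.sum_add_distrib]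
  refine Finset.sum_le_sum fun i _ => ?_
  rw [← Finset.sum_add_distrib]
  refine Finset.sum_le_sum fun j _ => ?_
  obtain rfl | hij := eq_or_ne i j
  · simp [penaltyWeight, hdiag i]
  · have hprod : |T i j * (R j i - Sig j i)| ≤ |T i j| * lam := by
      rw [abs_mul]
      gcongr
      exact hRS j i
    simp only [penaltyWeight, hij, if_false]
    linarith [neg_le_of_abs_le hprod]

theorem exists_isStationaryAt_precSupport (hSig : Sig.PosDef) (hR : Rᵀ = R)
    (hdiag : ∀ i, R i i = Sig i i) (hlam : 0 ≤ lam) (hRS : ∀ i j, |R i j - Sig i j| ≤ lam) :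
    ∃ T : Matrix (Fin p) (Fin p) ℝ, T.PosDef ∧ (∀ i j, (i, j) ∉ precSupport Sig → T i j = 0) ∧
      ∀ i j, (i, j) ∈ precSupport Sig → IsStationaryAt R lam T i j := by
  have hclosed : IsClosed {T : Matrix (Fin p) (Fin p) ℝ |
      ∀ i j, (i, j) ∉ precSupport Sig → T i j = 0} := by
    simp only [Set.ofPred_forall]
    exact isClosed_iInter fun i => isClosed_iInter fun j => isClosed_iInter fun _ =>
      isClosed_eq (by fun_prop) continuous_const
  obtain ⟨T, hTS, hT, hmin⟩ := exists_isMinOn_glassoObjective hSig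
    (fun T _ => trace_mul_le_of_abs_sub_le hdiag hRS T) hclosed
    ⟨Sig⁻¹, fun i j h => not_not.mp h, hSig.inv⟩
  exact ⟨T, hT, hTS, fun i j hij => isStationaryAt_of_isMinOn_support hlam hR
    (fun _ _ h => mem_precSupport_swap hSig h) hT hTS hmin hij⟩

theorem inv_eq_on_precSupport_of_newtonMap_eq (hSig : Sig.PosDef) {V : Matrix (Fin p) (Fin p) ℝ}
    {x : precSupport Sig → ℝ} (hx : newtonMap Sig V x = x) {i j : Fin p}
    (hij : (i, j) ∈ precSupport Sig) : (Sig⁻¹ + extendSupport x)⁻¹ i j = Sig i j + V i j := by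
  have hlin : fisherSS Sig *ᵥ x =
      restrictSupport Sig (invRemainder Sig (extendSupport x) - V) := by
    conv_lhs => rw [← hx, newtonMap, mulVec_mulVec, fisherSS_mul_fisherSSInv hSig, one_mulVec]
  rw [fisherSS_mulVec hSig] at hlin
  have hentry := congrFun hlin ⟨(i, j), hij⟩
  simp only [restrictSupport, invRemainder, Matrix.sub_apply, Matrix.add_apply] at hentry
  linarith

theorem inv_add_extendSupport_eq (hSig : Sig.PosDef) (hT : T.PosDef)
    (hTS : ∀ i j, (i, j) ∉ precSupport Sig → T i j = 0) {x : precSupport Sig → ℝ}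
    (hpos : (Sig⁻¹ + extendSupport x).PosDef) (hx : newtonMap Sig (T⁻¹ - Sig) x = x) :
    Sig⁻¹ + extendSupport x = T := by
  refine eq_of_trace_inv_sub_inv_mul_eq_zero hpos hT ?_
  simp only [trace, diag_apply, mul_apply]
  refine Finset.sum_eq_zero fun i _ => Finset.sum_eq_zero fun j _ => ?_
  by_cases hij : (i, j) ∈ precSupport Sig
  · have hinv : (Sig⁻¹ + extendSupport x)⁻¹ i j = T⁻¹ i j := by
      rw [inv_eq_on_precSupport_of_newtonMap_eq hSig hx hij, Matrix.sub_apply]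
      ring
    rw [Matrix.sub_apply, hinv, sub_self, zero_mul]
  · have hji : (j, i) ∉ precSupport Sig := fun h => hij (mem_precSupport_swap hSig h)
    have hSigji : Sig⁻¹ j i = 0 := not_not.mp hji
    rw [Matrix.sub_apply (Sig⁻¹ + extendSupport x), Matrix.add_apply, hSigji,
      extendSupport_notMem x hji, hTS j i hji, add_zero, sub_zero, mul_zero]

theorem abs_mul_extendSupport_mul_le (hSig : Sig.PosDef) (hirr : Irrepresentable Sig θ)
    {y : precSupport Sig → ℝ} {b : ℝ} (hb : 0 ≤ b) (hy : ∀ s, |y s| ≤ b) {i j : Fin p}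
    (hij : (i, j) ∉ precSupport Sig) :
    |(Sig * extendSupport (fisherSSInv Sig *ᵥ y) * Sig) i j| ≤ (1 - θ) * b := by
  have hdot : (Sig * extendSupport (fisherSSInv Sig *ᵥ y) * Sig) i j =
      ((fun s : precSupport Sig => fisher Sig (i, j) s) ᵥ* fisherSSInv Sig) ⬝ᵥ y := by
    rw [← dotProduct_mulVec]
    exact (sum_fisher_mul hSig _ (i, j)).symm
  rw [hdot]
  exact abs_dotProduct_le hb (hirr (i, j) hij) hy

/-- `r` is a radius on which the Taylor remainder of the inverse is at most `τ` and the Newton map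
for deviations of size `v` is a contraction of the ball into its interior. -/
structure IsNewtonRadius (Sig : Matrix (Fin p) (Fin p) ℝ) (τ v r : ℝ) : Prop where
  pos : 0 < r
  small : kappaSigma Sig * (maxDeg Sig * r) ≤ 1 / 3
  remainder_le : 3 / 2 * kappaSigma Sig ^ 3 * (maxDeg Sig * r) * r ≤ τ
  contracting : kappaGamma Sig * (15 / 4 * kappaSigma Sig ^ 3 * (maxDeg Sig * r)) ≤ 1 / 2
  image_lt : kappaGamma Sig * (τ + v) < r

/-- The two smallness conditions on the error level `τ` in the recovery theorem, with
`r = precError Sig θ τ`. -/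
structure IsSmallErrorLevel (Sig : Matrix (Fin p) (Fin p) ℝ) (θ τ : ℝ) : Prop where
  radius_le : precError Sig θ τ ≤ (3 * kappaSigma Sig * maxDeg Sig)⁻¹
    * min 1 (kappaSigma Sig ^ 2 * kappaGamma Sig)⁻¹
  remainder_le : 3 / 2 * maxDeg Sig * kappaSigma Sig ^ 3 * precError Sig θ τ ^ 2 ≤ τ

theorem precError_eq (hθ : θ ≠ 0) :
    precError Sig θ τ = 2 * kappaGamma Sig * (τ + 8 * τ / θ) := by
  rw [precError]
  field_simp

theorem le_eight_mul_div (hθ : 0 < θ) (hθ1 : θ ≤ 1) (hτ : 0 ≤ τ) : 8 * τ ≤ 8 * τ / θ :=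
  le_div_self (by positivity) hθ hθ1

theorem isNewtonRadius_precError (hp : 0 < p) (hSig : Sig.PosDef) (hSdiag : ∀ i, Sig i i = 1)
    (hθ : 0 < θ) (hθ1 : θ ≤ 1) (hτ : 0 < τ) (h : IsSmallErrorLevel Sig θ τ) :
    IsNewtonRadius Sig τ (τ / 2 + 8 * τ / θ) (precError Sig θ τ) := by
  obtain ⟨hradius, hremainder⟩ := h
  have hk : 1 ≤ kappaSigma Sig := one_le_kappaSigma hSdiag ⟨0, hp⟩
  have hg : 1 ≤ kappaGamma Sig := one_le_kappaGamma hSig hSdiag ⟨0, hp⟩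
  have hD : (1 : ℝ) ≤ maxDeg Sig := by exact_mod_cast one_le_maxDeg hSig ⟨0, hp⟩
  have hlam := le_eight_mul_div hθ hθ1 hτ.le
  have hr := precError_eq (Sig := Sig) (τ := τ) hθ.ne'
  set k := kappaSigma Sig
  set g := kappaGamma Sig
  set D : ℝ := (maxDeg Sig : ℝ)
  set r := precError Sig θ τ
  set lam := 8 * τ / θ
  have hrpos : 0 < r := by rw [hr]; positivity
  have hsmall : r ≤ (3 * k * D)⁻¹ := hradius.trans
    (mul_le_of_le_one_right (by positivity) (min_le_left _ _))
  rw [inv_eq_one_div, le_div_iff₀ (by positivity)] at hsmall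
  have hτr : 18 * g * τ ≤ r := by rw [hr]; nlinarith
  have hquad : g * (D * k ^ 3 * r) * 27 ≤ 1 := by
    refine le_of_mul_le_mul_left ?_ hrpos
    calc r * (g * (D * k ^ 3 * r) * 27) = 18 * g * (3 / 2 * D * k ^ 3 * r ^ 2) := by ring
      _ ≤ 18 * g * τ := by gcongr
      _ ≤ r * 1 := by rwa [mul_one]
  exact
    { pos := hrpos
      small := by linarith
      remainder_le := le_of_eq_of_le (by ring) hremainder
      contracting := by linarith
      image_lt := by rw [hr]; nlinarith }

theorem exists_newtonMap_inv_sub_eq (hr : IsNewtonRadius Sig τ v r) (hSig : Sig.PosDef)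
    (hT : T.PosDef) (hTS : ∀ i j, (i, j) ∉ precSupport Sig → T i j = 0) (hv : 0 ≤ v)
    (hTv : ∀ s, |restrictSupport Sig (T⁻¹ - Sig) s| ≤ v) :
    ∃ x ∈ symmBox Sig r, newtonMap Sig (T⁻¹ - Sig) x = x ∧ Sig⁻¹ + extendSupport x = T := by
  have hg : 0 ≤ kappaGamma Sig := maxRowSum_nonneg _
  have hsymm : (T⁻¹ - Sig)ᵀ = T⁻¹ - Sig := by
    rw [transpose_sub, transpose_eq_of_posDef hT.inv, transpose_eq_of_posDef hSig]
  have hmaps : kappaGamma Sig *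
      (3 / 2 * kappaSigma Sig ^ 3 * (maxDeg Sig * r) * r + v) ≤ r :=
    le_trans (by gcongr; exact hr.remainder_le) hr.image_lt.le
  obtain ⟨x, hx, hfix⟩ := exists_newtonMap_eq hSig hr.pos.le hr.small hmaps hr.contracting hsymm
    hv hTv
  have hpos := (isSmallPerturbation_of_mem_symmBox hSig hr.pos.le hr.small hx).posDef hSig
  exact ⟨x, hx, hfix, inv_add_extendSupport_eq hSig hT hTS hpos hfix⟩

theorem abs_restrictSupport_remainder_sub_le (hr : IsNewtonRadius Sig τ v r) (hSig : Sig.PosDef)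
    {V : Matrix (Fin p) (Fin p) ℝ} (hV : ∀ s, |restrictSupport Sig V s| ≤ v)
    {x : precSupport Sig → ℝ} (hx : x ∈ symmBox Sig r) (s : precSupport Sig) :
    |restrictSupport Sig (invRemainder Sig (extendSupport x) - V) s| ≤ τ + v :=
  (abs_sub _ _).trans (add_le_add
    ((abs_invRemainder_extendSupport_le hSig hr.pos.le hr.small hx _ _).trans hr.remainder_le)
    (hV s))

theorem abs_extendSupport_lt_of_newtonMap_eq (hr : IsNewtonRadius Sig τ v r) (hSig : Sig.PosDef)
    (hτv : 0 ≤ τ + v) {V : Matrix (Fin p) (Fin p) ℝ} (hV : ∀ s, |restrictSupport Sig V s| ≤ v)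
    {x : precSupport Sig → ℝ} (hx : x ∈ symmBox Sig r) (hfix : newtonMap Sig V x = x)
    (i j : Fin p) : |extendSupport x i j| < r := by
  refine (abs_extendSupport_le (mul_nonneg (maxRowSum_nonneg _) hτv) (fun s => ?_) i j).trans_lt
    hr.image_lt
  rw [← hfix]
  exact abs_fisherSSInv_mulVec_le hτv (abs_restrictSupport_remainder_sub_le hr hSig hV hx) s

theorem abs_sub_inv_le_of_notMem_precSupport (hr : IsNewtonRadius Sig τ v r) (hSig : Sig.PosDef)
    (hirr : Irrepresentable Sig θ) (hτv : 0 ≤ τ + v) {V : Matrix (Fin p) (Fin p) ℝ}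
    (hV : ∀ s, |restrictSupport Sig V s| ≤ v) {x : precSupport Sig → ℝ} (hx : x ∈ symmBox Sig r)
    (hfix : newtonMap Sig V x = x) (hRS : ∀ i j, |R i j - Sig i j| ≤ τ / 2) {i j : Fin p}
    (hij : (i, j) ∉ precSupport Sig) :
    |R i j - (Sig⁻¹ + extendSupport x)⁻¹ i j| ≤ τ / 2 + (1 - θ) * (τ + v) + τ := by
  have htaylor : R i j - (Sig⁻¹ + extendSupport x)⁻¹ i j = (R i j - Sig i j)
      + (Sig * extendSupport x * Sig) i j - invRemainder Sig (extendSupport x) i j := by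
    rw [invRemainder, Matrix.add_apply, Matrix.sub_apply]
    ring
  have hlinear : |(Sig * extendSupport x * Sig) i j| ≤ (1 - θ) * (τ + v) := by
    have := abs_mul_extendSupport_mul_le hSig hirr hτv
      (abs_restrictSupport_remainder_sub_le hr hSig hV hx) hij
    rwa [← newtonMap, hfix] at this
  have hrem : |invRemainder Sig (extendSupport x) i j| ≤ τ :=
    (abs_invRemainder_extendSupport_le hSig hr.pos.le hr.small hx i j).trans hr.remainder_le
  rw [htaylor]
  exact (abs_sub _ _).trans (add_le_add ((abs_add_le _ _).trans (add_le_add (hRS i j) hlinear))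
    hrem)

theorem abs_restrictSupport_inv_sub_le (hlam : 0 ≤ lam) (hRS : ∀ i j, |R i j - Sig i j| ≤ τ / 2)
    (hstat : ∀ i j, (i, j) ∈ precSupport Sig → IsStationaryAt R lam T i j) (s : precSupport Sig) :
    |restrictSupport Sig (T⁻¹ - Sig) s| ≤ τ / 2 + lam := by
  have hweight : penaltyWeight lam s.1.1 s.1.2 ≤ lam := by
    unfold penaltyWeight
    split_ifs <;> linarith
  calc |restrictSupport Sig (T⁻¹ - Sig) s|
      = |(R s.1.1 s.1.2 - Sig s.1.1 s.1.2) - (R s.1.1 s.1.2 - T⁻¹ s.1.1 s.1.2)| := by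
        rw [restrictSupport, Matrix.sub_apply]
        ring_nf
    _ ≤ τ / 2 + lam := (abs_sub _ _).trans
        (add_le_add (hRS _ _) ((hstat _ _ s.2).1.trans hweight))

theorem exists_glasso_of_abs_sub_le (hSig : Sig.PosDef) (hθ : 0 < θ) (hθ1 : θ ≤ 1) (hτ : 0 < τ)
    (hirr : Irrepresentable Sig θ) (hR : Rᵀ = R) (hdiag : ∀ i, R i i = Sig i i)
    (hRS : ∀ i j, |R i j - Sig i j| ≤ τ / 2)
    (hr : IsNewtonRadius Sig τ (τ / 2 + 8 * τ / θ) r) :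
    ∃ T : Matrix (Fin p) (Fin p) ℝ, (∀ T', IsGraphicalLasso R (8 * τ / θ) T' ↔ T' = T) ∧
      (∀ i j, (i, j) ∉ precSupport Sig → T i j = 0) ∧
      ∀ i j, |T i j - Sig⁻¹ i j| < r := by
  have hτlam := le_eight_mul_div hθ hθ1 hτ.le
  have hθlam : θ * (8 * τ / θ) = 8 * τ := mul_div_cancel₀ _ hθ.ne'
  set lam := 8 * τ / θ
  obtain ⟨T, hT, hTS, hstat⟩ := exists_isStationaryAt_precSupport hSig hR hdiag (lam := lam)
    (by linarith) fun i j => (hRS i j).trans (by linarith)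
  have hV := abs_restrictSupport_inv_sub_le (by linarith) hRS hstat
  obtain ⟨x, hx, hfix, hTx⟩ := exists_newtonMap_inv_sub_eq hr hSig hT hTS (by linarith) hV
  have hstatAll : ∀ i j, IsStationaryAt R lam T i j := by
    intro i j
    by_cases hij : (i, j) ∈ precSupport Sig
    · exact hstat i j hij
    have hne : i ≠ j := by
      rintro rfl
      exact hij (diag_mem_precSupport hSig i)
    have hdual := abs_sub_inv_le_of_notMem_precSupport hr hSig hirr (by linarith) hV hx hfix hRS
      hij
    rw [hTx] at hdual
    refine ⟨?_, by simp [hTS i j hij]⟩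
    rw [penaltyWeight, if_neg hne]
    nlinarith
  refine ⟨T, isGraphicalLasso_iff_eq_of_isStationaryAt hR hT hstatAll, hTS, fun i j => ?_⟩
  rw [show T i j - Sig⁻¹ i j = extendSupport x i j by rw [← hTx, Matrix.add_apply]; ring]
  exact abs_extendSupport_lt_of_newtonMap_eq hr hSig (by linarith) hV hx hfix i j

end Witness

/-! ### Gaussian concentration -/

section GaussianConcentration

variable {Ω : Type*} [MeasurableSpace Ω] {P : Measure Ω}

theorem measure_prodMk_mem_le_of_indepFun {α β : Type*} [MeasurableSpace α] [MeasurableSpace β]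
    [IsProbabilityMeasure P] {U : Ω → α} {V : Ω → β} (hU : AEMeasurable U P)
    (hV : AEMeasurable V P) (hUV : IndepFun U V P) {E : Set (α × β)} (hE : MeasurableSet E)
    {ε : ℝ≥0∞} (h : ∀ u, P {ω | (u, V ω) ∈ E} ≤ ε) : P {ω | (U ω, V ω) ∈ E} ≤ ε := by
  have : IsProbabilityMeasure (P.map U) := Measure.isProbabilityMeasure_map hU
  calc P {ω | (U ω, V ω) ∈ E} = P.map (fun ω => (U ω, V ω)) E :=
        (Measure.map_apply_of_aemeasurable (hU.prodMk hV) hE).symm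
    _ = ∫⁻ u, P.map V (Prod.mk u ⁻¹' E) ∂(P.map U) := by
        rw [(indepFun_iff_map_prod_eq_prod_map_map hU hV).mp hUV, Measure.prod_apply hE]
    _ ≤ ∫⁻ _, ε ∂(P.map U) := by
        refine lintegral_mono fun u => ?_
        rw [Measure.map_apply_of_aemeasurable hV (measurable_prodMk_left hE)]
        exact h u
    _ = ε := by simp

theorem measure_lt_abs_le_of_tails [IsFiniteMeasure P] {Z : Ω → ℝ} {a ε : ℝ}
    (hupper : P.real {ω | a ≤ Z ω} ≤ ε) (hlower : P.real {ω | Z ω ≤ -a} ≤ ε) :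
    P {ω | a < |Z ω|} ≤ ENNReal.ofReal (2 * ε) := by
  rw [← ofReal_measureReal]
  refine ENNReal.ofReal_le_ofReal ?_
  calc P.real {ω | a < |Z ω|} ≤ P.real ({ω | a ≤ Z ω} ∪ {ω | Z ω ≤ -a}) :=
        measureReal_mono fun ω (hω : a < |Z ω|) => (lt_abs.mp hω).imp (fun h => h.le)
          fun h => (by linarith : Z ω ≤ -a)
    _ ≤ ε + ε := (measureReal_union_le _ _).trans (add_le_add hupper hlower)
    _ = 2 * ε := (two_mul ε).symm

theorem ae_eq_zero_of_gaussianReal_zero {Z : Ω → ℝ} (hZ : HasLaw Z (gaussianReal 0 0) P) :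
    ∀ᵐ ω ∂P, Z ω = 0 := by
  rw [gaussianReal_zero_var] at hZ
  exact hZ.ae_eq_of_dirac

theorem mgf_sq_of_gaussianReal {Z : Ω → ℝ} {v : ℝ≥0} (hZ : HasLaw Z (gaussianReal 0 v) P)
    (hv : v ≠ 0) (m : ℝ) : mgf (fun ω => Z ω ^ 2) P (m / v) = √(1 / (1 - 2 * m)) := by
  have hdensity : ∀ x : ℝ, gaussianPDFReal 0 v x • Real.exp (m / v * x ^ 2)
      = (√(2 * Real.pi * v))⁻¹ * Real.exp (-((1 - 2 * m) / (2 * v)) * x ^ 2) := by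
    intro x
    rw [gaussianPDFReal, smul_eq_mul, mul_assoc, ← Real.exp_add]
    congr 2
    field_simp
    ring
  calc ∫ ω, Real.exp (m / v * Z ω ^ 2) ∂P
      = ∫ x, Real.exp (m / v * x ^ 2) ∂(gaussianReal 0 v) :=
        hZ.integral_comp (f := fun x => Real.exp (m / v * x ^ 2)) (by fun_prop)
    _ = ∫ x, (√(2 * Real.pi * v))⁻¹ * Real.exp (-((1 - 2 * m) / (2 * v)) * x ^ 2) := by
        rw [integral_gaussianReal_eq_integral_smul hv]
        simp_rw [hdensity]
    _ = √(1 / (1 - 2 * m)) := by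
        rw [integral_const_mul, integral_gaussian, ← Real.sqrt_inv,
          ← Real.sqrt_mul (by positivity)]
        congr 1
        field_simp

theorem sqrt_one_div_one_sub_le {m : ℝ} (hm : m ≤ 1 / 4) :
    √(1 / (1 - 2 * m)) ≤ Real.exp (m + 4 * m ^ 2) := by
  have hpos : 0 < 1 - 2 * m := by linarith
  have hinv : (1 - 2 * m)⁻¹ - 1 ≤ 2 * (m + 4 * m ^ 2) := by
    rw [sub_le_iff_le_add, inv_eq_one_div, div_le_iff₀ hpos]
    nlinarith [sq_nonneg m, mul_nonneg (sq_nonneg m) (by linarith : 0 ≤ 1 / 4 - m)]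
  rw [Real.sqrt_le_left (Real.exp_pos _).le, ← Real.exp_nat_mul,
    ← Real.log_le_iff_le_exp (by positivity), one_div, Real.log_inv]
  push_cast
  linarith [Real.one_sub_inv_le_log_of_pos hpos]

section ChiSquared

variable {ι : Type*} [Fintype ι] {ξ : ι → Ω → ℝ} {v : ℝ≥0} {δ m : ℝ}

theorem mgf_sum_sq_eq (hlaw : ∀ i, HasLaw (ξ i) (gaussianReal 0 v) P) (hind : iIndepFun ξ P)
    (hv : v ≠ 0) (m : ℝ) :
    mgf (fun ω => ∑ i, ξ i ω ^ 2) P (m / v) = √(1 / (1 - 2 * m)) ^ Fintype.card ι := by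
  have hsq : iIndepFun (fun i ω => ξ i ω ^ 2) P :=
    hind.comp (fun _ x => x ^ 2) fun _ => by fun_prop
  have hmgf := hsq.mgf_sum₀ (t := m / v) (fun i => (hlaw i).aemeasurable.pow_const 2) Finset.univ
  simp only [mgf_sq_of_gaussianReal (hlaw _) hv, Finset.prod_const, Finset.card_univ] at hmgf
  rw [← hmgf]
  congr 1
  ext ω
  simp

theorem mgf_sum_sq_le (hlaw : ∀ i, HasLaw (ξ i) (gaussianReal 0 v) P) (hind : iIndepFun ξ P)
    (hv : v ≠ 0) (hm : m ≤ 1 / 4) :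
    mgf (fun ω => ∑ i, ξ i ω ^ 2) P (m / v) ≤ Real.exp (Fintype.card ι * (m + 4 * m ^ 2)) := by
  rw [mgf_sum_sq_eq hlaw hind hv, Real.exp_nat_mul]
  gcongr
  exact sqrt_one_div_one_sub_le hm

variable [IsProbabilityMeasure P]

theorem integrable_exp_sum_sq (hlaw : ∀ i, HasLaw (ξ i) (gaussianReal 0 v) P)
    (hind : iIndepFun ξ P) (hv : v ≠ 0) (hm : m ≤ 1 / 4) :
    Integrable (fun ω => Real.exp (m / v * ∑ i, ξ i ω ^ 2)) P := by
  have hpos : 0 < 1 - 2 * m := by linarith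
  rw [← mgf_pos_iff, mgf_sum_sq_eq hlaw hind hv]
  positivity

/-- Chernoff's bound at `δ / (8 v)`, resp. `-δ / (8 v)`. -/
theorem measure_lt_abs_sum_sq_sub_le (hlaw : ∀ i, HasLaw (ξ i) (gaussianReal 0 v) P)
    (hind : iIndepFun ξ P) (hδ0 : 0 ≤ δ) (hδ1 : δ ≤ 1) :
    P {ω | δ * (Fintype.card ι * v) < |∑ i, ξ i ω ^ 2 - Fintype.card ι * v|}
      ≤ ENNReal.ofReal (2 * Real.exp (-(Fintype.card ι * δ ^ 2 / 16))) := by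
  rcases eq_or_ne v 0 with rfl | hv
  · have hzero : ∀ᵐ ω ∂P, ∀ i, ξ i ω = 0 :=
      ae_all_iff.mpr fun i => ae_eq_zero_of_gaussianReal_zero (hlaw i)
    refine (measure_mono_null (fun ω hω hz => ?_) (ae_iff.mp hzero)).trans_le zero_le
    simp [hz] at hω
  have hchernoff : ∀ m : ℝ, m ≤ 1 / 4 → ∀ b : ℝ, m * (1 + b) - (m + 4 * m ^ 2) = δ ^ 2 / 16 →
      Real.exp (-(m / v) * ((1 + b) * (Fintype.card ι * v))) *
        mgf (fun ω => ∑ i, ξ i ω ^ 2) P (m / v) ≤ Real.exp (-(Fintype.card ι * δ ^ 2 / 16)) := by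
    intro m hm b hb
    refine (mul_le_mul_of_nonneg_left (mgf_sum_sq_le hlaw hind hv hm)
      (Real.exp_pos _).le).trans_eq ?_
    rw [← Real.exp_add, mul_div_assoc, ← hb]
    congr 1
    field_simp
    ring
  refine measure_lt_abs_le_of_tails ?_ ?_
  · refine le_trans ?_ (hchernoff (δ / 8) (by linarith) δ (by ring))
    refine le_of_eq_of_le ?_ (measure_ge_le_exp_mul_mgf _ (by positivity)
      (integrable_exp_sum_sq hlaw hind hv (by linarith)))
    congr! 3 with ω
    constructor <;> intro h <;> linarith
  · refine le_trans ?_ (hchernoff (-(δ / 8)) (by linarith) (-δ) (by ring))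
    refine le_of_eq_of_le ?_ (measure_le_le_exp_mul_mgf _
      (div_nonpos_of_nonpos_of_nonneg (by linarith) v.2)
      (integrable_exp_sum_sq hlaw hind hv (by linarith)))
    congr! 3 with ω
    constructor <;> intro h <;> linarith

end ChiSquared

theorem hasSubgaussianMGF_of_gaussianReal [IsProbabilityMeasure P] {Z : Ω → ℝ} {c : ℝ≥0}
    (hZ : HasLaw Z (gaussianReal 0 c) P) : HasSubgaussianMGF Z c P := by
  have hmgf : ∀ a, mgf Z P a = Real.exp (c * a ^ 2 / 2) := fun a => by
    rw [mgf_gaussianReal hZ.map_eq, zero_mul, zero_add]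
  refine ⟨fun a => ?_, fun a => (hmgf a).le⟩
  rw [← mgf_pos_iff, hmgf]
  positivity

theorem measure_lt_abs_le_of_gaussianReal [IsProbabilityMeasure P] {Z : Ω → ℝ} {c : ℝ≥0}
    (hZ : HasLaw Z (gaussianReal 0 c) P) {t : ℝ} (ht : 0 ≤ t) :
    P {ω | t * √c < |Z ω|} ≤ ENNReal.ofReal (2 * Real.exp (-(t ^ 2 / 2))) := by
  rcases eq_or_ne c 0 with rfl | hc
  · refine (measure_mono_null (fun ω hω hz => ?_)
      (ae_iff.mp (ae_eq_zero_of_gaussianReal_zero hZ))).trans_le zero_le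
    simp [hz] at hω
  have hexp : -(t * √c) ^ 2 / (2 * c) = -(t ^ 2 / 2) := by
    rw [mul_pow, Real.sq_sqrt c.coe_nonneg]
    field_simp
  have hsub := hasSubgaussianMGF_of_gaussianReal hZ
  have hlower : {ω | Z ω ≤ -(t * √c)} = {ω | t * √c ≤ (-Z) ω} := by
    ext ω
    simp only [Set.mem_ofPred_eq, Pi.neg_apply]
    exact le_neg
  refine measure_lt_abs_le_of_tails ?_ ?_
  · exact (hsub.measure_ge_le (by positivity)).trans_eq (by rw [hexp])
  · rw [hlower]
    exact (hsub.neg.measure_ge_le (by positivity)).trans_eq (by rw [hexp])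

/-! ### Linear combinations of independent Gaussian variables -/

section LinearCombination

variable {ι : Type*} [Fintype ι] {g : ι → Ω → ℝ} {v : ℝ≥0}

theorem hasGaussianLaw_linearCombination (hlaw : ∀ i, HasLaw (g i) (gaussianReal 0 v) P)
    (hind : iIndepFun g P) {κ : Type*} [Finite κ] (F : κ → ι → ℝ) :
    HasGaussianLaw (fun ω k => ∑ i, F k i * g i ω) P := by
  have := Fintype.ofFinite κ
  exact (hind.hasGaussianLaw fun i => (hlaw i).hasGaussianLaw).map_fun
    (LinearMap.toContinuousLinearMap (Matrix.mulVecLin (Matrix.of F)))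

variable [IsProbabilityMeasure P]

theorem covariance_linearCombination (hlaw : ∀ i, HasLaw (g i) (gaussianReal 0 v) P)
    (hind : iIndepFun g P) (F G : ι → ℝ) :
    cov[fun ω => ∑ i, F i * g i ω, fun ω => ∑ i, G i * g i ω; P] = v * ∑ i, F i * G i := by
  classical
  have hL2 : ∀ i, MemLp (g i) 2 P := fun i => (hlaw i).hasGaussianLaw.memLp_two
  rw [covariance_fun_sum_fun_sum (fun i => (hL2 i).const_mul (F i))
    (fun i => (hL2 i).const_mul (G i)), Finset.mul_sum]
  refine Finset.sum_congr rfl fun i _ => ?_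
  rw [Finset.sum_eq_single i]
  · rw [covariance_const_mul_left, covariance_const_mul_right,
      covariance_self (hlaw i).aemeasurable, (hlaw i).variance_eq, variance_id_gaussianReal]
    ring
  · intro j _ hji
    rw [covariance_const_mul_left, covariance_const_mul_right,
      (hind.indepFun hji.symm).covariance_eq_zero (hL2 i) (hL2 j), mul_zero, mul_zero]
  · simp

theorem hasLaw_linearCombination (hlaw : ∀ i, HasLaw (g i) (gaussianReal 0 v) P)
    (hind : iIndepFun g P) (F : ι → ℝ) :
    HasLaw (fun ω => ∑ i, F i * g i ω) (gaussianReal 0 (v * (∑ i, F i ^ 2).toNNReal)) P := by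
  have hgauss : HasGaussianLaw (fun ω => ∑ i, F i * g i ω) P :=
    (hasGaussianLaw_linearCombination hlaw hind (fun _ : Unit => F)).eval ()
  refine ⟨hgauss.aemeasurable, ?_⟩
  rw [hgauss.map_eq_gaussianReal]
  congr 1
  · rw [integral_finsetSum _ fun i _ => (hlaw i).hasGaussianLaw.integrable.const_mul _]
    refine Finset.sum_eq_zero fun i _ => ?_
    rw [integral_const_mul, (hlaw i).integral_eq, integral_id_gaussianReal, mul_zero]
  · rw [← covariance_self hgauss.aemeasurable, covariance_linearCombination hlaw hind]
    ext
    simp only [← sq]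
    rw [Real.coe_toNNReal _ (by positivity), NNReal.coe_mul, Real.coe_toNNReal _ (by positivity)]

theorem iIndepFun_linearCombination (hlaw : ∀ i, HasLaw (g i) (gaussianReal 0 v) P)
    (hind : iIndepFun g P) {κ : Type*} [Finite κ] (F : κ → ι → ℝ)
    (hF : ∀ k l, k ≠ l → ∑ i, F k i * F l i = 0) :
    iIndepFun (fun k ω => ∑ i, F k i * g i ω) P := by
  have := Fintype.ofFinite κ
  refine (hasGaussianLaw_linearCombination hlaw hind F).iIndepFun_of_covariance_eq_zero
    fun k l hkl => ?_
  rw [covariance_linearCombination hlaw hind, hF k l hkl, mul_zero]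

theorem measure_lt_abs_linearCombination_le (hlaw : ∀ i, HasLaw (g i) (gaussianReal 0 v) P)
    (hind : iIndepFun g P) (F : ι → ℝ) {t : ℝ} (ht : 0 ≤ t) :
    P {ω | t * √(v * ∑ i, F i ^ 2) < |∑ i, F i * g i ω|}
      ≤ ENNReal.ofReal (2 * Real.exp (-(t ^ 2 / 2))) := by
  have := measure_lt_abs_le_of_gaussianReal (hasLaw_linearCombination hlaw hind F) ht
  rwa [NNReal.coe_mul, Real.coe_toNNReal _ (by positivity)] at this

theorem measure_lt_abs_randomCombination_le {κ : Type*} [Finite κ] {f : κ → Ω → ℝ}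
    (hf : ∀ k, AEMeasurable (f k) P) (hlaw : ∀ i, HasLaw (g i) (gaussianReal 0 v) P)
    (hind : iIndepFun g P) (hfg : IndepFun (fun ω k => f k ω) (fun ω i => g i ω) P)
    {F : (κ → ℝ) → ι → ℝ} (hF : Measurable F) {t : ℝ} (ht : 0 ≤ t) :
    P {ω | t * √(v * ∑ i, F (fun k => f k ω) i ^ 2) < |∑ i, F (fun k => f k ω) i * g i ω|}
      ≤ ENNReal.ofReal (2 * Real.exp (-(t ^ 2 / 2))) := by
  have hFi : ∀ i, Measurable fun x : (κ → ℝ) × (ι → ℝ) => F x.1 i := fun i =>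
    (measurable_pi_apply i).comp (hF.comp measurable_fst)
  refine measure_prodMk_mem_le_of_indepFun (U := fun ω k => f k ω) (V := fun ω i => g i ω)
    (E := {x | t * √(v * ∑ i, F x.1 i ^ 2) < |∑ i, F x.1 i * x.2 i|})
    (aemeasurable_pi_lambda _ hf) (aemeasurable_pi_lambda _ fun i => (hlaw i).aemeasurable) hfg
    ?_ fun u => measure_lt_abs_linearCombination_le hlaw hind (F u) ht
  refine measurableSet_lt (by fun_prop) ?_
  exact (Finset.measurable_sum _ fun i _ => (hFi i).mul (by fun_prop)).abs

end LinearCombination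

end GaussianConcentration

/-! ### The Gram matrix of a Gaussian matrix -/

section OrthResidual

variable {ι : Type*} [Fintype ι]

theorem dotProduct_self_nonneg (α : ι → ℝ) : 0 ≤ α ⬝ᵥ α := by
  simpa using dotProduct_self_star_nonneg α

/-- The component of `β` orthogonal to `α`. It is `β` itself when `α = 0`, because then the
division returns `0`. -/
noncomputable def orthResidual (α β : ι → ℝ) : ι → ℝ := β - (α ⬝ᵥ β / (α ⬝ᵥ α)) • α

theorem orthResidual_dotProduct (α β γ : ι → ℝ) :
    orthResidual α β ⬝ᵥ γ = β ⬝ᵥ γ - α ⬝ᵥ β / (α ⬝ᵥ α) * (α ⬝ᵥ γ) := by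
  rw [orthResidual, sub_dotProduct, smul_dotProduct, smul_eq_mul]

theorem dotProduct_orthResidual (α β : ι → ℝ) : α ⬝ᵥ orthResidual α β = 0 := by
  rw [dotProduct_comm, orthResidual_dotProduct, dotProduct_comm β]
  rcases eq_or_ne α 0 with rfl | hα
  · simp
  · rw [div_mul_cancel₀ _ (dotProduct_self_eq_zero.not.mpr hα), sub_self]

theorem orthResidual_dotProduct_self_le (α β : ι → ℝ) :
    orthResidual α β ⬝ᵥ orthResidual α β ≤ β ⬝ᵥ β := by
  rw [orthResidual_dotProduct, dotProduct_orthResidual, mul_zero, sub_zero, dotProduct_comm,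
    orthResidual_dotProduct, div_mul_eq_mul_div]
  exact sub_le_self _ (div_nonneg (mul_self_nonneg _) (dotProduct_self_nonneg α))

end OrthResidual

section Gram

/-- A random matrix with `d` rows and i.i.d. `N(0, 1/d)` entries. -/
structure IsGaussianMatrix {Ω : Type*} [MeasurableSpace Ω] {p d : ℕ} (P : Measure Ω)
    (A : Ω → Matrix (Fin d) (Fin p) ℝ) : Prop where
  law : ∀ k j, HasLaw (fun ω => A ω k j) (gaussianReal 0 (d : ℝ≥0)⁻¹) P
  indep : iIndepFun (fun (q : Fin d × Fin p) ω => A ω q.1 q.2) P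

variable {Ω : Type*} [MeasurableSpace Ω] {P : Measure Ω} {p d : ℕ}
  {A : Ω → Matrix (Fin d) (Fin p) ℝ}

theorem transpose_mul_self_apply {m n : Type*} [Fintype m] (B : Matrix m n ℝ) (i j : n) :
    (Bᵀ * B) i j = B.col i ⬝ᵥ B.col j := rfl

theorem IsGaussianMatrix.aemeasurable_col (hA : IsGaussianMatrix P A) (k : Fin p) :
    AEMeasurable (fun ω => (A ω).col k) P :=
  aemeasurable_pi_lambda _ fun a => (hA.law a k).aemeasurable

theorem IsGaussianMatrix.indepFun_col (hA : IsGaussianMatrix P A) {J K : Finset (Fin p)}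
    (hJK : Disjoint J K) :
    IndepFun (fun ω (j : J) => (A ω).col j) (fun ω (k : K) => (A ω).col k) P := by
  have h := hA.indep.indepFun_finset₀ (Finset.univ ×ˢ J) (Finset.univ ×ˢ K)
    (Finset.disjoint_product.mpr (Or.inr hJK)) (fun q => (hA.law q.1 q.2).aemeasurable)
  exact h.comp
    (φ := fun x (j : J) a => x ⟨(a, j), by simp⟩) (ψ := fun x (k : K) a => x ⟨(a, k), by simp⟩)
    (measurable_pi_lambda _ fun _ => measurable_pi_lambda _ fun _ => measurable_pi_apply _)
    (measurable_pi_lambda _ fun _ => measurable_pi_lambda _ fun _ => measurable_pi_apply _)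

theorem IsGaussianMatrix.iIndepFun_entry_col (hA : IsGaussianMatrix P A) (k : Fin p) :
    iIndepFun (fun a ω => A ω a k) P :=
  hA.indep.precomp (g := fun a : Fin d => (a, k)) fun _ _ h => (Prod.mk.inj h).1

variable [IsProbabilityMeasure P]

theorem IsGaussianMatrix.measure_mem_le_of_col (hA : IsGaussianMatrix P A) {J K : Finset (Fin p)}
    (hJK : Disjoint J K) {E : Set ((J → Fin d → ℝ) × (K → Fin d → ℝ))} (hE : MeasurableSet E)
    {ε : ℝ≥0∞} (h : ∀ u, P {ω | (u, fun k : K => (A ω).col k) ∈ E} ≤ ε) :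
    P {ω | (fun j : J => (A ω).col j, fun k : K => (A ω).col k) ∈ E} ≤ ε :=
  measure_prodMk_mem_le_of_indepFun (aemeasurable_pi_lambda _ fun _ => hA.aemeasurable_col _)
    (aemeasurable_pi_lambda _ fun _ => hA.aemeasurable_col _) (hA.indepFun_col hJK) hE h

theorem IsGaussianMatrix.hasLaw_dotProduct_col (hA : IsGaussianMatrix P A) (α : Fin d → ℝ)
    (k : Fin p) :
    HasLaw (fun ω => α ⬝ᵥ (A ω).col k) (gaussianReal 0 ((d : ℝ≥0)⁻¹ * (α ⬝ᵥ α).toNNReal)) P := by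
  have h := hasLaw_linearCombination (fun a => hA.law a k) (hA.iIndepFun_entry_col k) α
  simp only [sq] at h
  exact h

theorem coe_inv_mul_toNNReal_dotProduct (d : ℕ) {ι : Type*} [Fintype ι] (α : ι → ℝ) :
    (((d : ℝ≥0)⁻¹ * (α ⬝ᵥ α).toNNReal : ℝ≥0) : ℝ) = (d : ℝ)⁻¹ * (α ⬝ᵥ α) := by
  rw [NNReal.coe_mul, Real.coe_toNNReal _ (dotProduct_self_nonneg _),
    NNReal.coe_inv, NNReal.coe_natCast]

theorem IsGaussianMatrix.iIndepFun_dotProduct_col (hA : IsGaussianMatrix P A) {κ : Type*}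
    [Finite κ] (α : κ → Fin d → ℝ) (c : κ → Fin p)
    (hα : ∀ s t, s ≠ t → c s = c t → α s ⬝ᵥ α t = 0) :
    iIndepFun (fun s ω => α s ⬝ᵥ (A ω).col (c s)) P := by
  set F : κ → Fin d × Fin p → ℝ := fun s q => if q.2 = c s then α s q.1 else 0 with hF
  have hsum : ∀ s (x : Fin d × Fin p → ℝ), ∑ q, F s q * x q = ∑ a, α s a * x (a, c s) := by
    intro s x
    rw [Fintype.sum_prod_type]
    refine Finset.sum_congr rfl fun a _ => ?_
    simp [hF]
  have hind := iIndepFun_linearCombination (fun q => hA.law q.1 q.2) hA.indep F fun s t hst => ?_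
  · simp only [hsum _ fun q : Fin d × Fin p => A _ q.1 q.2] at hind
    exact hind
  · rw [hsum]
    by_cases hc : c s = c t
    · simpa [hF, hc, dotProduct] using hα s t hst hc
    · simp [hF, hc]

theorem IsGaussianMatrix.iIndepFun_dotProduct_col_of_injective (hA : IsGaussianMatrix P A)
    (α : Fin d → ℝ) {κ : Type*} [Finite κ] {c : κ → Fin p} (hc : c.Injective) :
    iIndepFun (fun s ω => α ⬝ᵥ (A ω).col (c s)) P :=
  hA.iIndepFun_dotProduct_col (fun _ => α) c fun _ _ hst hcst => absurd (hc hcst) hst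

theorem IsGaussianMatrix.measure_lt_abs_sum_mul_col_le (hA : IsGaussianMatrix P A)
    (α : Fin d → ℝ) (K : Finset (Fin p)) (c : Fin p → ℝ) {t : ℝ} (ht : 0 ≤ t) :
    P {ω | t * √((d : ℝ)⁻¹ * (α ⬝ᵥ α) * ∑ k : K, c k ^ 2)
        < |∑ k : K, c k * (α ⬝ᵥ (A ω).col k)|}
      ≤ ENNReal.ofReal (2 * Real.exp (-(t ^ 2 / 2))) := by
  rw [← coe_inv_mul_toNNReal_dotProduct]
  exact measure_lt_abs_linearCombination_le (fun k : K => hA.hasLaw_dotProduct_col α k)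
    (hA.iIndepFun_dotProduct_col_of_injective α Subtype.val_injective) (fun k => c k) ht

theorem IsGaussianMatrix.measure_lt_abs_sum_sq_col_le (hA : IsGaussianMatrix P A)
    (α : Fin d → ℝ) (K : Finset (Fin p)) {δ : ℝ} (hδ0 : 0 ≤ δ) (hδ1 : δ ≤ 1) :
    P {ω | δ * (K.card * ((d : ℝ)⁻¹ * (α ⬝ᵥ α)))
        < |∑ k : K, (α ⬝ᵥ (A ω).col k) ^ 2 - K.card * ((d : ℝ)⁻¹ * (α ⬝ᵥ α))|}
      ≤ ENNReal.ofReal (2 * Real.exp (-(K.card * δ ^ 2 / 16))) := by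
  rw [← coe_inv_mul_toNNReal_dotProduct, ← Fintype.card_coe K]
  exact measure_lt_abs_sum_sq_sub_le (fun k : K => hA.hasLaw_dotProduct_col α k)
    (hA.iIndepFun_dotProduct_col_of_injective α Subtype.val_injective) hδ0 hδ1

theorem IsGaussianMatrix.indepFun_dotProduct_col (hA : IsGaussianMatrix P A) {α β : Fin d → ℝ}
    (hαβ : α ⬝ᵥ β = 0) (K : Finset (Fin p)) :
    IndepFun (fun ω (k : K) => α ⬝ᵥ (A ω).col k) (fun ω (k : K) => β ⬝ᵥ (A ω).col k) P := by
  let γ : K ⊕ K → Fin d → ℝ := Sum.elim (fun _ => α) (fun _ => β)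
  let c : K ⊕ K → Fin p := Sum.elim Subtype.val Subtype.val
  have hind : iIndepFun (fun s ω => γ s ⬝ᵥ (A ω).col (c s)) P := by
    refine hA.iIndepFun_dotProduct_col γ c ?_
    rintro (k | k) (l | l) hkl hcol
    · exact absurd (congrArg Sum.inl (Subtype.ext hcol)) hkl
    · exact hαβ
    · exact (dotProduct_comm β α).trans hαβ
    · exact absurd (congrArg Sum.inr (Subtype.ext hcol)) hkl
  have hdisj : Disjoint (Finset.univ.map ⟨Sum.inl, Sum.inl_injective⟩ : Finset (K ⊕ K))
      (Finset.univ.map ⟨Sum.inr, Sum.inr_injective⟩) := by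
    rw [Finset.disjoint_left]
    simp
  exact (hind.indepFun_finset₀ _ _ hdisj
      fun s => (hA.hasLaw_dotProduct_col (γ s) (c s)).aemeasurable).comp
    (φ := fun x (k : K) => x ⟨Sum.inl k, by simp⟩) (ψ := fun x (k : K) => x ⟨Sum.inr k, by simp⟩)
    (measurable_pi_lambda _ fun _ => measurable_pi_apply _)
    (measurable_pi_lambda _ fun _ => measurable_pi_apply _)

theorem IsGaussianMatrix.measure_lt_abs_bilinear_col_le (hA : IsGaussianMatrix P A)
    {α β : Fin d → ℝ} (hαβ : α ⬝ᵥ β = 0) (M : Matrix (Fin p) (Fin p) ℝ) (K : Finset (Fin p))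
    {t : ℝ} (ht : 0 ≤ t) :
    P {ω | t * √((d : ℝ)⁻¹ * (β ⬝ᵥ β) * ∑ k : K, (∑ l : K, M k l * (α ⬝ᵥ (A ω).col l)) ^ 2)
        < |∑ k : K, (∑ l : K, M k l * (α ⬝ᵥ (A ω).col l)) * (β ⬝ᵥ (A ω).col k)|}
      ≤ ENNReal.ofReal (2 * Real.exp (-(t ^ 2 / 2))) := by
  rw [← coe_inv_mul_toNNReal_dotProduct]
  exact measure_lt_abs_randomCombination_le
    (fun k : K => (hA.hasLaw_dotProduct_col α k).aemeasurable)
    (fun k : K => hA.hasLaw_dotProduct_col β k)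
    (hA.iIndepFun_dotProduct_col_of_injective β Subtype.val_injective)
    (hA.indepFun_dotProduct_col hαβ K)
    (F := fun x k => ∑ l : K, M k l * x l) (by fun_prop) ht

theorem measure_gram_diag_le (hA : IsGaussianMatrix P A) (hd : 1 ≤ d) (i : Fin p)
    {δ : ℝ} (hδ0 : 0 ≤ δ) (hδ1 : δ ≤ 1) :
    P {ω | δ < |((A ω)ᵀ * A ω) i i - 1|}
      ≤ ENNReal.ofReal (2 * Real.exp (-(d * δ ^ 2 / 16))) := by
  have h := measure_lt_abs_sum_sq_sub_le (fun a => hA.law a i) (hA.iIndepFun_entry_col i) hδ0 hδ1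
  have hd' : (d : ℝ) ≠ 0 := by positivity
  simp only [Fintype.card_fin, NNReal.coe_inv, NNReal.coe_natCast, mul_inv_cancel₀ hd',
    mul_one, sq (A _ _ _)] at h
  exact h

theorem measure_gram_row_le (hA : IsGaussianMatrix P A) (i : Fin p) (c : Fin p → ℝ)
    {t : ℝ} (ht : 0 ≤ t) :
    P {ω | t * √((d : ℝ)⁻¹ * (((A ω)ᵀ * A ω) i i * ∑ k, c k ^ 2))
        < |∑ k ∈ Finset.univ.erase i, c k * ((A ω)ᵀ * A ω) i k|}
      ≤ ENNReal.ofReal (2 * Real.exp (-(t ^ 2 / 2))) := by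
  set K := Finset.univ.erase i with hK
  have h := hA.measure_mem_le_of_col (J := {i}) (K := K) (by simp [hK])
    (E := {x | t * √((d : ℝ)⁻¹ * (x.1 ⟨i, by simp⟩ ⬝ᵥ x.1 ⟨i, by simp⟩) * ∑ k : K, c k ^ 2)
      < |∑ k : K, c k * (x.1 ⟨i, by simp⟩ ⬝ᵥ x.2 k)|})
    (by simp only [dotProduct]; exact measurableSet_lt (by fun_prop) (by fun_prop))
    fun u => hA.measure_lt_abs_sum_mul_col_le (u ⟨i, by simp⟩) K c ht
  refine (measure_mono fun ω hω => ?_).trans h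
  simp only [Set.mem_ofPred_eq, transpose_mul_self_apply] at hω ⊢
  rw [Finset.sum_coe_sort K fun k => c k * ((A ω).col i ⬝ᵥ (A ω).col k),
    Finset.sum_coe_sort K fun k => c k ^ 2, mul_assoc]
  refine lt_of_le_of_lt ?_ hω
  gcongr
  · exact dotProduct_self_nonneg _
  · exact Finset.subset_univ _

theorem measure_gram_norm_le (hA : IsGaussianMatrix P A) (i : Fin p) :
    P {ω | 2 * (p * ((d : ℝ)⁻¹ * ((A ω)ᵀ * A ω) i i))
        < ∑ k ∈ Finset.univ.erase i, ((A ω)ᵀ * A ω) i k ^ 2}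
      ≤ ENNReal.ofReal (2 * Real.exp (-((p - 1) / 16))) := by
  set K := Finset.univ.erase i with hK
  have hcard : (K.card : ℝ) = p - 1 := by
    rw [hK, Finset.card_erase_of_mem (Finset.mem_univ i), Finset.card_fin,
      Nat.cast_pred i.pos]
  have h := hA.measure_mem_le_of_col (J := {i}) (K := K) (by simp [hK])
    (E := {x | 1 * (K.card * ((d : ℝ)⁻¹ * (x.1 ⟨i, by simp⟩ ⬝ᵥ x.1 ⟨i, by simp⟩)))
      < |∑ k : K, (x.1 ⟨i, by simp⟩ ⬝ᵥ x.2 k) ^ 2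
        - K.card * ((d : ℝ)⁻¹ * (x.1 ⟨i, by simp⟩ ⬝ᵥ x.1 ⟨i, by simp⟩))|})
    (by simp only [dotProduct]; exact measurableSet_lt (by fun_prop) (by fun_prop))
    fun u => hA.measure_lt_abs_sum_sq_col_le (u ⟨i, by simp⟩) K zero_le_one le_rfl
  rw [hcard, one_pow, mul_one] at h
  refine (measure_mono fun ω hω => ?_).trans h
  simp only [Set.mem_ofPred_eq, transpose_mul_self_apply] at hω ⊢
  rw [Finset.sum_coe_sort K fun k => ((A ω).col i ⬝ᵥ (A ω).col k) ^ 2]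
  have hnorm : 0 ≤ (d : ℝ)⁻¹ * ((A ω).col i ⬝ᵥ (A ω).col i) :=
    mul_nonneg (by positivity) (dotProduct_self_nonneg _)
  exact lt_of_lt_of_le (by linarith) (le_abs_self _)

/-- Conditionally on the columns `i` and `j`, the coefficients of the bilinear form depend on the
other columns only through their inner products with column `i`. Passing from column `j` to its
component orthogonal to column `i` makes its inner products with the other columns independent of
these coefficients. -/
theorem measure_gram_bilinear_le (hA : IsGaussianMatrix P A) (M : Matrix (Fin p) (Fin p) ℝ)
    (i j : Fin p) {t : ℝ} (ht : 0 ≤ t) :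
    P {ω | t * √((d : ℝ)⁻¹ * (((A ω)ᵀ * A ω) j j * ∑ k ∈ {i, j}ᶜ,
            (∑ l ∈ ({i, j} : Finset (Fin p))ᶜ, M k l * ((A ω)ᵀ * A ω) i l) ^ 2))
        < |∑ k ∈ ({i, j} : Finset (Fin p))ᶜ,
            (∑ l ∈ ({i, j} : Finset (Fin p))ᶜ, M k l * ((A ω)ᵀ * A ω) i l)
            * (((A ω)ᵀ * A ω) j k
              - ((A ω)ᵀ * A ω) i j / ((A ω)ᵀ * A ω) i i * ((A ω)ᵀ * A ω) i k)|}
      ≤ ENNReal.ofReal (2 * Real.exp (-(t ^ 2 / 2))) := by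
  set J : Finset (Fin p) := {i, j} with hJ
  set K := Jᶜ
  let i' : J := ⟨i, by simp [hJ]⟩
  let j' : J := ⟨j, by simp [hJ]⟩
  have h := hA.measure_mem_le_of_col (J := J) (K := K) disjoint_compl_right
    (E := {x | t * √((d : ℝ)⁻¹
          * (orthResidual (x.1 i') (x.1 j') ⬝ᵥ orthResidual (x.1 i') (x.1 j'))
          * ∑ k : K, (∑ l : K, M k l * (x.1 i' ⬝ᵥ x.2 l)) ^ 2)
      < |∑ k : K, (∑ l : K, M k l * (x.1 i' ⬝ᵥ x.2 l))
          * (orthResidual (x.1 i') (x.1 j') ⬝ᵥ x.2 k)|})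
    (by
      simp only [orthResidual, dotProduct, Pi.sub_apply, Pi.smul_apply, smul_eq_mul]
      exact measurableSet_lt (by fun_prop) (by fun_prop))
    fun u => hA.measure_lt_abs_bilinear_col_le (dotProduct_orthResidual (u i') (u j')) M K ht
  refine (measure_mono fun ω hω => ?_).trans h
  simp only [Set.mem_ofPred_eq, transpose_mul_self_apply] at hω
  have hcoeff : ∀ k, ∑ l : K, M k l * ((A ω).col i ⬝ᵥ (A ω).col l)
      = ∑ l ∈ K, M k l * ((A ω).col i ⬝ᵥ (A ω).col l) := fun k =>
    Finset.sum_coe_sort K fun l => M k l * ((A ω).col i ⬝ᵥ (A ω).col l)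
  simp only [Set.mem_ofPred_eq, orthResidual_dotProduct _ _ ((A ω).col _), i', j', hcoeff]
  rw [Finset.sum_coe_sort K fun k => (∑ l ∈ K, M k l * ((A ω).col i ⬝ᵥ (A ω).col l)) ^ 2,
    Finset.sum_coe_sort K fun k => (∑ l ∈ K, M k l * ((A ω).col i ⬝ᵥ (A ω).col l))
      * ((A ω).col j ⬝ᵥ (A ω).col k - (A ω).col i ⬝ᵥ (A ω).col j
        / ((A ω).col i ⬝ᵥ (A ω).col i) * ((A ω).col i ⬝ᵥ (A ω).col k)), mul_assoc]
  refine lt_of_le_of_lt ?_ hω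
  gcongr
  exact orthResidual_dotProduct_self_le _ _

end Gram

/-! ### Empirical second moments of the observations -/

section Sampling

variable {Ω : Type*} [MeasurableSpace Ω] {P : Measure Ω} {p d n : ℕ}
  {Sig : Matrix (Fin p) (Fin p) ℝ} {σ : ℝ≥0}

theorem dotProduct_ofLp_eq_innerSL (b : Fin p → ℝ) (x : EuclideanSpace ℝ (Fin p)) :
    b ⬝ᵥ x.ofLp = innerSL ℝ (WithLp.toLp 2 b) x := by
  simp [PiLp.inner_apply, dotProduct, mul_comm]

theorem hasLaw_dotProduct_multivariateGaussian (hSig : Sig.PosSemidef)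
    {Z : Ω → EuclideanSpace ℝ (Fin p)} (hZ : HasLaw Z (multivariateGaussian 0 Sig) P)
    (b : Fin p → ℝ) :
    HasLaw (fun ω => b ⬝ᵥ (Z ω).ofLp) (gaussianReal 0 (b ⬝ᵥ (Sig *ᵥ b)).toNNReal) P := by
  simp only [dotProduct_ofLp_eq_innerSL b (Z _)]
  have hgauss := hZ.hasGaussianLaw.map_fun (innerSL ℝ (WithLp.toLp 2 b))
  refine ⟨hgauss.aemeasurable, ?_⟩
  rw [hgauss.map_eq_gaussianReal]
  congr 2
  · rw [ContinuousLinearMap.integral_comp_comm _ hZ.hasGaussianLaw.integrable, hZ.integral_eq,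
      integral_id_multivariateGaussian, map_zero]
  · rw [← covariance_self hgauss.aemeasurable,
      hZ.covariance_fun_comp (f := innerSL ℝ (WithLp.toLp 2 b))
        (g := innerSL ℝ (WithLp.toLp 2 b)) (by fun_prop) (by fun_prop)]
    exact (covarianceBilin_apply_eq_cov IsGaussian.memLp_two_id _ _).symm.trans
      (by rw [covarianceBilin_multivariateGaussian hSig])

variable {A : Ω → Matrix (Fin d) (Fin p) ℝ} {X : Fin n → Ω → EuclideanSpace ℝ (Fin p)}
  {W : Fin n → Ω → Fin d → ℝ}

namespace IsSensingModel

theorem isGaussianMatrix (h : IsSensingModel P Sig σ A X W) : IsGaussianMatrix P A :=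
  ⟨h.law_A, h.indep_A⟩

theorem hasGaussianLaw_form (h : IsSensingModel P Sig σ A X W) (b : Fin p → ℝ) (w : Fin d → ℝ) :
    HasGaussianLaw (fun ω (s : Fin n) => b ⬝ᵥ (X s ω).ofLp + w ⬝ᵥ W s ω) P := by
  have hX : HasGaussianLaw (fun ω s => X s ω) P :=
    h.indep_X.hasGaussianLaw fun s => (h.law_X s).hasGaussianLaw
  have hW : HasGaussianLaw (fun ω (q : Fin n × Fin d) => W q.1 ω q.2) P :=
    h.indep_W.hasGaussianLaw fun q => (h.law_W q.1 q.2).hasGaussianLaw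
  let L : (Fin n → EuclideanSpace ℝ (Fin p)) × (Fin n × Fin d → ℝ) →ₗ[ℝ] (Fin n → ℝ) :=
    { toFun := fun x s => b ⬝ᵥ (x.1 s).ofLp + w ⬝ᵥ fun k => x.2 (s, k)
      map_add' := fun x y => by
        ext s
        simp only [Prod.fst_add, Prod.snd_add, Pi.add_apply, WithLp.ofLp_add, dotProduct,
          mul_add, Finset.sum_add_distrib]
        ring
      map_smul' := fun c x => by
        ext s
        simp only [Prod.smul_fst, Prod.smul_snd, Pi.smul_apply, WithLp.ofLp_smul, smul_eq_mul,
          dotProduct, RingHom.id_apply, mul_add, Finset.mul_sum, mul_left_comm c] }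
  exact (h.indep_X_W.hasGaussianLaw hX hW).map_fun (LinearMap.toContinuousLinearMap L)

theorem indepFun_form (h : IsSensingModel P Sig σ A X W) (b : Fin p → ℝ) (w : Fin d → ℝ)
    (s s' : Fin n) : IndepFun (fun ω => b ⬝ᵥ (X s ω).ofLp) (fun ω => w ⬝ᵥ W s' ω) P :=
  h.indep_X_W.comp (φ := fun x : Fin n → EuclideanSpace ℝ (Fin p) => b ⬝ᵥ (x s).ofLp)
    (ψ := fun y : Fin n × Fin d → ℝ => w ⬝ᵥ fun k => y (s', k))
    (by simp only [dotProduct]; fun_prop) (by simp only [dotProduct]; fun_prop)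

theorem indepFun_signal_form (h : IsSensingModel P Sig σ A X W) (b : Fin p → ℝ) {s s' : Fin n}
    (hs : s ≠ s') : IndepFun (fun ω => b ⬝ᵥ (X s ω).ofLp) (fun ω => b ⬝ᵥ (X s' ω).ofLp) P :=
  (h.indep_X.indepFun hs).comp (φ := fun x : EuclideanSpace ℝ (Fin p) => b ⬝ᵥ x.ofLp)
    (ψ := fun x : EuclideanSpace ℝ (Fin p) => b ⬝ᵥ x.ofLp)
    (by simp only [dotProduct]; fun_prop) (by simp only [dotProduct]; fun_prop)

variable [IsProbabilityMeasure P]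

theorem hasLaw_noise_form (h : IsSensingModel P Sig σ A X W) (w : Fin d → ℝ) (s : Fin n) :
    HasLaw (fun ω => w ⬝ᵥ W s ω) (gaussianReal 0 (σ ^ 2 * (∑ k, w k ^ 2).toNNReal)) P :=
  hasLaw_linearCombination (h.law_W s) (h.indep_W.precomp (Prod.mk_right_injective s)) w

theorem indepFun_noise_form (h : IsSensingModel P Sig σ A X W) (w : Fin d → ℝ) {s s' : Fin n}
    (hs : s ≠ s') : IndepFun (fun ω => w ⬝ᵥ W s ω) (fun ω => w ⬝ᵥ W s' ω) P := by
  classical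
  have hind := (iIndepFun_linearCombination (g := fun (q : Fin n × Fin d) ω => W q.1 ω q.2)
    (fun q => h.law_W q.1 q.2) h.indep_W
    (fun s q => if q.1 = s then w q.2 else 0) fun a b hab => ?_).indepFun hs
  · simpa only [dotProduct, Fintype.sum_prod_type, ite_mul, zero_mul, Finset.sum_ite_irrel,
      Finset.sum_const_zero, Finset.sum_ite_eq', Finset.mem_univ, if_true] using hind
  · refine Finset.sum_eq_zero fun q _ => ?_
    split_ifs with ha hb
    · exact absurd (ha.symm.trans hb) hab
    all_goals simp

theorem hasLaw_form (h : IsSensingModel P Sig σ A X W) (hSig : Sig.PosSemidef)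
    (b : Fin p → ℝ) (w : Fin d → ℝ) (s : Fin n) :
    HasLaw (fun ω => b ⬝ᵥ (X s ω).ofLp + w ⬝ᵥ W s ω)
      (gaussianReal 0 (b ⬝ᵥ (Sig *ᵥ b) + σ ^ 2 * ∑ k, w k ^ 2).toNNReal) P := by
  have hvar : (b ⬝ᵥ (Sig *ᵥ b) + σ ^ 2 * ∑ k, w k ^ 2).toNNReal
      = (b ⬝ᵥ (Sig *ᵥ b)).toNNReal + σ ^ 2 * (∑ k, w k ^ 2).toNNReal := by
    rw [Real.toNNReal_add (by simpa using hSig.dotProduct_mulVec_nonneg b) (by positivity),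
      Real.toNNReal_mul (by positivity), ← NNReal.coe_pow, Real.toNNReal_coe]
  have hX := hasLaw_dotProduct_multivariateGaussian hSig (h.law_X s) b
  have hW := h.hasLaw_noise_form w s
  refine ⟨hX.aemeasurable.add hW.aemeasurable, ?_⟩
  have hmap := gaussianReal_add_gaussianReal_of_indepFun (h.indepFun_form b w s s) hX.map_eq
    hW.map_eq
  rwa [add_zero, ← hvar] at hmap

theorem iIndepFun_form (h : IsSensingModel P Sig σ A X W) (hSig : Sig.PosSemidef)
    (b : Fin p → ℝ) (w : Fin d → ℝ) :
    iIndepFun (fun (s : Fin n) ω => b ⬝ᵥ (X s ω).ofLp + w ⬝ᵥ W s ω) P := by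
  have hX : ∀ s, MemLp (fun ω => b ⬝ᵥ (X s ω).ofLp) 2 P := fun s =>
    (hasLaw_dotProduct_multivariateGaussian hSig (h.law_X s) b).hasGaussianLaw.memLp_two
  have hW : ∀ s, MemLp (fun ω => w ⬝ᵥ W s ω) 2 P := fun s =>
    (h.hasLaw_noise_form w s).hasGaussianLaw.memLp_two
  refine (h.hasGaussianLaw_form b w).iIndepFun_of_covariance_eq_zero fun s s' hs => ?_
  refine (covariance_add_left (hX s) (hW s) ((hX s').add (hW s'))).trans ?_
  rw [covariance_add_right (hX s) (hX s') (hW s'), covariance_add_right (hW s) (hX s') (hW s'),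
    (h.indepFun_signal_form b hs).covariance_eq_zero (hX s) (hX s'),
    (h.indepFun_form b w s s').covariance_eq_zero (hX s) (hW s'),
    (h.indepFun_form b w s' s).symm.covariance_eq_zero (hW s) (hX s'),
    (h.indepFun_noise_form w hs).covariance_eq_zero (hW s) (hW s')]
  simp

theorem measure_form_le (h : IsSensingModel P Sig σ A X W) (hSig : Sig.PosSemidef)
    (b : Fin p → ℝ) (w : Fin d → ℝ) {δ : ℝ} (hδ0 : 0 ≤ δ) (hδ1 : δ ≤ 1) :
    P {ω | δ * (n * (b ⬝ᵥ (Sig *ᵥ b) + σ ^ 2 * ∑ k, w k ^ 2))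
        < |∑ s, (b ⬝ᵥ (X s ω).ofLp + w ⬝ᵥ W s ω) ^ 2
          - n * (b ⬝ᵥ (Sig *ᵥ b) + σ ^ 2 * ∑ k, w k ^ 2)|}
      ≤ ENNReal.ofReal (2 * Real.exp (-(n * δ ^ 2 / 16))) := by
  have hquad : 0 ≤ b ⬝ᵥ (Sig *ᵥ b) := by simpa using hSig.dotProduct_mulVec_nonneg b
  have hconc := measure_lt_abs_sum_sq_sub_le (h.hasLaw_form hSig b w)
    (h.iIndepFun_form hSig b w) hδ0 hδ1
  rwa [Real.coe_toNNReal _ (by positivity), Fintype.card_fin] at hconc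

end IsSensingModel

theorem dotProduct_observe (B : Matrix (Fin d) (Fin p) ℝ) (x : EuclideanSpace ℝ (Fin p))
    (y w : Fin d → ℝ) :
    w ⬝ᵥ observe B x y = (Bᵀ *ᵥ w) ⬝ᵥ x.ofLp + w ⬝ᵥ y := by
  rw [observe, dotProduct_add, dotProduct_mulVec, ← mulVec_transpose]

/-- The variance of `⟨w, y⟩` for one observation `y`, conditionally on the sensing matrix `B`. -/
noncomputable def observeVar (Sig : Matrix (Fin p) (Fin p) ℝ) (σ : ℝ)
    (B : Matrix (Fin d) (Fin p) ℝ) (w : Fin d → ℝ) : ℝ :=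
  (Bᵀ *ᵥ w) ⬝ᵥ (Sig *ᵥ (Bᵀ *ᵥ w)) + σ ^ 2 * ∑ k, w k ^ 2

theorem measurable_observeVar {α : Type*} [MeasurableSpace α] {B : α → Matrix (Fin d) (Fin p) ℝ}
    {w : α → Fin d → ℝ} (hB : ∀ k j, Measurable fun a => B a k j)
    (hw : ∀ k, Measurable fun a => w a k) (Sig : Matrix (Fin p) (Fin p) ℝ) (σ : ℝ) :
    Measurable fun a => observeVar Sig σ (B a) (w a) := by
  simp only [observeVar, dotProduct, mulVec, transpose_apply]
  fun_prop

theorem measurable_dotProduct_observe {α : Type*} [MeasurableSpace α]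
    {B : α → Matrix (Fin d) (Fin p) ℝ} {w y : α → Fin d → ℝ} {x : α → EuclideanSpace ℝ (Fin p)}
    (hB : ∀ k j, Measurable fun a => B a k j) (hw : ∀ k, Measurable fun a => w a k)
    (hx : Measurable x) (hy : ∀ k, Measurable fun a => y a k) :
    Measurable fun a => w a ⬝ᵥ observe (B a) (x a) (y a) := by
  simp only [observe, dotProduct, mulVec, Pi.add_apply]
  fun_prop

theorem IsSensingModel.measure_observe_le [IsProbabilityMeasure P]
    (h : IsSensingModel P Sig σ A X W) (hSig : Sig.PosSemidef)
    {w : Matrix (Fin d) (Fin p) ℝ → Fin d → ℝ}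
    (hw : Measurable fun u : Fin d × Fin p → ℝ => w (of fun k j => u (k, j)))
    {δ : ℝ} (hδ0 : 0 ≤ δ) (hδ1 : δ ≤ 1) :
    P {ω | δ * (n * observeVar Sig σ (A ω) (w (A ω)))
        < |∑ s, (w (A ω) ⬝ᵥ observe (A ω) (X s ω) (W s ω)) ^ 2
          - n * observeVar Sig σ (A ω) (w (A ω))|}
      ≤ ENNReal.ofReal (2 * Real.exp (-(n * δ ^ 2 / 16))) := by
  let toMatrix : (Fin d × Fin p → ℝ) → Matrix (Fin d) (Fin p) ℝ := fun u => of fun k j => u (k, j)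
  have hobserve : ∀ u, P {ω | δ * (n * observeVar Sig σ (toMatrix u) (w (toMatrix u)))
        < |∑ s, (w (toMatrix u) ⬝ᵥ observe (toMatrix u) (X s ω) (W s ω)) ^ 2
          - n * observeVar Sig σ (toMatrix u) (w (toMatrix u))|}
      ≤ ENNReal.ofReal (2 * Real.exp (-(n * δ ^ 2 / 16))) := fun u => by
    simp only [dotProduct_observe]
    exact h.measure_form_le hSig _ _ hδ0 hδ1
  refine measure_prodMk_mem_le_of_indepFun
    (U := fun ω (q : Fin d × Fin p) => A ω q.1 q.2)
    (V := fun ω => ((fun s => X s ω), (fun (q : Fin n × Fin d) => W q.1 ω q.2)))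
    (E := {x | δ * (n * observeVar Sig σ (toMatrix x.1) (w (toMatrix x.1)))
        < |∑ s, (w (toMatrix x.1) ⬝ᵥ
            observe (toMatrix x.1) (x.2.1 s) fun k => x.2.2 (s, k)) ^ 2
          - n * observeVar Sig σ (toMatrix x.1) (w (toMatrix x.1))|})
    (aemeasurable_pi_lambda _ fun q => (h.law_A _ _).aemeasurable)
    ((aemeasurable_pi_lambda _ fun s => (h.law_X s).aemeasurable).prodMk
      (aemeasurable_pi_lambda _ fun q => (h.law_W _ _).aemeasurable))
    h.indep_A_XW ?_ hobserve
  let Sample := (Fin n → EuclideanSpace ℝ (Fin p)) × (Fin n × Fin d → ℝ)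
  have hB : ∀ k j, Measurable fun x : (Fin d × Fin p → ℝ) × Sample => toMatrix x.1 k j :=
    fun k j => (measurable_pi_apply (k, j)).comp measurable_fst
  have hwB : ∀ k, Measurable fun x : (Fin d × Fin p → ℝ) × Sample => w (toMatrix x.1) k :=
    fun k => (measurable_pi_iff.mp hw k).comp measurable_fst
  have hvar := measurable_observeVar hB hwB Sig σ
  exact measurableSet_lt (by fun_prop) <| ((Finset.measurable_fun_sum _ fun s _ =>
    (measurable_dotProduct_observe hB hwB (by fun_prop) (by fun_prop)).pow_const 2).sub
      (hvar.const_mul _)).abs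

end Sampling

/-! ### The bias of the covariance estimator on the concentration event -/

section Deterministic

variable {p : ℕ} {G Sig B : Matrix (Fin p) (Fin p) ℝ} {δ ε ν : ℝ}

/-- The product of `M` with the restriction of the vector `x` to the indices in `K`. -/
noncomputable def mulVecOn (M : Matrix (Fin p) (Fin p) ℝ) (K : Finset (Fin p)) (x : Fin p → ℝ) :
    Fin p → ℝ :=
  fun k => ∑ l ∈ K, M k l * x l

/-- The products of `M` with the off-diagonal parts of the rows of a Gram matrix `G`, one further
entry being deleted (none when `i = j`), are small compared with the rows of `M`. -/
def RowBound (G M : Matrix (Fin p) (Fin p) ℝ) (ε : ℝ) : Prop :=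
  ∀ i j a, |mulVecOn M {i, j}ᶜ (G i) a| ≤ 2 * ε * √(∑ k, M a k ^ 2)

/-- The concentration properties of the Gram matrix `G = AᵀA` of a Gaussian matrix, where `B` is a
square root of `Sig` in the sense that `Sig = BᵀB`. In the field `bilinear`, row `j` of `G` is
replaced by its residual against row `i`, which makes it independent of the coefficients. -/
structure IsGoodGram (G Sig B : Matrix (Fin p) (Fin p) ℝ) (δ ε ν : ℝ) : Prop where
  symm : ∀ i j, G i j = G j i
  diag : ∀ i, |G i i - 1| ≤ δ
  row_one : RowBound G 1 ε
  row_sig : RowBound G Sig ε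
  row_off : RowBound G (offPart Sig) ε
  row_root : RowBound G B ε
  norm : ∀ i, ∑ k ∈ ({i} : Finset (Fin p))ᶜ, G i k ^ 2 ≤ 4 * ν
  bilinear : ∀ i j, i ≠ j →
    |∑ k ∈ {i, j}ᶜ, mulVecOn Sig {i, j}ᶜ (G i) k * (G j k - G i j / G i i * G i k)|
      ≤ 2 * ε * √(∑ k ∈ {i, j}ᶜ, mulVecOn Sig {i, j}ᶜ (G i) k ^ 2)

/-- The bound on the error of `G i ⬝ᵥ (Sig *ᵥ G j)` as an estimate of `Sig i j`. -/
noncomputable def gramError (Sig : Matrix (Fin p) (Fin p) ℝ) (δ ε ν : ℝ) : ℝ :=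
  3 * δ + 15 * ε * maxColNorm Sig
    + 4 * ε * (2 * √ν + 2 * ε * offFrobenius Sig) * (1 + 4 * √ν)

theorem offFrobenius_nonneg (M : Matrix (Fin p) (Fin p) ℝ) : 0 ≤ offFrobenius M :=
  Real.sqrt_nonneg _

theorem sq_offFrobenius (M : Matrix (Fin p) (Fin p) ℝ) :
    offFrobenius M ^ 2 = ∑ i, ∑ j, offPart M i j ^ 2 :=
  Real.sq_sqrt (by positivity)

theorem sum_eq_add_add_sum_compl_pair {i j : Fin p} (hij : i ≠ j) (f : Fin p → ℝ) :
    ∑ k, f k = f i + f j + ∑ k ∈ ({i, j} : Finset (Fin p))ᶜ, f k := by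
  rw [← Finset.sum_add_sum_compl {i, j} f, Finset.sum_pair hij]

theorem mulVec_eq_add_add_mulVecOn {i j : Fin p} (hij : i ≠ j) (x : Fin p → ℝ) (k : Fin p) :
    (Sig *ᵥ x) k = Sig k i * x i + Sig k j * x j + mulVecOn Sig {i, j}ᶜ x k :=
  sum_eq_add_add_sum_compl_pair hij _

theorem mulVecOn_eq_add_mulVecOn_offPart (hdiag : ∀ i, Sig i i = 1) {K : Finset (Fin p)}
    {k : Fin p} (hk : k ∈ K) (x : Fin p → ℝ) :
    mulVecOn Sig K x k = x k + mulVecOn (offPart Sig) K x k := by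
  have hsplit : ∀ l, Sig k l * x l = (if l = k then x k else 0) + offPart Sig k l * x l := by
    intro l
    by_cases hl : l = k
    · subst hl; simp [offPart, hdiag]
    · simp [offPart, hl, Ne.symm hl]
  simp only [mulVecOn, hsplit, Finset.sum_add_distrib, Finset.sum_ite_eq', hk, if_true]

theorem dotProduct_mulVec_eq_pair_expansion (hSig : ∀ k l, Sig k l = Sig l k) {i j : Fin p}
    (hij : i ≠ j) (x y : Fin p → ℝ) :
    x ⬝ᵥ (Sig *ᵥ y)
      = (Sig i i * (x i * y i) + Sig i j * (x i * y j + x j * y i) + Sig j j * (x j * y j))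
      + (x i * mulVecOn Sig {i, j}ᶜ y i + x j * mulVecOn Sig {i, j}ᶜ y j
        + y i * mulVecOn Sig {i, j}ᶜ x i + y j * mulVecOn Sig {i, j}ᶜ x j)
      + ∑ k ∈ {i, j}ᶜ, mulVecOn Sig {i, j}ᶜ x k * y k := by
  set K : Finset (Fin p) := {i, j}ᶜ
  have hcross : ∑ k ∈ K, x k * mulVecOn Sig K y k = ∑ k ∈ K, mulVecOn Sig K x k * y k := by
    simp_rw [mulVecOn, Finset.sum_mul, Finset.mul_sum]
    rw [Finset.sum_comm]
    exact Finset.sum_congr rfl fun k _ => Finset.sum_congr rfl fun l _ => by rw [hSig l k]; ring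
  have hK : ∑ k ∈ K, x k * (Sig *ᵥ y) k
      = y i * mulVecOn Sig K x i + y j * mulVecOn Sig K x j
        + ∑ k ∈ K, mulVecOn Sig K x k * y k := by
    rw [← hcross, mulVecOn, mulVecOn, Finset.mul_sum, Finset.mul_sum, ← Finset.sum_add_distrib,
      ← Finset.sum_add_distrib]
    exact Finset.sum_congr rfl fun k _ => by
      rw [mulVec_eq_add_add_mulVecOn hij, hSig k i, hSig k j]; ring
  rw [dotProduct, sum_eq_add_add_sum_compl_pair hij, hK, mulVec_eq_add_add_mulVecOn hij,
    mulVec_eq_add_add_mulVecOn hij, hSig j i]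
  ring

theorem abs_apply_le_one (hSig : Sig.PosSemidef) (hdiag : ∀ i, Sig i i = 1) (i j : Fin p) :
    |Sig i j| ≤ 1 :=
  (abs_apply_le_mean_diag hSig i j).trans_eq (by rw [hdiag, hdiag]; norm_num)

theorem sqrt_sum_sq_col_le_maxColNorm (a : Fin p) : √(∑ k, Sig k a ^ 2) ≤ maxColNorm Sig :=
  le_ciSup (f := fun j => √(∑ i, Sig i j ^ 2)) (Set.finite_range _).bddAbove a

theorem one_le_maxColNorm (hdiag : ∀ i, Sig i i = 1) (i : Fin p) : 1 ≤ maxColNorm Sig := by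
  refine le_trans ?_ (sqrt_sum_sq_col_le_maxColNorm i)
  rw [Real.one_le_sqrt]
  calc (1 : ℝ) = Sig i i ^ 2 := by simp [hdiag]
    _ ≤ ∑ k, Sig k i ^ 2 :=
      Finset.single_le_sum (f := fun k => Sig k i ^ 2) (fun _ _ => sq_nonneg _) (Finset.mem_univ i)

theorem RowBound.sq_le {M : Matrix (Fin p) (Fin p) ℝ} (h : RowBound G M ε) (i j a : Fin p) :
    mulVecOn M {i, j}ᶜ (G i) a ^ 2 ≤ (2 * ε) ^ 2 * ∑ k, M a k ^ 2 := by
  calc mulVecOn M {i, j}ᶜ (G i) a ^ 2 = |mulVecOn M {i, j}ᶜ (G i) a| ^ 2 := (sq_abs _).symm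
    _ ≤ (2 * ε * √(∑ k, M a k ^ 2)) ^ 2 := by gcongr; exact h i j a
    _ = (2 * ε) ^ 2 * ∑ k, M a k ^ 2 := by rw [mul_pow, Real.sq_sqrt (by positivity)]

theorem RowBound.sum_sq_offPart_le (h : RowBound G (offPart Sig) ε) (i j : Fin p) :
    ∑ k ∈ {i, j}ᶜ, mulVecOn (offPart Sig) {i, j}ᶜ (G i) k ^ 2
      ≤ (2 * ε * offFrobenius Sig) ^ 2 := by
  calc ∑ k ∈ {i, j}ᶜ, mulVecOn (offPart Sig) {i, j}ᶜ (G i) k ^ 2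
      ≤ ∑ k, (2 * ε) ^ 2 * ∑ l, offPart Sig k l ^ 2 :=
        (Finset.sum_le_sum_of_subset_of_nonneg (Finset.subset_univ _)
          fun _ _ _ => sq_nonneg _).trans (Finset.sum_le_sum fun k _ => h.sq_le i j k)
    _ = (2 * ε * offFrobenius Sig) ^ 2 := by
        rw [← Finset.mul_sum, mul_pow (2 * ε), sq_offFrobenius]

namespace IsGoodGram

theorem abs_apply_le (h : IsGoodGram G Sig B δ ε ν) {i j : Fin p} (hij : i ≠ j) :
    |G i j| ≤ 2 * ε := by
  have hrow := h.row_one i i j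
  simpa [mulVecOn, Matrix.one_apply, hij, Ne.symm hij, ite_pow] using hrow

theorem sum_sq_compl_pair_le (h : IsGoodGram G Sig B δ ε ν) (hν : 0 ≤ ν) (i j : Fin p) :
    ∑ k ∈ ({i, j} : Finset (Fin p))ᶜ, G i k ^ 2 ≤ (2 * √ν) ^ 2 := by
  rw [mul_pow, Real.sq_sqrt hν]
  refine (Finset.sum_le_sum_of_subset_of_nonneg ?_ fun _ _ _ => sq_nonneg _).trans
    ((h.norm i).trans_eq (by ring))
  exact Finset.compl_subset_compl.mpr (by simp)

theorem sum_sq_mulVecOn_le (h : IsGoodGram G Sig B δ ε ν) (hdiag : ∀ i, Sig i i = 1)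
    (hε : 0 ≤ ε) (hν : 0 ≤ ν) (i j : Fin p) :
    ∑ k ∈ {i, j}ᶜ, mulVecOn Sig {i, j}ᶜ (G i) k ^ 2
      ≤ (2 * (2 * √ν + 2 * ε * offFrobenius Sig)) ^ 2 := by
  have hcross : 0 ≤ 2 * √ν * (2 * ε * offFrobenius Sig) :=
    mul_nonneg (by positivity) (mul_nonneg (by positivity) (offFrobenius_nonneg Sig))
  calc ∑ k ∈ {i, j}ᶜ, mulVecOn Sig {i, j}ᶜ (G i) k ^ 2
      ≤ ∑ k ∈ {i, j}ᶜ, (2 * G i k ^ 2 + 2 * mulVecOn (offPart Sig) {i, j}ᶜ (G i) k ^ 2) := by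
        refine Finset.sum_le_sum fun k hk => ?_
        rw [mulVecOn_eq_add_mulVecOn_offPart hdiag hk, ← mul_add]
        exact add_sq_le
    _ = 2 * ∑ k ∈ {i, j}ᶜ, G i k ^ 2
          + 2 * ∑ k ∈ {i, j}ᶜ, mulVecOn (offPart Sig) {i, j}ᶜ (G i) k ^ 2 := by
        rw [Finset.sum_add_distrib, Finset.mul_sum, Finset.mul_sum]
    _ ≤ 2 * (2 * √ν) ^ 2 + 2 * (2 * ε * offFrobenius Sig) ^ 2 := by
        gcongr
        · exact h.sum_sq_compl_pair_le hν i j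
        · exact h.row_off.sum_sq_offPart_le i j
    _ ≤ (2 * (2 * √ν + 2 * ε * offFrobenius Sig)) ^ 2 := by nlinarith [hcross]

theorem abs_sum_mulVecOn_mul_self_le (h : IsGoodGram G Sig B δ ε ν) (hdiag : ∀ i, Sig i i = 1)
    (hε : 0 ≤ ε) (hν : 0 ≤ ν) (i j : Fin p) :
    |∑ k ∈ {i, j}ᶜ, mulVecOn Sig {i, j}ᶜ (G i) k * G i k|
      ≤ 2 * (2 * √ν + 2 * ε * offFrobenius Sig) * (2 * √ν) := by
  have hF := offFrobenius_nonneg Sig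
  refine abs_le_of_sq_le_sq ?_ (by positivity)
  calc (∑ k ∈ {i, j}ᶜ, mulVecOn Sig {i, j}ᶜ (G i) k * G i k) ^ 2
      ≤ (∑ k ∈ {i, j}ᶜ, mulVecOn Sig {i, j}ᶜ (G i) k ^ 2) * ∑ k ∈ {i, j}ᶜ, G i k ^ 2 :=
        Finset.sum_mul_sq_le_sq_mul_sq _ _ _
    _ ≤ (2 * (2 * √ν + 2 * ε * offFrobenius Sig)) ^ 2 * (2 * √ν) ^ 2 := by
        gcongr
        · exact h.sum_sq_mulVecOn_le hdiag hε hν i j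
        · exact h.sum_sq_compl_pair_le hν i j
    _ = _ := (mul_pow _ _ 2).symm

theorem abs_div_diag_le (h : IsGoodGram G Sig B δ ε ν) (hδ : δ ≤ 1 / 2) {i j : Fin p}
    (hij : i ≠ j) : |G i j / G i i| ≤ 4 * ε := by
  have hdiag : 1 / 2 ≤ G i i := by linarith [(abs_le.mp (h.diag i)).1]
  rw [abs_div, abs_of_pos (by linarith : (0 : ℝ) < G i i), div_le_iff₀ (by linarith)]
  nlinarith [h.abs_apply_le hij, abs_nonneg (G i j)]

theorem abs_sum_mulVecOn_mul_le (h : IsGoodGram G Sig B δ ε ν) (hdiag : ∀ i, Sig i i = 1)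
    (hδ : δ ≤ 1 / 2) (hε : 0 ≤ ε) (hν : 0 ≤ ν) {i j : Fin p} (hij : i ≠ j) :
    |∑ k ∈ {i, j}ᶜ, mulVecOn Sig {i, j}ᶜ (G i) k * G j k|
      ≤ 4 * ε * (2 * √ν + 2 * ε * offFrobenius Sig) * (1 + 4 * √ν) := by
  set K : Finset (Fin p) := {i, j}ᶜ
  set x := mulVecOn Sig K (G i)
  set N := 2 * √ν + 2 * ε * offFrobenius Sig
  have hN0 : 0 ≤ N := by have := offFrobenius_nonneg Sig; positivity
  have hresidual : |∑ k ∈ K, x k * (G j k - G i j / G i i * G i k)| ≤ 2 * ε * (2 * N) := by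
    refine (h.bilinear i j hij).trans ?_
    gcongr
    exact Real.sqrt_le_iff.mpr ⟨by positivity, h.sum_sq_mulVecOn_le hdiag hε hν i j⟩
  have hprojection : |G i j / G i i * ∑ k ∈ K, x k * G i k| ≤ 4 * ε * (2 * N * (2 * √ν)) := by
    rw [abs_mul]
    gcongr
    · exact h.abs_div_diag_le hδ hij
    · exact h.abs_sum_mulVecOn_mul_self_le hdiag hε hν i j
  have hsplit : ∑ k ∈ K, x k * G j k = ∑ k ∈ K, x k * (G j k - G i j / G i i * G i k)
      + G i j / G i i * ∑ k ∈ K, x k * G i k := by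
    rw [Finset.mul_sum, ← Finset.sum_add_distrib]
    exact Finset.sum_congr rfl fun _ _ => by ring
  calc |∑ k ∈ K, x k * G j k| ≤ 2 * ε * (2 * N) + 4 * ε * (2 * N * (2 * √ν)) := by
        rw [hsplit]
        exact (abs_add_le _ _).trans (add_le_add hresidual hprojection)
    _ = 4 * ε * N * (1 + 4 * √ν) := by ring

theorem abs_diag_le (h : IsGoodGram G Sig B δ ε ν) (hδ : δ ≤ 1 / 2) (i : Fin p) :
    |G i i| ≤ 3 / 2 := by
  have hi := abs_le.mp (h.diag i)
  exact abs_le.mpr ⟨by linarith, by linarith⟩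

theorem abs_pair_terms_sub_le (h : IsGoodGram G Sig B δ ε ν) (hδ : δ ≤ 1 / 2) (hε : 0 ≤ ε)
    (hε1 : ε ≤ 1 / 4) {i j : Fin p} (hij : i ≠ j) {ρ : ℝ} (hρ : |ρ| ≤ 1) :
    |G i i * G i j + ρ * (G i i * G j j + G i j * G i j) + G i j * G j j - ρ|
      ≤ 3 * δ + 7 * ε := by
  have hG := h.abs_apply_le hij
  have hdiag : |(G i i - 1) * G j j + (G j j - 1)| ≤ 3 * δ := by
    have hδ0 : 0 ≤ δ := (abs_nonneg _).trans (h.diag i)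
    refine (abs_add_le _ _).trans ?_
    rw [abs_mul]
    nlinarith [mul_le_mul (h.diag i) (h.abs_diag_le hδ j) (abs_nonneg _) hδ0, h.diag j]
  have hsq : |G i j * G i j| ≤ ε := by
    rw [abs_mul]
    nlinarith [mul_le_mul hG hG (abs_nonneg _) (by positivity)]
  have hlinear : |G i j * (G i i + G j j)| ≤ 6 * ε := by
    rw [abs_mul]
    calc |G i j| * |G i i + G j j| ≤ 2 * ε * (3 / 2 + 3 / 2) := by
          gcongr
          exact (abs_add_le _ _).trans (add_le_add (h.abs_diag_le hδ i) (h.abs_diag_le hδ j))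
      _ = 6 * ε := by ring
  calc |G i i * G i j + ρ * (G i i * G j j + G i j * G i j) + G i j * G j j - ρ|
      = |ρ * ((G i i - 1) * G j j + (G j j - 1)) + ρ * (G i j * G i j)
          + G i j * (G i i + G j j)| := by congr 1; ring
    _ ≤ 1 * (3 * δ) + 1 * ε + 6 * ε := by
        refine (abs_add_three _ _ _).trans ?_
        rw [abs_mul ρ, abs_mul ρ]
        gcongr
    _ = 3 * δ + 7 * ε := by ring

theorem abs_linear_terms_le (h : IsGoodGram G Sig B δ ε ν) (hSig : ∀ k l, Sig k l = Sig l k)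
    (hδ : δ ≤ 1 / 2) (hε : 0 ≤ ε) (hε1 : ε ≤ 1 / 4) {i j : Fin p} (hij : i ≠ j) :
    |G i i * mulVecOn Sig {i, j}ᶜ (G j) i + G i j * mulVecOn Sig {i, j}ᶜ (G j) j
      + G i j * mulVecOn Sig {i, j}ᶜ (G i) i + G j j * mulVecOn Sig {i, j}ᶜ (G i) j|
      ≤ 8 * ε * maxColNorm Sig := by
  have hrow : ∀ a b c, |mulVecOn Sig {a, b}ᶜ (G a) c| ≤ 2 * ε * maxColNorm Sig := fun a b c => by
    refine (h.row_sig a b c).trans ?_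
    simp only [hSig c]
    gcongr
    exact sqrt_sum_sq_col_le_maxColNorm c
  have hrow' : ∀ c, |mulVecOn Sig {i, j}ᶜ (G j) c| ≤ 2 * ε * maxColNorm Sig := fun c => by
    rw [Finset.pair_comm]
    exact hrow j i c
  have hG : |G i j| ≤ 1 / 2 := (h.abs_apply_le hij).trans (by linarith)
  have := (abs_nonneg _).trans (hrow i j i)
  refine (abs_add_le _ _).trans ((add_le_add_left (abs_add_three _ _ _) _).trans ?_)
  simp only [abs_mul]
  calc _ ≤ 3 / 2 * (2 * ε * maxColNorm Sig) + 1 / 2 * (2 * ε * maxColNorm Sig)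
        + 1 / 2 * (2 * ε * maxColNorm Sig) + 3 / 2 * (2 * ε * maxColNorm Sig) := by
        gcongr
        exacts [h.abs_diag_le hδ i, hrow' i, hrow' j, hrow i j i, h.abs_diag_le hδ j, hrow i j j]
    _ = 8 * ε * maxColNorm Sig := by ring

theorem abs_form_sub_le (h : IsGoodGram G Sig B δ ε ν) (hSig : Sig.PosSemidef)
    (hdiag : ∀ i, Sig i i = 1) (hδ : δ ≤ 1 / 2) (hε : 0 ≤ ε) (hε1 : ε ≤ 1 / 4) (hν : 0 ≤ ν)
    {i j : Fin p} (hij : i ≠ j) :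
    |G i ⬝ᵥ (Sig *ᵥ G j) - Sig i j| ≤ gramError Sig δ ε ν := by
  have hsymm : ∀ k l, Sig k l = Sig l k := fun k l => by simpa using hSig.isHermitian.apply l k
  have hpair := h.abs_pair_terms_sub_le hδ hε hε1 hij (abs_apply_le_one hSig hdiag i j)
  have hlinear := h.abs_linear_terms_le hsymm hδ hε hε1 hij
  have hcross := h.abs_sum_mulVecOn_mul_le hdiag hδ hε hν hij
  have hεm : ε ≤ ε * maxColNorm Sig := le_mul_of_one_le_right hε (one_le_maxColNorm hdiag i)
  rw [dotProduct_mulVec_eq_pair_expansion hsymm hij, gramError, hdiag, hdiag, one_mul, one_mul,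
    h.symm j i, add_sub_right_comm, add_sub_right_comm]
  refine (abs_add_three _ _ _).trans ?_
  linarith

theorem sq_mulVec_root_le (h : IsGoodGram G Sig B δ ε ν) (hδ : δ ≤ 1 / 2) (i k : Fin p) :
    (B *ᵥ G i) k ^ 2 ≤ 8 * B k i ^ 2 + 8 * ε ^ 2 * ∑ l, B k l ^ 2 := by
  have hsplit : (B *ᵥ G i) k = B k i * G i i + mulVecOn B {i, i}ᶜ (G i) k := by
    rw [mulVec, dotProduct, ← Finset.sum_add_sum_compl {i, i}]
    simp [mulVecOn]
  have hrow := h.row_root.sq_le i i k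
  have hdiag : G i i ^ 2 ≤ 4 := by nlinarith [abs_le.mp (h.diag i)]
  calc (B *ᵥ G i) k ^ 2 ≤ 2 * ((B k i * G i i) ^ 2 + mulVecOn B {i, i}ᶜ (G i) k ^ 2) := by
        rw [hsplit]; exact add_sq_le
    _ = 2 * (B k i ^ 2 * G i i ^ 2 + mulVecOn B {i, i}ᶜ (G i) k ^ 2) := by rw [mul_pow]
    _ ≤ 2 * (B k i ^ 2 * 4 + (2 * ε) ^ 2 * ∑ l, B k l ^ 2) := by gcongr
    _ = 8 * B k i ^ 2 + 8 * ε ^ 2 * ∑ l, B k l ^ 2 := by ring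

theorem form_self_le (h : IsGoodGram G Sig B δ ε ν) (hB : Sig = Bᵀ * B)
    (hdiag : ∀ i, Sig i i = 1) (hδ : δ ≤ 1 / 2) (i : Fin p) :
    G i ⬝ᵥ (Sig *ᵥ G i) ≤ 8 + 8 * ε ^ 2 * p := by
  have hcol : ∀ a, ∑ k, B k a ^ 2 = 1 := fun a => by
    simp only [← hdiag a, hB, mul_apply, transpose_apply, sq]
  calc G i ⬝ᵥ (Sig *ᵥ G i) = ∑ k, (B *ᵥ G i) k ^ 2 := by
        rw [hB, ← mulVec_mulVec, dotProduct_mulVec, vecMul_transpose, dotProduct]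
        simp only [sq]
    _ ≤ ∑ k, (8 * B k i ^ 2 + 8 * ε ^ 2 * ∑ l, B k l ^ 2) :=
        Finset.sum_le_sum fun k _ => h.sq_mulVec_root_le hδ i k
    _ = 8 + 8 * ε ^ 2 * p := by
        rw [Finset.sum_add_distrib, ← Finset.mul_sum, ← Finset.mul_sum, hcol, Finset.sum_comm]
        simp [hcol]

end IsGoodGram

end Deterministic

/-! ### The error of the covariance estimator on the concentration event -/

section Estimator

variable {p d n : ℕ} {Sig B : Matrix (Fin p) (Fin p) ℝ} {δ ε ν δ' σ : ℝ}
  {A : Matrix (Fin d) (Fin p) ℝ} {y : Fin n → Fin d → ℝ}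

/-- The empirical second moments of the observations in the directions `a_i + c a_j`, where `a_i`
is column `i` of `A`, are close to their conditional means given `A`. -/
def IsGoodSample (Sig : Matrix (Fin p) (Fin p) ℝ) (σ : ℝ) (A : Matrix (Fin d) (Fin p) ℝ)
    (y : Fin n → Fin d → ℝ) (c δ : ℝ) : Prop :=
  ∀ i j, |∑ s, ((A.col i + c • A.col j) ⬝ᵥ y s) ^ 2
      - n * observeVar Sig σ A (A.col i + c • A.col j)|
    ≤ δ * (n * observeVar Sig σ A (A.col i + c • A.col j))

/-- The empirical mixed moment of the observations in the directions of columns `i` and `j` of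
`A`. -/
noncomputable def empiricalMoment (A : Matrix (Fin d) (Fin p) ℝ) (y : Fin n → Fin d → ℝ)
    (i j : Fin p) : ℝ :=
  (n : ℝ)⁻¹ * ∑ s, (A.col i ⬝ᵥ y s) * (A.col j ⬝ᵥ y s)

/-- The bound on the error of `empiricalMoment A y i j` as an estimate of `Sig i j`: the bias of the
Gram matrix, the contribution of the noise, and the sampling error. -/
noncomputable def momentError (Sig : Matrix (Fin p) (Fin p) ℝ) (σ δ ε ν δ' : ℝ) : ℝ :=
  gramError Sig δ ε ν + 2 * ε * σ ^ 2 + δ' * (8 + 8 * ε ^ 2 * p + 2 * σ ^ 2)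

theorem transpose_mulVec_col (A : Matrix (Fin d) (Fin p) ℝ) (i : Fin p) :
    Aᵀ *ᵥ A.col i = (Aᵀ * A) i := by
  ext l
  exact dotProduct_comm _ _

theorem observeVar_col_add_smul_col (hSig : Sigᵀ = Sig) (i j : Fin p) (c : ℝ) :
    observeVar Sig σ A (A.col i + c • A.col j)
      = (Aᵀ * A) i ⬝ᵥ (Sig *ᵥ (Aᵀ * A) i) + 2 * c * ((Aᵀ * A) i ⬝ᵥ (Sig *ᵥ (Aᵀ * A) j))
        + c ^ 2 * ((Aᵀ * A) j ⬝ᵥ (Sig *ᵥ (Aᵀ * A) j))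
        + σ ^ 2 * ((Aᵀ * A) i i + 2 * c * (Aᵀ * A) i j + c ^ 2 * (Aᵀ * A) j j) := by
  have hnorm : ∑ k, (A.col i + c • A.col j) k ^ 2
      = (Aᵀ * A) i i + 2 * c * (Aᵀ * A) i j + c ^ 2 * (Aᵀ * A) j j := by
    simp only [transpose_mul_self_apply, dotProduct, Finset.mul_sum, ← Finset.sum_add_distrib]
    exact Finset.sum_congr rfl fun _ _ => by
      simp only [Pi.add_apply, Pi.smul_apply, smul_eq_mul]; ring
  have hsymm : (Aᵀ * A) j ⬝ᵥ (Sig *ᵥ (Aᵀ * A) i) = (Aᵀ * A) i ⬝ᵥ (Sig *ᵥ (Aᵀ * A) j) := by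
    rw [dotProduct_mulVec, ← mulVec_transpose, hSig, dotProduct_comm]
  simp only [observeVar, hnorm, mulVec_add, mulVec_smul, transpose_mulVec_col, add_dotProduct,
    dotProduct_add, smul_dotProduct, dotProduct_smul, hsymm, smul_eq_mul]
  ring

theorem covEstimator_apply_self (i : Fin p) : covEstimator A y i i = 1 := by
  simp [covEstimator, offPart]

theorem covEstimator_apply_of_ne {i j : Fin p} (hij : i ≠ j) :
    covEstimator A y i j = (d : ℝ) / (d + 1) * empiricalMoment A y i j := by
  have hmoment : (Aᵀ * ((n : ℝ)⁻¹ • ∑ s, vecMulVec (y s) (y s)) * A) i j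
      = empiricalMoment A y i j := by
    rw [Matrix.mul_smul, Matrix.smul_mul, Matrix.smul_apply, smul_eq_mul, Matrix.mul_sum,
      Matrix.sum_mul, Matrix.sum_apply, empiricalMoment]
    congr 1
    refine Finset.sum_congr rfl fun s _ => ?_
    rw [mul_vecMulVec, vecMulVec_mul, vecMulVec_apply]
    exact congrArg _ (dotProduct_comm _ _)
  rw [covEstimator, Matrix.add_apply, one_apply_ne hij, zero_add, Matrix.smul_apply, smul_eq_mul,
    offPart, of_apply, if_neg hij, hmoment]

theorem covEstimator_transpose : (covEstimator A y)ᵀ = covEstimator A y := by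
  ext i j
  rw [transpose_apply]
  by_cases hij : i = j
  · rw [hij]
  · rw [covEstimator_apply_of_ne hij, covEstimator_apply_of_ne (Ne.symm hij)]
    simp only [empiricalMoment, mul_comm]

theorem four_mul_empiricalMoment (hn : n ≠ 0) (i j : Fin p) :
    4 * (n * empiricalMoment A y i j)
      = ∑ s, ((A.col i + (1 : ℝ) • A.col j) ⬝ᵥ y s) ^ 2
        - ∑ s, ((A.col i + (-1 : ℝ) • A.col j) ⬝ᵥ y s) ^ 2 := by
  have hn0 : (n : ℝ) ≠ 0 := Nat.cast_ne_zero.mpr hn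
  rw [empiricalMoment, mul_inv_cancel_left₀ hn0, ← Finset.sum_sub_distrib, Finset.mul_sum]
  refine Finset.sum_congr rfl fun s _ => ?_
  simp only [add_dotProduct, smul_dotProduct, smul_eq_mul]
  ring

theorem abs_empiricalMoment_sub_mean_le (hSig : Sigᵀ = Sig) (hn : n ≠ 0)
    (hpos : IsGoodSample Sig σ A y 1 δ') (hneg : IsGoodSample Sig σ A y (-1) δ') (i j : Fin p) :
    |empiricalMoment A y i j - ((Aᵀ * A) i ⬝ᵥ (Sig *ᵥ (Aᵀ * A) j) + σ ^ 2 * (Aᵀ * A) i j)|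
      ≤ δ' * (((Aᵀ * A) i ⬝ᵥ (Sig *ᵥ (Aᵀ * A) i) + (Aᵀ * A) j ⬝ᵥ (Sig *ᵥ (Aᵀ * A) j)
        + σ ^ 2 * ((Aᵀ * A) i i + (Aᵀ * A) j j)) / 2) := by
  have hn4 : (0 : ℝ) < 4 * n := by positivity
  refine le_of_mul_le_mul_left ?_ hn4
  rw [← abs_of_pos hn4, ← abs_mul, abs_of_pos hn4, mul_sub, mul_assoc 4 (n : ℝ),
    four_mul_empiricalMoment hn]
  have hplus := hpos i j
  have hminus := hneg i j
  rw [observeVar_col_add_smul_col hSig, abs_le] at hplus hminus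
  rw [abs_le]
  constructor <;> linarith [hplus.1, hplus.2, hminus.1, hminus.2]

theorem abs_empiricalMoment_sub_le (hSig : Sig.PosSemidef) (hB : Sig = Bᵀ * B)
    (hdiag : ∀ i, Sig i i = 1) (hn : n ≠ 0) (h : IsGoodGram (Aᵀ * A) Sig B δ ε ν)
    (hpos : IsGoodSample Sig σ A y 1 δ') (hneg : IsGoodSample Sig σ A y (-1) δ')
    (hδ : δ ≤ 1 / 2) (hε : 0 ≤ ε) (hε1 : ε ≤ 1 / 4) (hν : 0 ≤ ν) (hδ' : 0 ≤ δ')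
    {i j : Fin p} (hij : i ≠ j) :
    |empiricalMoment A y i j - Sig i j| ≤ momentError Sig σ δ ε ν δ' := by
  have hsymm : Sigᵀ = Sig := by simpa using hSig.isHermitian.eq
  have hsample := abs_empiricalMoment_sub_mean_le hsymm hn hpos hneg i j
  have hbias := h.abs_form_sub_le hSig hdiag hδ hε hε1 hν hij
  have hvar : (Aᵀ * A) i ⬝ᵥ (Sig *ᵥ (Aᵀ * A) i) + (Aᵀ * A) j ⬝ᵥ (Sig *ᵥ (Aᵀ * A) j)
      + σ ^ 2 * ((Aᵀ * A) i i + (Aᵀ * A) j j) ≤ 2 * (8 + 8 * ε ^ 2 * p + 2 * σ ^ 2) := by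
    have hGii := abs_le.mp (h.diag i)
    have hGjj := abs_le.mp (h.diag j)
    have hnoise : σ ^ 2 * ((Aᵀ * A) i i + (Aᵀ * A) j j) ≤ σ ^ 2 * 4 :=
      mul_le_mul_of_nonneg_left (by linarith) (sq_nonneg σ)
    linarith [h.form_self_le hB hdiag hδ i, h.form_self_le hB hdiag hδ j]
  have hnoise : |σ ^ 2 * (Aᵀ * A) i j| ≤ 2 * ε * σ ^ 2 := by
    rw [abs_mul, abs_of_nonneg (sq_nonneg σ), mul_comm]
    exact mul_le_mul_of_nonneg_right (h.abs_apply_le hij) (sq_nonneg σ)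
  have hsample' := hsample.trans (mul_le_mul_of_nonneg_left
    (show _ ≤ 8 + 8 * ε ^ 2 * p + 2 * σ ^ 2 by linarith) hδ')
  rw [momentError]
  rw [abs_le] at *
  constructor <;> linarith

theorem abs_div_add_one_mul_sub_le {d q s : ℝ} (hd : 0 < d) (hs : |s| ≤ 1) :
    |d / (d + 1) * q - s| ≤ |q - s| + 1 / d := by
  have hsplit : d / (d + 1) * q - s = d / (d + 1) * (q - s) - s / (d + 1) := by
    field_simp; ring
  have hfrac : d / (d + 1) ≤ 1 := by rw [div_le_one (by positivity)]; linarith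
  rw [hsplit]
  refine (abs_sub _ _).trans (add_le_add ?_ ?_)
  · rw [abs_mul, abs_of_nonneg (by positivity : 0 ≤ d / (d + 1))]
    exact mul_le_of_le_one_left (abs_nonneg _) hfrac
  · rw [abs_div, abs_of_pos (by positivity : 0 < d + 1)]
    exact div_le_div₀ zero_le_one hs hd (by linarith)

theorem abs_covEstimator_sub_le (hSig : Sig.PosSemidef) (hB : Sig = Bᵀ * B)
    (hdiag : ∀ i, Sig i i = 1) (hd : d ≠ 0) (hn : n ≠ 0)
    (h : IsGoodGram (Aᵀ * A) Sig B δ ε ν)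
    (hpos : IsGoodSample Sig σ A y 1 δ') (hneg : IsGoodSample Sig σ A y (-1) δ')
    (hδ : δ ≤ 1 / 2) (hε : 0 ≤ ε) (hε1 : ε ≤ 1 / 4) (hν : 0 ≤ ν) (hδ' : 0 ≤ δ')
    {i j : Fin p} (hij : i ≠ j) :
    |covEstimator A y i j - Sig i j| ≤ momentError Sig σ δ ε ν δ' + 1 / d := by
  rw [covEstimator_apply_of_ne hij]
  refine (abs_div_add_one_mul_sub_le (by positivity) (abs_apply_le_one hSig hdiag i j)).trans ?_
  gcongr
  exact abs_empiricalMoment_sub_le hSig hB hdiag hn h hpos hneg hδ hε hε1 hν hδ' hij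

end Estimator

section ErrorLevel

variable {p d n : ℕ} {Sig : Matrix (Fin p) (Fin p) ℝ}

theorem tauInf_eq (hp : 0 < p) (hd : 0 < d) (hn : 0 < n) (C σ : ℝ) :
    tauInf C d n Sig σ = C * (√(Real.log p / d) * maxColNorm Sig
      + √(Real.log p / d) ^ 2 * (1 + √(p / d) ^ 2) * offFrobenius Sig
      + √p * Real.log p / √(n * d)
      + √(Real.log p / d) ^ 2 * p * √(Real.log p / n) * (1 + √(p / d) ^ 2)
      + √(Real.log p / d) * √(p / d) + √(Real.log p / d) * √(p / d) ^ 2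
      + √(Real.log p / n)
      + σ ^ 2 * (1 + √(Real.log p / d)) * √(Real.log p / d) * (1 + max √(d / n) (d / n))) := by
  have hℓ : 0 ≤ Real.log p := Real.log_natCast_nonneg p
  have hd2 : √(d : ℝ) ^ 2 = d := Real.sq_sqrt (by positivity)
  have hs2 : √(Real.log p / d) ^ 2 = Real.log p / d := Real.sq_sqrt (by positivity)
  have hv2 : √((p : ℝ) / d) ^ 2 = p / d := Real.sq_sqrt (by positivity)
  have hs : √(Real.log p / d) = √(Real.log p) / √d := Real.sqrt_div hℓ _
  have hsample : (p : ℝ) * √(Real.log p) ^ 3 / (√n * d)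
      = √(Real.log p / d) ^ 2 * p * √(Real.log p / n) := by
    rw [hs2, Real.sqrt_div hℓ, pow_succ √(Real.log p), Real.sq_sqrt hℓ]; field_simp
  have hcross : √((p : ℝ) * Real.log p) / d = √(Real.log p / d) * √(p / d) := by
    rw [hs, Real.sqrt_div p.cast_nonneg, Real.sqrt_mul p.cast_nonneg, div_mul_div_comm, ← sq, hd2,
      mul_comm]
  have hcross2 : (p : ℝ) * √(Real.log p) / √d ^ 3 = √(Real.log p / d) * √(p / d) ^ 2 := by
    rw [hv2, hs, pow_succ √(d : ℝ), hd2]; field_simp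
  rw [tauInf, hsample, hcross, hcross2, hv2, hs2]

theorem inv_le_two_mul_sqrt_log_div (hp : 2 ≤ p) (hd : 1 ≤ d) :
    1 / (d : ℝ) ≤ 2 * √(Real.log p / d) := by
  have hd1 : (1 : ℝ) ≤ d := by exact_mod_cast hd
  have hℓ : 1 / 4 ≤ Real.log p := by
    have hp2 : (2 : ℝ) ≤ p := by exact_mod_cast hp
    linarith [Real.log_two_gt_d9, Real.log_le_log (by norm_num) hp2]
  have : 1 / (2 * d : ℝ) ≤ √(Real.log p / d) := by
    refine Real.le_sqrt_of_sq_le ?_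
    rw [div_pow, div_le_div_iff₀ (by positivity) (by positivity)]
    nlinarith
  calc 1 / (d : ℝ) = 2 * (1 / (2 * d)) := by field_simp
    _ ≤ 2 * √(Real.log p / d) := by linarith

theorem noise_le_tauInf_noise (hd : 0 < d) (σ : ℝ) :
    σ ^ 2 * √(Real.log p / d) + σ ^ 2 * √(Real.log p / n)
      ≤ σ ^ 2 * (1 + √(Real.log p / d)) * √(Real.log p / d) * (1 + max √(d / n) (d / n)) := by
  have hr : √(Real.log p / d) * √((d : ℝ) / n) = √(Real.log p / n) := by
    rw [← Real.sqrt_mul (by positivity), div_mul_div_cancel₀ (by positivity)]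
  calc σ ^ 2 * √(Real.log p / d) + σ ^ 2 * √(Real.log p / n)
      = σ ^ 2 * 1 * √(Real.log p / d) * (1 + √((d : ℝ) / n)) := by rw [← hr]; ring
    _ ≤ _ := by
        gcongr
        · linarith [Real.sqrt_nonneg (Real.log p / d)]
        · exact le_max_left _ _

theorem momentError_expand (σ s ν r : ℝ) :
    momentError Sig σ (8 * s) (3 * s) ν (8 * r)
      = 24 * s + 45 * (s * maxColNorm Sig) + 24 * (s * √ν) + 96 * (s * √ν ^ 2)
        + 72 * (s ^ 2 * offFrobenius Sig * (1 + 4 * √ν)) + 6 * (σ ^ 2 * s) + 64 * r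
        + 576 * (s ^ 2 * p * r) + 16 * (σ ^ 2 * r) := by
  rw [momentError, gramError]
  ring

theorem momentError_add_inv_le_tauInf (hp : 2 ≤ p) (hd : 1 ≤ d) (hn : 1 ≤ n)
    (hm : 1 ≤ maxColNorm Sig) (σ : ℝ) :
    momentError Sig σ (8 * √(Real.log p / d)) (3 * √(Real.log p / d)) (p / d)
      (8 * √(Real.log p / n)) + 1 / d ≤ tauInf 1200 d n Sig σ / 2 := by
  have hinv := inv_le_two_mul_sqrt_log_div hp hd
  have hnoise := noise_le_tauInf_noise (p := p) (n := n) hd σ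
  have hthird : 0 ≤ √(p : ℝ) * Real.log p / √((n : ℝ) * d) := by positivity
  have hF := offFrobenius_nonneg Sig
  rw [tauInf_eq (by lia) hd hn, momentError_expand]
  set s := √(Real.log p / d)
  set r := √(Real.log p / n)
  set v := √((p : ℝ) / d)
  set F := offFrobenius Sig
  have hs : 0 ≤ s := Real.sqrt_nonneg _
  have hr : 0 ≤ r := Real.sqrt_nonneg _
  have : 0 ≤ v := Real.sqrt_nonneg _
  have hdiag : s ≤ s * maxColNorm Sig := le_mul_of_one_le_right hs hm
  have hfrob : s ^ 2 * F * (1 + 4 * v) ≤ 3 * (s ^ 2 * (1 + v ^ 2) * F) := by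
    have : 1 + 4 * v ≤ 3 * (1 + v ^ 2) := by nlinarith [sq_nonneg (v - 1), sq_nonneg (3 * v - 2)]
    calc s ^ 2 * F * (1 + 4 * v) ≤ s ^ 2 * F * (3 * (1 + v ^ 2)) := by gcongr
      _ = _ := by ring
  have hsample : s ^ 2 * p * r ≤ s ^ 2 * p * r * (1 + v ^ 2) :=
    le_mul_of_one_le_right (by positivity) (by nlinarith [sq_nonneg v])
  have : 0 ≤ σ ^ 2 * s := by positivity
  have : 0 ≤ σ ^ 2 * r := by positivity
  have : 0 ≤ s * v := by positivity
  have : 0 ≤ s * v ^ 2 := by positivity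
  have : 0 ≤ s ^ 2 * p * r := by positivity
  have : 0 ≤ s ^ 2 * (1 + v ^ 2) * F := by positivity
  linarith

end ErrorLevel

/-! ### Probability of the concentration event -/

section UnionBound

variable {Ω : Type*} [MeasurableSpace Ω] {P : Measure Ω}

theorem measure_not_forall_le {ι : Type*} [Fintype ι] {f g : ι → Ω → ℝ} {b c : ℝ}
    (h : ∀ i, P {ω | g i ω < f i ω} ≤ ENNReal.ofReal b) (hc : (Fintype.card ι : ℝ) = c) :
    P {ω | ¬ ∀ i, f i ω ≤ g i ω} ≤ ENNReal.ofReal (c * b) := by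
  simp only [not_forall, not_le, Set.ofPred_exists]
  refine (measure_iUnion_fintype_le P _).trans ((Finset.sum_le_sum fun i _ => h i).trans ?_)
  rw [Finset.sum_const, Finset.card_univ, nsmul_eq_mul, ← hc,
    ENNReal.ofReal_mul (Nat.cast_nonneg _), ENNReal.ofReal_natCast]

theorem measure_not_and_le {Q R : Ω → Prop} {a b : ℝ} (ha : 0 ≤ a) (hb : 0 ≤ b)
    (hQ : P {ω | ¬ Q ω} ≤ ENNReal.ofReal a) (hR : P {ω | ¬ R ω} ≤ ENNReal.ofReal b) :
    P {ω | ¬ (Q ω ∧ R ω)} ≤ ENNReal.ofReal (a + b) := by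
  simp only [not_and_or, Set.ofPred_or, ENNReal.ofReal_add ha hb]
  exact (measure_union_le _ _).trans (add_le_add hQ hR)

end UnionBound

section GramConcentration

variable {Ω : Type*} [MeasurableSpace Ω] {P : Measure Ω} [IsProbabilityMeasure P] {p d : ℕ}
  {A : Ω → Matrix (Fin d) (Fin p) ℝ}

theorem sum_erase_update_mul (i j : Fin p) (c g : Fin p → ℝ) :
    ∑ k ∈ Finset.univ.erase i, Function.update c j 0 k * g k
      = ∑ k ∈ ({i, j} : Finset (Fin p))ᶜ, c k * g k := by
  have herase : ({i, j} : Finset (Fin p))ᶜ = (Finset.univ.erase i).filter (· ≠ j) := by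
    ext; simp
  rw [herase, Finset.sum_filter]
  refine Finset.sum_congr rfl fun k _ => ?_
  by_cases hk : k = j <;> simp [hk]

theorem sum_update_zero_sq_le (j : Fin p) (c : Fin p → ℝ) :
    ∑ k, Function.update c j 0 k ^ 2 ≤ ∑ k, c k ^ 2 := by
  refine Finset.sum_le_sum fun k _ => ?_
  by_cases hk : k = j
  · subst hk; simp [sq_nonneg]
  · rw [Function.update_of_ne hk]

theorem mul_sqrt_inv_mul_le {d x S t : ℝ} (hd : 0 ≤ d) (ht : 0 ≤ t) (hx : x ≤ 4) (hS : 0 ≤ S) :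
    t * √(d⁻¹ * (x * S)) ≤ 2 * (t / √d) * √S := by
  calc t * √(d⁻¹ * (x * S)) ≤ t * √(d⁻¹ * (2 ^ 2 * S)) := by gcongr; linarith
    _ = 2 * (t / √d) * √S := by
      rw [Real.sqrt_mul (inv_nonneg.mpr hd), Real.sqrt_mul (sq_nonneg 2), Real.sqrt_sq zero_le_two,
        Real.sqrt_inv]
      ring

theorem measure_not_gram_diag_le (hA : IsGaussianMatrix P A) (hd : 1 ≤ d) {δ : ℝ}
    (hδ0 : 0 ≤ δ) (hδ1 : δ ≤ 1) :
    P {ω | ¬ ∀ i, |((A ω)ᵀ * A ω) i i - 1| ≤ δ}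
      ≤ ENNReal.ofReal (p * (2 * Real.exp (-(d * δ ^ 2 / 16)))) :=
  measure_not_forall_le (fun i => measure_gram_diag_le hA hd i hδ0 hδ1) (by simp)

theorem measure_not_rowBound_le (hA : IsGaussianMatrix P A)
    (M : Matrix (Fin p) (Fin p) ℝ) {t : ℝ} (ht : 0 ≤ t) :
    P {ω | ¬ ((∀ i, ((A ω)ᵀ * A ω) i i ≤ 4) → RowBound ((A ω)ᵀ * A ω) M (t / √d))}
      ≤ ENNReal.ofReal (p ^ 3 * (2 * Real.exp (-(t ^ 2 / 2)))) := by
  refine (measure_mono ?_).trans (measure_not_forall_le (ι := Fin p × Fin p × Fin p)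
    (fun q => measure_gram_row_le hA q.1 (Function.update (M q.2.2) q.2.1 0) ht) (by simp; ring))
  intro ω hω hall
  refine hω fun hdiag i j a => ?_
  have hrow := hall (i, j, a)
  simp only [sum_erase_update_mul] at hrow
  calc _ ≤ _ := hrow
    _ ≤ 2 * (t / √d) * √(∑ k, Function.update (M a) j 0 k ^ 2) :=
        mul_sqrt_inv_mul_le d.cast_nonneg ht (hdiag i) (by positivity)
    _ ≤ 2 * (t / √d) * √(∑ k, M a k ^ 2) := by
        exact mul_le_mul_of_nonneg_left (Real.sqrt_le_sqrt (sum_update_zero_sq_le j (M a)))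
          (by positivity)

theorem measure_not_gram_norm_le (hA : IsGaussianMatrix P A) :
    P {ω | ¬ ((∀ i, ((A ω)ᵀ * A ω) i i ≤ 2) →
        ∀ i, ∑ k ∈ ({i} : Finset (Fin p))ᶜ, ((A ω)ᵀ * A ω) i k ^ 2 ≤ 4 * ((p : ℝ) / d))}
      ≤ ENNReal.ofReal (p * (2 * Real.exp (-((p - 1) / 16)))) := by
  refine (measure_mono ?_).trans
    (measure_not_forall_le (fun i => measure_gram_norm_le hA i) (by simp))
  intro ω hω hall
  refine hω fun hdiag i => ?_
  rw [Finset.compl_singleton]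
  calc _ ≤ 2 * ((p : ℝ) * ((d : ℝ)⁻¹ * ((A ω)ᵀ * A ω) i i)) := hall i
    _ ≤ 2 * ((p : ℝ) * ((d : ℝ)⁻¹ * 2)) := by gcongr; exact hdiag i
    _ = 4 * ((p : ℝ) / d) := by rw [div_eq_mul_inv]; ring

theorem measure_not_gram_bilinear_le (hA : IsGaussianMatrix P A)
    (M : Matrix (Fin p) (Fin p) ℝ) {t : ℝ} (ht : 0 ≤ t) :
    P {ω | ¬ ((∀ i, ((A ω)ᵀ * A ω) i i ≤ 4) → ∀ i j,
        |∑ k ∈ {i, j}ᶜ, mulVecOn M {i, j}ᶜ (((A ω)ᵀ * A ω) i) k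
            * (((A ω)ᵀ * A ω) j k
              - ((A ω)ᵀ * A ω) i j / ((A ω)ᵀ * A ω) i i * ((A ω)ᵀ * A ω) i k)|
          ≤ 2 * (t / √d) * √(∑ k ∈ {i, j}ᶜ, mulVecOn M {i, j}ᶜ (((A ω)ᵀ * A ω) i) k ^ 2))}
      ≤ ENNReal.ofReal (p ^ 2 * (2 * Real.exp (-(t ^ 2 / 2)))) := by
  refine (measure_mono ?_).trans (measure_not_forall_le (ι := Fin p × Fin p)
    (fun q => measure_gram_bilinear_le hA M q.1 q.2 ht) (by simp; ring))
  intro ω hω hall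
  refine hω fun hdiag i j => ?_
  exact (hall (i, j)).trans (mul_sqrt_inv_mul_le d.cast_nonneg ht (hdiag j) (by positivity))

theorem measure_not_isGoodGram_le (hA : IsGaussianMatrix P A)
    (hd : 1 ≤ d) (Sig B : Matrix (Fin p) (Fin p) ℝ) {δ t : ℝ} (hδ0 : 0 ≤ δ) (hδ1 : δ ≤ 1)
    (ht : 0 ≤ t) :
    P {ω | ¬ IsGoodGram ((A ω)ᵀ * A ω) Sig B δ (t / √d) (p / d)}
      ≤ ENNReal.ofReal (p * (2 * Real.exp (-(d * δ ^ 2 / 16)))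
        + (p ^ 3 * (2 * Real.exp (-(t ^ 2 / 2))) + (p ^ 3 * (2 * Real.exp (-(t ^ 2 / 2)))
        + (p ^ 3 * (2 * Real.exp (-(t ^ 2 / 2))) + (p ^ 3 * (2 * Real.exp (-(t ^ 2 / 2)))
        + (p * (2 * Real.exp (-((p - 1) / 16))) + p ^ 2 * (2 * Real.exp (-(t ^ 2 / 2))))))))) := by
  refine (measure_mono ?_).trans <|
    measure_not_and_le (by positivity) (by positivity) (measure_not_gram_diag_le hA hd hδ0 hδ1) <|
    measure_not_and_le (by positivity) (by positivity) (measure_not_rowBound_le hA 1 ht) <|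
    measure_not_and_le (by positivity) (by positivity) (measure_not_rowBound_le hA Sig ht) <|
    measure_not_and_le (by positivity) (by positivity)
      (measure_not_rowBound_le hA (offPart Sig) ht) <|
    measure_not_and_le (by positivity) (by positivity) (measure_not_rowBound_le hA B ht) <|
    measure_not_and_le (by positivity) (by positivity) (measure_not_gram_norm_le hA)
      (measure_not_gram_bilinear_le hA Sig ht)
  rintro ω hω ⟨hdiag, hone, hsig, hoff, hroot, hnorm, hbilin⟩
  have hdiag2 : ∀ i, ((A ω)ᵀ * A ω) i i ≤ 2 := fun i => by linarith [(abs_le.mp (hdiag i)).2]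
  have hdiag4 : ∀ i, ((A ω)ᵀ * A ω) i i ≤ 4 := fun i => (hdiag2 i).trans (by norm_num)
  exact hω
    { symm := fun i j => dotProduct_comm _ _
      diag := hdiag
      row_one := hone hdiag4
      row_sig := hsig hdiag4
      row_off := hoff hdiag4
      row_root := hroot hdiag4
      norm := hnorm hdiag2
      bilinear := fun i j _ => hbilin hdiag4 i j }

end GramConcentration

section TailBounds

variable {p : ℕ}

theorem exp_neg_four_mul_log (hp : 0 < p) : Real.exp (-(4 * Real.log p)) = ((p : ℝ) ^ 4)⁻¹ := by
  have hp0 : (0 : ℝ) < p := by exact_mod_cast hp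
  rw [Real.exp_neg, mul_comm, Real.exp_mul, Real.exp_log hp0]
  norm_cast

theorem exp_neg_mul_sq_sqrt_log_div (hp : 0 < p) {N : ℕ} (hN : 1 ≤ N) :
    Real.exp (-(N * (8 * √(Real.log p / N)) ^ 2 / 16)) = ((p : ℝ) ^ 4)⁻¹ := by
  have := Real.log_natCast_nonneg p
  rw [← exp_neg_four_mul_log hp, mul_pow, Real.sq_sqrt (by positivity)]
  congr 1
  field_simp
  ring

theorem exp_neg_sq_three_mul_sqrt_log_le (hp : 0 < p) :
    Real.exp (-((3 * √(Real.log p)) ^ 2 / 2)) ≤ ((p : ℝ) ^ 4)⁻¹ := by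
  have hℓ : 0 ≤ Real.log p := Real.log_natCast_nonneg p
  rw [← exp_neg_four_mul_log hp, mul_pow, Real.sq_sqrt hℓ]
  exact Real.exp_le_exp.mpr (by linarith)

theorem pow_mul_two_mul_le {k : ℕ} (hk : k ≤ 3) (hp : 0 < p) {x : ℝ} (hx : x ≤ ((p : ℝ) ^ 4)⁻¹) :
    (p : ℝ) ^ k * (2 * x) ≤ 2 / p := by
  have hp1 : (1 : ℝ) ≤ p := by exact_mod_cast hp
  calc (p : ℝ) ^ k * (2 * x) ≤ (p : ℝ) ^ k * (2 * ((p : ℝ) ^ 4)⁻¹) := by gcongr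
    _ ≤ (p : ℝ) ^ 3 * (2 * ((p : ℝ) ^ 4)⁻¹) := by gcongr
    _ = 2 / p := by field_simp

theorem mul_exp_neg_sub_one_le (hp : 0 < p) :
    (p : ℝ) * (2 * Real.exp (-((p - 1) / 16))) ≤ 4 * (p : ℝ) ^ 2 * Real.exp (-(1 / 16) * p) := by
  have hp1 : (1 : ℝ) ≤ p := by exact_mod_cast hp
  have hexp : Real.exp (1 / 16) ≤ 2 := by
    rw [← Real.le_log_iff_exp_le zero_lt_two]
    linarith [Real.log_two_gt_d9]
  calc (p : ℝ) * (2 * Real.exp (-((p - 1) / 16)))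
      = p * (2 * (Real.exp (1 / 16) * Real.exp (-(1 / 16) * p))) := by
        rw [← Real.exp_add]; ring_nf
    _ ≤ (p : ℝ) ^ 2 * (2 * (2 * Real.exp (-(1 / 16) * p))) := by
        gcongr
        exact le_self_pow₀ hp1 two_ne_zero
    _ = _ := by ring

end TailBounds

section Concentration

variable {Ω : Type*} [MeasurableSpace Ω] {P : Measure Ω} [IsProbabilityMeasure P] {p d n : ℕ}
  {Sig : Matrix (Fin p) (Fin p) ℝ} {σ : ℝ≥0}
  {A : Ω → Matrix (Fin d) (Fin p) ℝ} {X : Fin n → Ω → EuclideanSpace ℝ (Fin p)}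
  {W : Fin n → Ω → Fin d → ℝ}

theorem IsSensingModel.measure_not_isGoodSample_le (h : IsSensingModel P Sig σ A X W)
    (hSig : Sig.PosSemidef) (c : ℝ) {δ : ℝ} (hδ0 : 0 ≤ δ) (hδ1 : δ ≤ 1) :
    P {ω | ¬ IsGoodSample Sig σ (A ω) (fun s => observe (A ω) (X s ω) (W s ω)) c δ}
      ≤ ENNReal.ofReal (p ^ 2 * (2 * Real.exp (-(n * δ ^ 2 / 16)))) := by
  have hw (q : Fin p × Fin p) : Measurable fun u : Fin d × Fin p → ℝ =>
      (of fun k j => u (k, j)).col q.1 + c • (of fun k j => u (k, j)).col q.2 := by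
    refine measurable_pi_lambda _ fun k => ?_
    simp only [Pi.add_apply, Pi.smul_apply, col_apply, of_apply]
    fun_prop
  refine (measure_mono ?_).trans (measure_not_forall_le (ι := Fin p × Fin p)
    (fun q => h.measure_observe_le hSig (w := fun A => A.col q.1 + c • A.col q.2) (hw q) hδ0 hδ1)
    (by simp; ring))
  exact fun ω hω hall => hω fun i j => hall (i, j)

theorem IsSensingModel.measure_not_isGoodGram_le (h : IsSensingModel P Sig σ A X W) (hp : 0 < p)
    (hd : 1 ≤ d) (hsd : √(Real.log p / d) ≤ 1 / 16) (B : Matrix (Fin p) (Fin p) ℝ) :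
    P {ω | ¬ IsGoodGram ((A ω)ᵀ * A ω) Sig B (8 * √(Real.log p / d)) (3 * √(Real.log p / d))
        (p / d)}
      ≤ ENNReal.ofReal (12 / p + 4 * (p : ℝ) ^ 2 * Real.exp (-(1 / 16) * p)) := by
  have hrow : 3 * √(Real.log p / d) = 3 * √(Real.log p) / √d := by
    rw [Real.sqrt_div (Real.log_natCast_nonneg p), mul_div_assoc]
  rw [hrow]
  refine (IndirectGGM.measure_not_isGoodGram_le h.isGaussianMatrix hd Sig B (by positivity)
    (by linarith) (by positivity)).trans (ENNReal.ofReal_le_ofReal ?_)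
  have hone := pow_mul_two_mul_le (k := 1) (by norm_num) hp (exp_neg_mul_sq_sqrt_log_div hp hd).le
  have htwo := pow_mul_two_mul_le (k := 2) (by norm_num) hp (exp_neg_sq_three_mul_sqrt_log_le hp)
  have hthree := pow_mul_two_mul_le (k := 3) le_rfl hp (exp_neg_sq_three_mul_sqrt_log_le hp)
  rw [pow_one] at hone
  have hsum : (12 : ℝ) / p = 6 * (2 / p) := by ring
  linarith [mul_exp_neg_sub_one_le hp]

theorem abs_covEstimator_sub_le_tauInf {B : Matrix (Fin p) (Fin p) ℝ}
    {A : Matrix (Fin d) (Fin p) ℝ} {y : Fin n → Fin d → ℝ} {σ : ℝ} (hSig : Sig.PosSemidef)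
    (hB : Sig = Bᵀ * B) (hdiag : ∀ i, Sig i i = 1) (hp : 2 ≤ p) (hd : 1 ≤ d) (hn : 1 ≤ n)
    (hsd : √(Real.log p / d) ≤ 1 / 16)
    (hgram : IsGoodGram (Aᵀ * A) Sig B (8 * √(Real.log p / d)) (3 * √(Real.log p / d)) (p / d))
    (hpos : IsGoodSample Sig σ A y 1 (8 * √(Real.log p / n)))
    (hneg : IsGoodSample Sig σ A y (-1) (8 * √(Real.log p / n))) (i j : Fin p) :
    |covEstimator A y i j - Sig i j| ≤ tauInf 1200 d n Sig σ / 2 := by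
  have hm := one_le_maxColNorm hdiag i
  refine le_trans ?_ (momentError_add_inv_le_tauInf hp hd hn hm σ)
  by_cases hij : i = j
  · subst hij
    rw [covEstimator_apply_self, hdiag, sub_self, abs_zero, momentError, gramError]
    have := offFrobenius_nonneg Sig
    positivity
  · exact abs_covEstimator_sub_le hSig hB hdiag (by lia) (by lia) hgram hpos hneg (by linarith)
      (by positivity) (by linarith) (by positivity) (by positivity) hij

theorem IsSensingModel.measure_covEstimator_error_le (h : IsSensingModel P Sig σ A X W)
    (hSig : Sig.PosSemidef) (hdiag : ∀ i, Sig i i = 1) (hp : 2 ≤ p) (hd : 1 ≤ d) (hn : 1 ≤ n)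
    (hsd : √(Real.log p / d) ≤ 1 / 16) (hsn : √(Real.log p / n) ≤ 1 / 8) :
    P {ω | ¬ ∀ i j, |covEstimator (A ω) (fun s => observe (A ω) (X s ω) (W s ω)) i j - Sig i j|
          ≤ tauInf 1200 d n Sig σ / 2}
      ≤ ENNReal.ofReal (failureBound 16 1 1 4 (1 / 16) p d) := by
  obtain ⟨B, hB⟩ := exists_transpose_mul_self hSig
  have hp0 : 0 < p := by lia
  have hsample := fun c => h.measure_not_isGoodSample_le hSig c
    (δ := 8 * √(Real.log p / n)) (by positivity) (by linarith)
  refine (measure_mono ?_).trans <|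
    (measure_not_and_le (by positivity) (by positivity) (h.measure_not_isGoodGram_le hp0 hd hsd B)
      (measure_not_and_le (by positivity) (by positivity) (hsample 1) (hsample (-1)))).trans <|
    ENNReal.ofReal_le_ofReal ?_
  · rintro ω hω ⟨hgram, hpos, hneg⟩
    exact hω (abs_covEstimator_sub_le_tauInf hSig hB hdiag hp hd hn hsd hgram hpos hneg)
  · have htwo := pow_mul_two_mul_le (k := 2) (by norm_num) hp0
      (exp_neg_mul_sq_sqrt_log_div hp0 hn).le
    have : 0 ≤ 1 * (p : ℝ) ^ 2 * Real.exp (-1 * d) := by positivity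
    have hsum : (16 : ℝ) / p = 12 / p + 2 * (2 / p) := by ring
    rw [failureBound]
    linarith

end Concentration

/-! ### Recovery of the precision matrix -/

section Recovery

variable {p d n : ℕ} {Sig R : Matrix (Fin p) (Fin p) ℝ} {θ τ : ℝ}

theorem mul_sqrt_add_sqrt_le_tauInf {C : ℝ} (hC : 0 ≤ C) (hm : 1 ≤ maxColNorm Sig) (σ : ℝ) :
    C * (√(Real.log p / d) + √(Real.log p / n)) ≤ tauInf C d n Sig σ := by
  have := Real.log_natCast_nonneg p
  have := offFrobenius_nonneg Sig
  have hcol : √(Real.log p / d) ≤ √(Real.log p / d) * maxColNorm Sig :=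
    le_mul_of_one_le_right (Real.sqrt_nonneg _) hm
  have hfrobenius : 0 ≤ Real.log p / d * (1 + (p : ℝ) / d) * offFrobenius Sig := by positivity
  have hsample : 0 ≤ √(p : ℝ) * Real.log p / √((n : ℝ) * d)
      + (p : ℝ) * √(Real.log p) ^ 3 / (√n * d) * (1 + (p : ℝ) / d) := by positivity
  have hsensing : 0 ≤ √((p : ℝ) * Real.log p) / d + (p : ℝ) * √(Real.log p) / √d ^ 3 := by
    positivity
  have hnoise : 0 ≤ σ ^ 2 * (1 + √(Real.log p / d)) * √(Real.log p / d)
      * (1 + max √((d : ℝ) / n) ((d : ℝ) / n)) := by positivity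
  rw [tauInf]
  exact mul_le_mul_of_nonneg_left (by linarith) hC

theorem tauInf_pos {C : ℝ} (hC : 0 < C) (hp : 2 ≤ p) (hd : 0 < d) (hm : 1 ≤ maxColNorm Sig)
    (σ : ℝ) : 0 < tauInf C d n Sig σ := by
  refine lt_of_lt_of_le ?_ (mul_sqrt_add_sqrt_le_tauInf hC.le hm σ)
  have : 0 < Real.log p := Real.log_pos (by exact_mod_cast hp)
  positivity

theorem eighteen_mul_le_precError (hG : 1 ≤ kappaGamma Sig) (hθ : 0 < θ) (hθ1 : θ ≤ 1)
    (hτ : 0 ≤ τ) : 18 * τ ≤ precError Sig θ τ :=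
  calc 18 * τ = 2 * 1 * (τ + 8 * τ) := by ring
    _ ≤ 2 * kappaGamma Sig * (τ + 8 * τ / θ) := by gcongr; exact le_eight_mul_div hθ hθ1 hτ
    _ = precError Sig θ τ := (precError_eq hθ.ne').symm

theorem IsSmallErrorLevel.eighteen_mul_le_one (h : IsSmallErrorLevel Sig θ τ) (hp : 0 < p)
    (hSig : Sig.PosDef) (hdiag : ∀ i, Sig i i = 1) (hθ : 0 < θ) (hθ1 : θ ≤ 1) (hτ : 0 ≤ τ) :
    18 * τ ≤ 1 := by
  have hk := one_le_kappaSigma hdiag ⟨0, hp⟩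
  have hG := one_le_kappaGamma hSig hdiag ⟨0, hp⟩
  have hD : (1 : ℝ) ≤ maxDeg Sig := by exact_mod_cast one_le_maxDeg hSig ⟨0, hp⟩
  refine (eighteen_mul_le_precError hG hθ hθ1 hτ).trans (h.radius_le.trans ?_)
  refine mul_le_one₀ (inv_le_one_of_one_le₀ ?_) (by positivity) (min_le_left _ _)
  nlinarith

theorem sign_eq_sign_of_abs_sub_lt {x y : ℝ} (h : |x - y| < |y|) :
    SignType.sign x = SignType.sign y := by
  rcases lt_trichotomy y 0 with hy | rfl | hy
  · rw [abs_of_neg hy, abs_lt] at h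
    rw [sign_neg hy, sign_neg (by linarith [h.2])]
  · rw [abs_zero] at h
    exact absurd h (abs_nonneg _).not_gt
  · rw [abs_of_pos hy, abs_lt] at h
    rw [sign_pos hy, sign_pos (by linarith [h.1])]

/-- The graphical lasso for `R` at level `lam = 8 τ / θ` has a unique solution, which has no false
edges, is within `r = precError Sig θ τ` of `Sig⁻¹`, and has the signs of `Sig⁻¹` as soon as the
off-diagonal entries of `Sig⁻¹` on its support are at least `r`. -/
def RecoversPrecision (Sig R : Matrix (Fin p) (Fin p) ℝ) (θ τ : ℝ) : Prop :=
  ∃ T : Matrix (Fin p) (Fin p) ℝ,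
    (∀ T', IsGraphicalLasso R (8 * τ / θ) T' ↔ T' = T) ∧
    (∀ i j, (i, j) ∉ precSupport Sig → T i j = 0) ∧
    entryMax (T - Sig⁻¹) ≤ precError Sig θ τ ∧
    ((∀ i j, i ≠ j → (i, j) ∈ precSupport Sig → precError Sig θ τ ≤ |Sig⁻¹ i j|) →
      ∀ i j, SignType.sign (T i j) = SignType.sign (Sig⁻¹ i j))

theorem recoversPrecision_of_abs_sub_le (hp : 0 < p) (hSig : Sig.PosDef)
    (hdiag : ∀ i, Sig i i = 1) (hθ : 0 < θ) (hθ1 : θ ≤ 1) (hτ : 0 < τ)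
    (hirr : Irrepresentable Sig θ) (h : IsSmallErrorLevel Sig θ τ) (hR : Rᵀ = R)
    (hRdiag : ∀ i, R i i = 1) (hRS : ∀ i j, |R i j - Sig i j| ≤ τ / 2) :
    RecoversPrecision Sig R θ τ := by
  obtain ⟨T, hT, hTS, hTsub⟩ := exists_glasso_of_abs_sub_le hSig hθ hθ1 hτ hirr hR
    (fun i => by rw [hRdiag, hdiag]) hRS (isNewtonRadius_precError hp hSig hdiag hθ hθ1 hτ h)
  have : Nonempty (Fin p) := ⟨⟨0, hp⟩⟩
  refine ⟨T, hT, hTS, ciSup_le fun q => (hTsub q.1 q.2).le, fun hmin i j => ?_⟩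
  by_cases hij : i = j
  · subst hij
    have hTpos : T.PosDef := ((hT T).2 rfl).1
    rw [sign_pos hTpos.diag_pos, sign_pos hSig.inv.diag_pos]
  by_cases hS : (i, j) ∈ precSupport Sig
  · exact sign_eq_sign_of_abs_sub_lt ((hTsub i j).trans_le (hmin i j hij hS))
  · have hzero : Sig⁻¹ i j = 0 := not_not.1 hS
    rw [hTS i j hS, hzero]

theorem one_le_failureBound_one (d : ℕ) : 1 ≤ failureBound 16 1 1 4 (1 / 16) 1 d := by
  have hd : 0 ≤ 1 * ((1 : ℕ) : ℝ) ^ 2 * Real.exp (-1 * d) := by positivity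
  have hp : 0 ≤ 4 * ((1 : ℕ) : ℝ) ^ 2 * Real.exp (-(1 / 16) * (1 : ℕ)) := by positivity
  rw [failureBound]
  norm_num at hd hp ⊢
  linarith

theorem IsSensingModel.measure_not_recoversPrecision_le {Ω : Type*} [MeasurableSpace Ω]
    {P : Measure Ω} [IsProbabilityMeasure P] {σ : ℝ≥0} {A : Ω → Matrix (Fin d) (Fin p) ℝ}
    {X : Fin n → Ω → EuclideanSpace ℝ (Fin p)} {W : Fin n → Ω → Fin d → ℝ}
    (h : IsSensingModel P Sig σ A X W) (hp : 1 ≤ p) (hd : 1 ≤ d) (hn : 1 ≤ n)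
    (hSig : Sig.PosDef) (hdiag : ∀ i, Sig i i = 1) (hθ : 0 < θ) (hθ1 : θ ≤ 1)
    (hirr : Irrepresentable Sig θ) (hsmall : IsSmallErrorLevel Sig θ (tauInf 1200 d n Sig σ)) :
    P {ω | ¬ RecoversPrecision Sig (covEstimator (A ω) fun s => observe (A ω) (X s ω) (W s ω)) θ
        (tauInf 1200 d n Sig σ)}
      ≤ ENNReal.ofReal (failureBound 16 1 1 4 (1 / 16) p d) := by
  rcases hp.eq_or_lt with rfl | hp2
  · exact prob_le_one.trans (ENNReal.one_le_ofReal.2 (one_le_failureBound_one d))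
  have hm := one_le_maxColNorm hdiag ⟨0, hp⟩
  have hτ := tauInf_pos (n := n) (by norm_num : (0 : ℝ) < 1200) hp2 hd hm σ
  have hτ1 := hsmall.eighteen_mul_le_one hp hSig hdiag hθ hθ1 hτ.le
  have hsqrt := mul_sqrt_add_sqrt_le_tauInf (d := d) (n := n) (by norm_num : (0 : ℝ) ≤ 1200) hm σ
  have hsd0 := Real.sqrt_nonneg (Real.log p / d)
  have hsn0 := Real.sqrt_nonneg (Real.log p / n)
  refine (measure_mono ?_).trans (h.measure_covEstimator_error_le hSig.posSemidef hdiag hp2 hd hn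
    (by linarith) (by linarith))
  intro ω hω hRS
  exact hω (recoversPrecision_of_abs_sub_le hp hSig hdiag hθ hθ1 hτ hirr hsmall
    covEstimator_transpose covEstimator_apply_self hRS)

end Recovery

/-! ### Sufficient orders of the dimensions -/

section CovarianceNorms

variable {p : ℕ} {Sig : Matrix (Fin p) (Fin p) ℝ} {κ : ℝ}

theorem sum_sq_row_le (hκ : kappaSigma Sig ≤ κ) (i : Fin p) : ∑ j, Sig i j ^ 2 ≤ κ ^ 2 := by
  have hrow : ∑ j, |Sig i j| ≤ κ := (sum_abs_le_maxRowSum Sig i).trans hκ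
  calc ∑ j, Sig i j ^ 2 = ∑ j, |Sig i j| ^ 2 := by simp only [sq_abs]
    _ ≤ (∑ j, |Sig i j|) ^ 2 := Finset.sum_sq_le_sq_sum_of_nonneg fun _ _ => abs_nonneg _
    _ ≤ κ ^ 2 := pow_le_pow_left₀ (Finset.sum_nonneg fun _ _ => abs_nonneg _) hrow 2

theorem maxColNorm_le [Nonempty (Fin p)] (hSig : Sig.PosDef) (hκ : kappaSigma Sig ≤ κ)
    (hκ0 : 0 ≤ κ) : maxColNorm Sig ≤ κ := by
  refine ciSup_le fun j => Real.sqrt_le_iff.2 ⟨hκ0, ?_⟩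
  calc ∑ i, Sig i j ^ 2 = ∑ i, Sig j i ^ 2 :=
        Finset.sum_congr rfl fun i _ => by rw [apply_comm_of_posDef hSig]
    _ ≤ κ ^ 2 := sum_sq_row_le hκ j

theorem offFrobenius_le (hκ : kappaSigma Sig ≤ κ) (hκ0 : 0 ≤ κ) : offFrobenius Sig ≤ √p * κ := by
  refine Real.sqrt_le_iff.2 ⟨by positivity, ?_⟩
  rw [mul_pow, Real.sq_sqrt p.cast_nonneg]
  calc ∑ i, ∑ j, offPart Sig i j ^ 2 ≤ ∑ i, ∑ j, Sig i j ^ 2 := by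
        refine Finset.sum_le_sum fun i _ => Finset.sum_le_sum fun j _ => ?_
        by_cases hij : i = j <;> simp [offPart, hij, sq_nonneg]
    _ ≤ ∑ _i : Fin p, κ ^ 2 := Finset.sum_le_sum fun i _ => sum_sq_row_le hκ i
    _ = p * κ ^ 2 := by simp

end CovarianceNorms

/-- The growth conditions on the dimensions with constant `K = L ^ 2`, as inequalities between
real numbers: `q`, `D`, `N` stand for `p`, `d`, `n`, the number `ℓ` for `log p`, and `z` for
`p ^ (1 / 10)`, in which all the exponents that occur are integers. -/
structure IsSufficientOrder (L q z ℓ D N : ℝ) : Prop where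
  one_le : 1 ≤ L
  one_le_root : 1 ≤ z
  eq_root_pow : q = z ^ 10
  half_le_log : 1 / 2 ≤ ℓ
  log_le_root : ℓ ≤ 10 * z
  le_sensing : L ^ 2 * z ^ 8 ≤ D
  le_sample : L ^ 2 * z ^ 8 * ℓ ^ 3 ≤ N

theorem isSufficientOrder_rpow {p d n : ℕ} {L : ℝ} (hL : 1 ≤ L) (hp : 2 ≤ p)
    (hd : L ^ 2 * (p : ℝ) ^ (0.8 : ℝ) ≤ d)
    (hn : L ^ 2 * (p : ℝ) ^ (0.8 : ℝ) * Real.log p ^ 3 ≤ n) :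
    IsSufficientOrder L p ((p : ℝ) ^ (1 / 10 : ℝ)) (Real.log p) d n := by
  have hp2 : (2 : ℝ) ≤ p := by exact_mod_cast hp
  have hp0 : (0 : ℝ) ≤ p := p.cast_nonneg
  have hroot8 : (p : ℝ) ^ (0.8 : ℝ) = ((p : ℝ) ^ (1 / 10 : ℝ)) ^ 8 := by
    rw [← Real.rpow_mul_natCast hp0]; norm_num
  rw [hroot8] at hd hn
  exact
    { one_le := hL
      one_le_root := Real.one_le_rpow (by linarith) (by norm_num)
      eq_root_pow := by rw [← Real.rpow_mul_natCast hp0]; norm_num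
      half_le_log := by
        linarith [Real.log_two_gt_d9, Real.log_le_log (by norm_num) hp2]
      log_le_root := by
        linarith [Real.log_le_rpow_div hp0 (by norm_num : (0 : ℝ) < 1 / 10)]
      le_sensing := hd
      le_sample := hn }

namespace IsSufficientOrder

variable {L q z ℓ D N : ℝ}

theorem pos (h : IsSufficientOrder L q z ℓ D N) : 0 < L := by linarith [h.one_le]

theorem root_pos (h : IsSufficientOrder L q z ℓ D N) : 0 < z := by linarith [h.one_le_root]

theorem log_pos (h : IsSufficientOrder L q z ℓ D N) : 0 < ℓ := by linarith [h.half_le_log]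

theorem dim_pos (h : IsSufficientOrder L q z ℓ D N) : 0 < q :=
  h.eq_root_pow ▸ pow_pos h.root_pos 10

theorem sensing_pos (h : IsSufficientOrder L q z ℓ D N) : 0 < D :=
  lt_of_lt_of_le (mul_pos (pow_pos h.pos 2) (pow_pos h.root_pos 8)) h.le_sensing

theorem sample_pos (h : IsSufficientOrder L q z ℓ D N) : 0 < N :=
  lt_of_lt_of_le (mul_pos (mul_pos (pow_pos h.pos 2) (pow_pos h.root_pos 8)) (pow_pos h.log_pos 3))
    h.le_sample

theorem le_sq (h : IsSufficientOrder L q z ℓ D N) : L ≤ L ^ 2 := le_self_pow₀ h.one_le two_ne_zero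

theorem one_le_root_pow (h : IsSufficientOrder L q z ℓ D N) (k : ℕ) : 1 ≤ z ^ k :=
  one_le_pow₀ h.one_le_root

theorem one_add_dim_div_sensing_le (h : IsSufficientOrder L q z ℓ D N) :
    1 + q / D ≤ 2 * z ^ 2 := by
  have := h.root_pos
  have hdiv : q / D ≤ z ^ 2 := by
    rw [div_le_iff₀ h.sensing_pos, h.eq_root_pow]
    calc z ^ 10 = z ^ 2 * (1 * z ^ 8) := by ring
      _ ≤ z ^ 2 * (L ^ 2 * z ^ 8) := by gcongr; exact one_le_pow₀ h.one_le
      _ ≤ z ^ 2 * D := by gcongr; exact h.le_sensing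
  linarith [h.one_le_root_pow 2]

theorem log_div_sensing_le (h : IsSufficientOrder L q z ℓ D N) :
    ℓ / D ≤ 10 / (L ^ 2 * z ^ 7) := by
  have := h.pos
  have := h.root_pos
  rw [div_le_div_iff₀ h.sensing_pos (by positivity)]
  calc ℓ * (L ^ 2 * z ^ 7) ≤ 10 * z * (L ^ 2 * z ^ 7) := by gcongr; exact h.log_le_root
    _ = 10 * (L ^ 2 * z ^ 8) := by ring
    _ ≤ 10 * D := by gcongr; exact h.le_sensing

theorem sqrt_log_div_sensing_le (h : IsSufficientOrder L q z ℓ D N) : √(ℓ / D) ≤ 4 / L := by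
  have := h.pos
  refine Real.sqrt_le_iff.2 ⟨by positivity, ?_⟩
  calc ℓ / D ≤ 10 / (L ^ 2 * z ^ 7) := h.log_div_sensing_le
    _ ≤ 16 / (L ^ 2 * 1) := by gcongr; exacts [by norm_num, h.one_le_root_pow 7]
    _ = (4 / L) ^ 2 := by ring

theorem sqrt_log_div_sample_le (h : IsSufficientOrder L q z ℓ D N) : √(ℓ / N) ≤ 2 / L := by
  have := h.pos
  have := h.log_pos
  refine Real.sqrt_le_iff.2 ⟨by positivity, ?_⟩
  rw [div_pow, div_le_div_iff₀ h.sample_pos (by positivity)]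
  have hlog : (1 / 2) ^ 2 ≤ ℓ ^ 2 := by gcongr; exact h.half_le_log
  calc ℓ * L ^ 2 = 2 ^ 2 * (L ^ 2 * 1 * (ℓ * (1 / 2) ^ 2)) := by ring
    _ ≤ 2 ^ 2 * (L ^ 2 * z ^ 8 * (ℓ * ℓ ^ 2)) := by gcongr; exact h.one_le_root_pow 8
    _ = 2 ^ 2 * (L ^ 2 * z ^ 8 * ℓ ^ 3) := by ring
    _ ≤ 2 ^ 2 * N := by gcongr; exact h.le_sample

theorem frobenius_term_le (h : IsSufficientOrder L q z ℓ D N) {κ F : ℝ} (hκ : 0 ≤ κ)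
    (hF : F ≤ √q * κ) : ℓ / D * (1 + q / D) * F ≤ 20 * κ / L := by
  have := h.pos
  have := h.root_pos
  have := h.log_pos
  have := h.sensing_pos
  have := h.dim_pos
  have hsqrt : √q = z ^ 5 := by
    rw [h.eq_root_pow, show z ^ 10 = (z ^ 5) ^ 2 by ring, Real.sqrt_sq (by positivity)]
  calc ℓ / D * (1 + q / D) * F ≤ ℓ / D * (1 + q / D) * (√q * κ) := by gcongr
    _ ≤ 10 / (L ^ 2 * z ^ 7) * (2 * z ^ 2) * (z ^ 5 * κ) := by
        have hlog := h.log_div_sensing_le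
        have hdim := h.one_add_dim_div_sensing_le
        rw [hsqrt]
        gcongr
    _ = 20 * κ / L ^ 2 := by field_simp; ring
    _ ≤ 20 * κ / L := by gcongr; exact h.le_sq

theorem sample_term_le (h : IsSufficientOrder L q z ℓ D N) : √q * ℓ / √(N * D) ≤ 2 / L := by
  have := h.pos
  have := h.root_pos
  have := h.log_pos
  have := h.sensing_pos
  have := h.sample_pos
  have hprod : (L ^ 2 * z ^ 8 * ℓ ^ 3) * (L ^ 2 * z ^ 8) ≤ N * D := by
    gcongr
    exacts [h.le_sample, h.le_sensing]
  have hone : 1 ≤ 4 * ℓ * (L ^ 2 * z ^ 6) :=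
    one_le_mul_of_one_le_of_one_le (by linarith [h.half_le_log])
      (one_le_mul_of_one_le_of_one_le (one_le_pow₀ h.one_le) (h.one_le_root_pow 6))
  rw [← Real.sqrt_sq h.log_pos.le, ← Real.sqrt_mul h.dim_pos.le,
    ← Real.sqrt_div (mul_nonneg h.dim_pos.le (sq_nonneg ℓ))]
  refine Real.sqrt_le_iff.2 ⟨by positivity, ?_⟩
  rw [div_pow, div_le_div_iff₀ (by positivity) (by positivity), h.eq_root_pow]
  calc z ^ 10 * ℓ ^ 2 * L ^ 2 = 1 * (z ^ 10 * ℓ ^ 2 * L ^ 2) := by ring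
    _ ≤ 4 * ℓ * (L ^ 2 * z ^ 6) * (z ^ 10 * ℓ ^ 2 * L ^ 2) := by gcongr
    _ = 2 ^ 2 * ((L ^ 2 * z ^ 8 * ℓ ^ 3) * (L ^ 2 * z ^ 8)) := by ring
    _ ≤ 2 ^ 2 * (N * D) := by gcongr

theorem sample_sensing_term_le (h : IsSufficientOrder L q z ℓ D N) :
    q * √ℓ ^ 3 / (√N * D) * (1 + q / D) ≤ 2 / L := by
  have := h.pos
  have := h.root_pos
  have := h.log_pos
  have := h.sensing_pos
  have := h.sample_pos
  have := h.dim_pos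
  have hsqrtN : L * z ^ 4 * √ℓ ^ 3 ≤ √N := by
    refine Real.le_sqrt_of_sq_le (le_of_eq_of_le ?_ h.le_sample)
    rw [mul_pow, ← pow_mul, mul_comm 3 2, pow_mul, Real.sq_sqrt h.log_pos.le]
    ring
  have hfactor : q * √ℓ ^ 3 / (√N * D) ≤ 1 / (L ^ 3 * z ^ 2) := by
    rw [div_le_div_iff₀ (by positivity) (by positivity), h.eq_root_pow, one_mul]
    calc z ^ 10 * √ℓ ^ 3 * (L ^ 3 * z ^ 2) = (L * z ^ 4 * √ℓ ^ 3) * (L ^ 2 * z ^ 8) := by ring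
      _ ≤ √N * D := by gcongr; exact h.le_sensing
  calc q * √ℓ ^ 3 / (√N * D) * (1 + q / D) ≤ 1 / (L ^ 3 * z ^ 2) * (2 * z ^ 2) := by
        gcongr
        exact h.one_add_dim_div_sensing_le
    _ = 2 / L ^ 3 := by field_simp
    _ ≤ 2 / L := by gcongr; exact le_self_pow₀ h.one_le (by norm_num)

theorem sqrt_log_le (h : IsSufficientOrder L q z ℓ D N) : √ℓ ≤ 4 * z :=
  Real.sqrt_le_iff.2 ⟨by linarith [h.root_pos], by nlinarith [h.log_le_root, h.one_le_root]⟩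

theorem sensing_term_le (h : IsSufficientOrder L q z ℓ D N) : √(q * ℓ) / D ≤ 4 / L := by
  have := h.root_pos
  have := h.pos
  have hsqrt : √(q * ℓ) ≤ 4 * z ^ 6 := by
    have hsqrtq : √q = z ^ 5 := by
      rw [h.eq_root_pow, show z ^ 10 = (z ^ 5) ^ 2 by ring, Real.sqrt_sq (by positivity)]
    rw [Real.sqrt_mul h.dim_pos.le, hsqrtq]
    calc z ^ 5 * √ℓ ≤ z ^ 5 * (4 * z) := by gcongr; exact h.sqrt_log_le
      _ = 4 * z ^ 6 := by ring
  rw [div_le_div_iff₀ h.sensing_pos h.pos]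
  calc √(q * ℓ) * L ≤ 4 * z ^ 8 * L ^ 2 := by
        gcongr
        exacts [hsqrt.trans (by gcongr; exacts [h.one_le_root, by norm_num]), h.le_sq]
    _ = 4 * (L ^ 2 * z ^ 8) := by ring
    _ ≤ 4 * D := by gcongr; exact h.le_sensing

theorem sensing_pow_term_le (h : IsSufficientOrder L q z ℓ D N) : q * √ℓ / √D ^ 3 ≤ 4 / L := by
  have := h.pos
  have := h.root_pos
  have := h.sensing_pos
  have hsqrtD : L * z ^ 4 ≤ √D :=
    Real.le_sqrt_of_sq_le (le_of_eq_of_le (by ring) h.le_sensing)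
  rw [div_le_div_iff₀ (by positivity) h.pos, h.eq_root_pow]
  calc z ^ 10 * √ℓ * L ≤ z ^ 10 * (4 * z) * L := by gcongr; exact h.sqrt_log_le
    _ = 4 * (z ^ 11 * L) := by ring
    _ ≤ 4 * (z ^ 12 * L ^ 3) := by
        gcongr
        exacts [h.one_le_root, by norm_num, le_self_pow₀ h.one_le (by norm_num)]
    _ = 4 * (L * z ^ 4) ^ 3 := by ring
    _ ≤ 4 * √D ^ 3 := by gcongr

theorem sqrt_log_mul_le (h : IsSufficientOrder L q z ℓ D N) (hDq : D ≤ q) :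
    √(ℓ * D) ≤ 12 * ℓ ^ 3 * z ^ 8 := by
  have := h.root_pos
  have := h.log_pos
  refine Real.sqrt_le_iff.2 ⟨by positivity, ?_⟩
  have hlog : (1 / 2) ^ 5 ≤ ℓ ^ 5 := by gcongr; exact h.half_le_log
  calc ℓ * D ≤ 1 * (ℓ * z ^ 10) := by rw [one_mul, ← h.eq_root_pow]; gcongr
    _ ≤ 32 * ℓ ^ 5 * (ℓ * z ^ 16) := by
        gcongr
        exacts [by linarith, h.one_le_root, by norm_num]
    _ = 32 * (ℓ ^ 6 * z ^ 16) := by ring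
    _ ≤ 144 * (ℓ ^ 6 * z ^ 16) := by gcongr; norm_num
    _ = (12 * ℓ ^ 3 * z ^ 8) ^ 2 := by ring

theorem sqrt_log_div_mul_div_le (h : IsSufficientOrder L q z ℓ D N) (hD : D ≤ q ∨ D ≤ N) :
    √(ℓ / D) * (D / N) ≤ 12 / L := by
  have := h.pos
  have := h.root_pos
  have := h.log_pos
  have := h.sensing_pos
  have := h.sample_pos
  rcases hD with hDq | hDN
  · have hcancel : √(ℓ / D) * (D / N) = √(ℓ * D) / N := by
      rw [← mul_div_assoc]
      nth_rewrite 2 [← Real.sqrt_sq h.sensing_pos.le]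
      rw [← Real.sqrt_mul (by positivity)]
      congr 2
      field_simp
    rw [hcancel, div_le_div_iff₀ h.sample_pos h.pos]
    calc √(ℓ * D) * L ≤ 12 * ℓ ^ 3 * z ^ 8 * L ^ 2 := by
          gcongr
          exacts [h.sqrt_log_mul_le hDq, h.le_sq]
      _ = 12 * (L ^ 2 * z ^ 8 * ℓ ^ 3) := by ring
      _ ≤ 12 * N := by gcongr; exact h.le_sample
  · calc √(ℓ / D) * (D / N) ≤ 4 / L * 1 := by
          gcongr
          exacts [h.sqrt_log_div_sensing_le, (div_le_one h.sample_pos).2 hDN]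
      _ ≤ 12 / L := by rw [mul_one]; gcongr; norm_num

theorem sqrt_log_div_mul_one_add_max_le (h : IsSufficientOrder L q z ℓ D N)
    (hD : D ≤ q ∨ D ≤ N) : √(ℓ / D) * (1 + max √(D / N) (D / N)) ≤ 16 / L := by
  have := h.pos
  have := h.log_pos
  have hsqrt : √(ℓ / D) * √(D / N) ≤ 12 / L := by
    rw [← Real.sqrt_mul (div_nonneg h.log_pos.le h.sensing_pos.le),
      div_mul_div_cancel₀ h.sensing_pos.ne']
    exact h.sqrt_log_div_sample_le.trans (by gcongr; norm_num)
  calc √(ℓ / D) * (1 + max √(D / N) (D / N))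
      = √(ℓ / D) + max (√(ℓ / D) * √(D / N)) (√(ℓ / D) * (D / N)) := by
        rw [mul_add, mul_one, mul_max_of_nonneg _ _ (Real.sqrt_nonneg _)]
    _ ≤ 4 / L + 12 / L := add_le_add h.sqrt_log_div_sensing_le
        (max_le hsqrt (h.sqrt_log_div_mul_div_le hD))
    _ = 16 / L := by ring

theorem noise_term_le (h : IsSufficientOrder L q z ℓ D N) (hD : D ≤ q ∨ D ≤ N) {σ σ₀ : ℝ}
    (hσ0 : 0 ≤ σ) (hσ : σ ≤ σ₀) :
    σ ^ 2 * (1 + √(ℓ / D)) * √(ℓ / D) * (1 + max √(D / N) (D / N)) ≤ 80 * σ₀ ^ 2 / L := by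
  have hsqrt : √(ℓ / D) ≤ 4 :=
    h.sqrt_log_div_sensing_le.trans (div_le_self (by norm_num) h.one_le)
  calc σ ^ 2 * (1 + √(ℓ / D)) * √(ℓ / D) * (1 + max √(D / N) (D / N))
      = σ ^ 2 * (1 + √(ℓ / D)) * (√(ℓ / D) * (1 + max √(D / N) (D / N))) := by ring
    _ ≤ σ₀ ^ 2 * (1 + 4) * (16 / L) := by
        gcongr
        exact h.sqrt_log_div_mul_one_add_max_le hD
    _ = 80 * σ₀ ^ 2 / L := by ring

end IsSufficientOrder

section Orders

variable {p d n : ℕ} {Sig : Matrix (Fin p) (Fin p) ℝ}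

theorem tauInf_le_of_orders [Nonempty (Fin p)] (hp : 2 ≤ p) {C L κ σ σ₀ : ℝ} (hC : 0 ≤ C)
    (hL : 1 ≤ L) (hSig : Sig.PosDef) (hκ : kappaSigma Sig ≤ κ) (hκ0 : 0 ≤ κ) (hσ0 : 0 ≤ σ)
    (hσ : σ ≤ σ₀) (hd : L ^ 2 * (p : ℝ) ^ (0.8 : ℝ) ≤ d) (hdn : d ≤ max p n)
    (hn : L ^ 2 * (p : ℝ) ^ (0.8 : ℝ) * Real.log p ^ 3 ≤ n) :
    tauInf C d n Sig σ ≤ C * (24 * κ + 14 + 80 * σ₀ ^ 2) / L := by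
  have h := isSufficientOrder_rpow hL hp hd hn
  have := h.pos
  have hdn' : (d : ℝ) ≤ p ∨ (d : ℝ) ≤ n := by exact_mod_cast le_max_iff.1 hdn
  have hcol : √(Real.log p / d) * maxColNorm Sig ≤ 4 / L * κ :=
    mul_le_mul h.sqrt_log_div_sensing_le (maxColNorm_le hSig hκ hκ0)
      (Real.iSup_nonneg fun _ => Real.sqrt_nonneg _) (by positivity)
  rw [tauInf, mul_div_assoc C]
  refine mul_le_mul_of_nonneg_left ?_ hC
  have hsum : (24 * κ + 14 + 80 * σ₀ ^ 2) / L = 4 / L * κ + 20 * κ / L + 2 / L + 2 / L + 4 / L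
      + 4 / L + 2 / L + 80 * σ₀ ^ 2 / L := by ring
  linarith [h.frobenius_term_le hκ0 (offFrobenius_le hκ hκ0), h.sample_term_le,
    h.sample_sensing_term_le, h.sensing_term_le, h.sensing_pow_term_le, h.sqrt_log_div_sample_le,
    h.noise_term_le hdn' hσ0 hσ]

/-- Bounds on the level `τ` that make it small for every covariance matrix with
`kappaSigma ≤ κ₁`, `kappaGamma ≤ κ₂`, `maxDeg ≤ D` and signal at least `b`; here
`c * τ` bounds `precError`. -/
structure IsUniformlySmall (κ₁ D κ₂ c b τ : ℝ) : Prop where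
  radius_le : c * τ ≤ (3 * κ₁ * D)⁻¹ * (κ₁ ^ 2 * κ₂)⁻¹
  remainder_le : 3 / 2 * D * κ₁ ^ 3 * c ^ 2 * τ ≤ 1
  signal_le : c * τ ≤ b

theorem exists_isUniformlySmall {κ₁ D κ₂ c b : ℝ} (hκ₁ : 0 < κ₁) (hD : 0 < D) (hκ₂ : 0 < κ₂)
    (hc : 0 < c) (hb : 0 < b) : ∃ τ₀ > 0, ∀ τ ≤ τ₀, IsUniformlySmall κ₁ D κ₂ c b τ := by
  refine ⟨min (min ((3 * κ₁ * D)⁻¹ * (κ₁ ^ 2 * κ₂)⁻¹ / c)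
    (1 / (3 / 2 * D * κ₁ ^ 3 * c ^ 2))) (b / c), by positivity, fun τ hτ => ?_⟩
  obtain ⟨⟨hradius, hremainder⟩, hsignal⟩ := by simpa only [le_min_iff] using hτ
  exact ⟨(le_div_iff₀' hc).1 hradius, (le_div_iff₀' (by positivity)).1 hremainder,
    (le_div_iff₀' hc).1 hsignal⟩

theorem IsUniformlySmall.isSmallErrorLevel {θ κ₁ κ₂ b τ : ℝ} {D : ℕ}
    (h : IsUniformlySmall κ₁ D κ₂ (2 * κ₂ * (1 + 8 / θ)) b τ) (hp : 0 < p) (hSig : Sig.PosDef)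
    (hdiag : ∀ i, Sig i i = 1) (hθ : 0 < θ) (hτ : 0 ≤ τ) (hκ₁ : kappaSigma Sig ≤ κ₁)
    (hκ₂ : kappaGamma Sig ≤ κ₂) (hD : maxDeg Sig ≤ D) :
    IsSmallErrorLevel Sig θ τ ∧ precError Sig θ τ ≤ b := by
  have hk := one_le_kappaSigma hdiag ⟨0, hp⟩
  have hG := one_le_kappaGamma hSig hdiag ⟨0, hp⟩
  have hκ₁0 : 0 < κ₁ := by linarith
  have hκ₂0 : 0 < κ₂ := by linarith
  have hdeg : (1 : ℝ) ≤ maxDeg Sig := by exact_mod_cast one_le_maxDeg hSig ⟨0, hp⟩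
  have hD' : (maxDeg Sig : ℝ) ≤ D := by exact_mod_cast hD
  have hr : precError Sig θ τ ≤ 2 * κ₂ * (1 + 8 / θ) * τ := by rw [precError]; gcongr
  have hr0 : 0 ≤ precError Sig θ τ := by rw [precError]; positivity
  set c := 2 * κ₂ * (1 + 8 / θ)
  refine ⟨⟨hr.trans (h.radius_le.trans ?_), ?_⟩, hr.trans h.signal_le⟩
  · have hone : 1 ≤ kappaSigma Sig ^ 2 * kappaGamma Sig :=
      one_le_mul_of_one_le_of_one_le (one_le_pow₀ hk) hG
    rw [min_eq_right (inv_le_one_of_one_le₀ hone)]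
    gcongr
  · calc 3 / 2 * maxDeg Sig * kappaSigma Sig ^ 3 * precError Sig θ τ ^ 2
        ≤ 3 / 2 * D * κ₁ ^ 3 * (c * τ) ^ 2 := by gcongr
      _ = (3 / 2 * D * κ₁ ^ 3 * c ^ 2 * τ) * τ := by ring
      _ ≤ 1 * τ := by gcongr; exact h.remainder_le
      _ = τ := one_mul τ

theorem exists_order_constant_tauInf_le {C κ τ₀ : ℝ} (hC : 0 < C) (hκ : 0 < κ) (σ₀ : ℝ)
    (hτ₀ : 0 < τ₀) :
    ∃ K : ℝ, 0 < K ∧ ∀ (p d n : ℕ), 2 ≤ p →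
      K * (p : ℝ) ^ (0.8 : ℝ) ≤ d → d ≤ max p n →
      K * (p : ℝ) ^ (0.8 : ℝ) * Real.log p ^ 3 ≤ n →
      ∀ (Sig : Matrix (Fin p) (Fin p) ℝ) (σ : ℝ≥0), Sig.PosDef → kappaSigma Sig ≤ κ → σ ≤ σ₀ →
      tauInf C d n Sig σ ≤ τ₀ := by
  set B := C * (24 * κ + 14 + 80 * σ₀ ^ 2)
  set L := max 1 (B / τ₀)
  have hL : 1 ≤ L := le_max_left _ _
  refine ⟨L ^ 2, by positivity, fun p d n hp hd hdn hn Sig σ hSig hSigκ hσ => ?_⟩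
  have : Nonempty (Fin p) := ⟨⟨0, by lia⟩⟩
  calc tauInf C d n Sig σ
      ≤ B / L := tauInf_le_of_orders hp hC.le hL hSig hSigκ hκ.le σ.2 hσ hd hdn hn
    _ ≤ τ₀ := (div_le_comm₀ (by positivity) hτ₀).2 (le_max_right _ _)

theorem exists_order_constant {C θ b : ℝ} (κ₁ κ₂ σ₀ : ℝ) (D : ℕ) (hC : 0 < C) (hθ : 0 < θ)
    (hb : 0 < b) :
    ∃ K : ℝ, 0 < K ∧ ∀ (p d n : ℕ), 2 ≤ p → 1 ≤ d →
      K * (p : ℝ) ^ (0.8 : ℝ) ≤ d → d ≤ max p n →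
      K * (p : ℝ) ^ (0.8 : ℝ) * Real.log p ^ 3 ≤ n →
      ∀ (Sig : Matrix (Fin p) (Fin p) ℝ) (σ : ℝ≥0), Sig.PosDef → (∀ i, Sig i i = 1) →
      kappaSigma Sig ≤ κ₁ → kappaGamma Sig ≤ κ₂ → maxDeg Sig ≤ D → σ ≤ σ₀ →
      IsSmallErrorLevel Sig θ (tauInf C d n Sig σ) ∧
        precError Sig θ (tauInf C d n Sig σ) ≤ b := by
  by_cases hpar : 1 ≤ κ₁ ∧ 1 ≤ κ₂ ∧ 1 ≤ D
  · obtain ⟨hκ₁, hκ₂, hD⟩ := hpar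
    have hD' : (1 : ℝ) ≤ D := by exact_mod_cast hD
    obtain ⟨τ₀, hτ₀, hsmall⟩ := exists_isUniformlySmall (κ₁ := κ₁) (D := D) (κ₂ := κ₂)
      (c := 2 * κ₂ * (1 + 8 / θ)) (by linarith) (by linarith) (by linarith) (by positivity) hb
    obtain ⟨K, hK, hKτ⟩ := exists_order_constant_tauInf_le (κ := κ₁) hC (by linarith) σ₀ hτ₀
    refine ⟨K, hK, fun p d n hp hd hdK hdn hnK Sig σ hSig hdiag hSig₁ hSig₂ hdeg hσ => ?_⟩
    have hm := one_le_maxColNorm hdiag ⟨0, by lia⟩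
    exact (hsmall _ (hKτ p d n hp hdK hdn hnK Sig σ hSig hSig₁ hσ)).isSmallErrorLevel (by lia)
      hSig hdiag hθ (tauInf_pos hC hp hd hm σ).le hSig₁ hSig₂ hdeg
  · refine ⟨1, one_pos, fun p d n hp _ _ _ _ Sig σ hSig hdiag hκ₁ hκ₂ hD _ => absurd ?_ hpar⟩
    have hp0 : 0 < p := by lia
    exact ⟨(one_le_kappaSigma hdiag ⟨0, hp0⟩).trans hκ₁,
      (one_le_kappaGamma hSig hdiag ⟨0, hp0⟩).trans hκ₂, (one_le_maxDeg hSig ⟨0, hp0⟩).trans hD⟩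

end Orders

end IndirectGGM

open IndirectGGM in
theorem mainTheorem1 :
    ∃ C a₀ a₁ a₂ a₃ a₄ : ℝ, 0 < C ∧ 0 < a₀ ∧ 0 < a₁ ∧ 0 < a₂ ∧ 0 < a₃ ∧ 0 < a₄ ∧
      -- the non-asymptotic guarantee
      (∀ (p d n : ℕ), 1 ≤ p → 1 ≤ d → 1 ≤ n →
        ∀ (Sig : Matrix (Fin p) (Fin p) ℝ) (θ : ℝ) (σ : ℝ≥0),
        Sig.PosDef → (∀ i, Sig i i = 1) →
        0 < θ → θ ≤ 1 → Irrepresentable Sig θ →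
        precError Sig θ (tauInf C d n Sig σ)
          ≤ (3 * kappaSigma Sig * maxDeg Sig)⁻¹
            * min 1 (kappaSigma Sig ^ 2 * kappaGamma Sig)⁻¹ →
        3 / 2 * maxDeg Sig * kappaSigma Sig ^ 3 * precError Sig θ (tauInf C d n Sig σ) ^ 2
          ≤ tauInf C d n Sig σ →
        ∀ (Ω : Type u) [MeasurableSpace Ω] (P : Measure Ω) [IsProbabilityMeasure P]
          (A : Ω → Matrix (Fin d) (Fin p) ℝ) (X : Fin n → Ω → EuclideanSpace ℝ (Fin p))
          (W : Fin n → Ω → Fin d → ℝ),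
        IsSensingModel P Sig σ A X W →
        P {ω | ¬ ∃ T : Matrix (Fin p) (Fin p) ℝ,
              (∀ T', IsGraphicalLasso
                (covEstimator (A ω) fun s => observe (A ω) (X s ω) (W s ω))
                (8 * tauInf C d n Sig σ / θ) T' ↔ T' = T) ∧
              (∀ i j, (i, j) ∉ precSupport Sig → T i j = 0) ∧
              entryMax (T - Sig⁻¹) ≤ precError Sig θ (tauInf C d n Sig σ) ∧
              ((∀ i j, i ≠ j → (i, j) ∈ precSupport Sig →
                  precError Sig θ (tauInf C d n Sig σ) ≤ |Sig⁻¹ i j|) →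
                ∀ i j, SignType.sign (T i j) = SignType.sign (Sig⁻¹ i j))}
          ≤ ENNReal.ofReal (failureBound a₀ a₁ a₂ a₃ a₄ p d)) ∧
      -- sufficient orders of `d` and `n` when all other parameters are bounded
      (∀ (θ κ₁ κ₂ σ₀ b : ℝ) (D : ℕ), 0 < θ → θ ≤ 1 → 0 < b →
        ∃ K : ℝ, 0 < K ∧
        ∀ (p d n : ℕ), 1 ≤ p → 1 ≤ d → 1 ≤ n →
        K * (p : ℝ) ^ (0.8 : ℝ) ≤ d → d ≤ max p n →
        K * (p : ℝ) ^ (0.8 : ℝ) * Real.log p ^ 3 ≤ n →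
        ∀ (Sig : Matrix (Fin p) (Fin p) ℝ) (σ : ℝ≥0),
        Sig.PosDef → (∀ i, Sig i i = 1) → Irrepresentable Sig θ →
        kappaSigma Sig ≤ κ₁ → kappaGamma Sig ≤ κ₂ → maxDeg Sig ≤ D → σ ≤ σ₀ →
        (∀ i j, i ≠ j → (i, j) ∈ precSupport Sig → b ≤ |Sig⁻¹ i j|) →
        ∀ (Ω : Type u) [MeasurableSpace Ω] (P : Measure Ω) [IsProbabilityMeasure P]
          (A : Ω → Matrix (Fin d) (Fin p) ℝ) (X : Fin n → Ω → EuclideanSpace ℝ (Fin p))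
          (W : Fin n → Ω → Fin d → ℝ),
        IsSensingModel P Sig σ A X W →
        P {ω | ¬ ∃ T : Matrix (Fin p) (Fin p) ℝ,
              (∀ T', IsGraphicalLasso
                (covEstimator (A ω) fun s => observe (A ω) (X s ω) (W s ω))
                (8 * tauInf C d n Sig σ / θ) T' ↔ T' = T) ∧
              ∀ i j, SignType.sign (T i j) = SignType.sign (Sig⁻¹ i j)}
          ≤ ENNReal.ofReal (failureBound a₀ a₁ a₂ a₃ a₄ p d)) := by
  refine ⟨1200, 16, 1, 1, 4, 1 / 16, by norm_num, by norm_num, by norm_num, by norm_num,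
    by norm_num, by norm_num, ?_, ?_⟩
  · intro p d n hp hd hn Sig θ σ hSig hdiag hθ hθ1 hirr hradius hremainder Ω _ P _ A X W h
    exact h.measure_not_recoversPrecision_le hp hd hn hSig hdiag hθ hθ1 hirr ⟨hradius, hremainder⟩
  · intro θ κ₁ κ₂ σ₀ b D hθ hθ1 hb
    obtain ⟨K, hK, hKsmall⟩ := exists_order_constant (C := 1200) κ₁ κ₂ σ₀ D (by norm_num) hθ hb
    refine ⟨K, hK, ?_⟩
    intro p d n hp hd hn hdK hdn hnK Sig σ hSig hdiag hirr hκ₁ hκ₂ hD hσ hmin Ω _ P _ A X W h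
    rcases hp.eq_or_lt with rfl | hp2
    · exact prob_le_one.trans (ENNReal.one_le_ofReal.2 (one_le_failureBound_one d))
    obtain ⟨hsmall, hsignal⟩ := hKsmall p d n hp2 hd hdK hdn hnK Sig σ hSig hdiag hκ₁ hκ₂ hD hσ
    refine (measure_mono ?_).trans
      (h.measure_not_recoversPrecision_le hp hd hn hSig hdiag hθ hθ1 hirr hsmall)
    rintro ω hω ⟨T, hT, -, -, hsign⟩
    exact hω ⟨T, hT, hsign fun i j hij hS => hsignal.trans (hmin i j hij hS)⟩
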